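/- **Setting.** Let $M$ be a closed oriented triangulated 4-manifold. Let a covering complex $\tilde M\to M$ with group $\Gamma$ of covering transformations (for instance the universal cover) be mapped into $\mathbb R^4$, equivariantly with respect to a homomorphism from $\Gamma$ to the Euclidean motions, so that every 4-simplex has a nondegenerate image. A 4-simplex has the sign $+$ or $-$ according to whether the map preserves or reverses its orientation. Let $L_a$ be the squared length of the edge $a$, $S_i$ the area of the 2-face $i$ and $V_\sigma$ the volume of the 4-simplex $\sigma$. Let $\omega_i$ be the deficit angle at the 2-face $i$, that is, modulo $2\pi$, minus the sum of the dihedral angles at $i$ of the surrounding 4-simplices taken with their signs. It is regarded as a function of the independent variables $L_a$, and its partial derivatives are taken at the lengths coming from $\mathbb R^4$. The matrix $(\partial\Omega_a/\partial S_i)$, defining a map $(dS_i)\to(d\Omega_a)$, is the transpose of $(\partial\omega_i/\partial L_a)$, which defines a map $(dL_a)\to(d\omega_i)$. A deviation of an edge $AB$ is an infinitesimal vector $d\vec v_{AB}\in\mathbb R^4$ orthogonal to $AB$, regarded as a displacement of the midpoint of $AB$ (in $\tilde M$ the deviations are $\Gamma$-equivariant). Deviations of the edges of a triangle $ABC$ produce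 $dS_{ABC}=4S_{A'B'C'}-S_{ABC}$ to first order, where $A',B',C'$ are the displaced midpoints of the sides. This is the linear map $(\partial S_i/\partial\vec v_a)\colon(d\vec v_a)\to(dS_i)$. Let $\mathcal D$ be a set of 2-faces and $\mathcal C$ a set of edges such that the submatrix $\mathcal B={}_{\mathcal D}(\partial\omega_i/\partial L_a)_{\mathcal C}$ is a maximal nondegenerate square submatrix. The invariant of moves $3\to3$ is, up to sign, $$\frac{\prod_{\text{2-faces}}S_i}{\prod_{\text{4-simplices}}V_\sigma}\cdot\frac1{\det\mathcal B}\;\bigwedge_{a\notin\mathcal C}dL_a\;\otimes\bigwedge_{i\notin\mathcal D}dS_i ,$$ where the first form is considered on $\operatorname{Ker}(\partial\omega_i/\partial L_a)$ and the second one on $\operatorname{Ker}(\partial\Omega_a/\partial S_i)$. **Theorem.** Assume that $$\operatorname{Ker}(\partial\Omega_a/\partial S_i)\subset\operatorname{Im}(\partial S_i/\partial\vec v_a),$$ so that the form $\bigwedge dS_i$ can be expressed through edge deviations, i.e. pulled back to a space $U$ of edge deviations that is mapped isomorphically onto $\operatorname{Ker}(\partial\Omega_a/\partial S_i)$. Let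 a Pachner move $2\to4$, with all 4-simplices before and after it nondegenerate, add a new edge $AB$. Let $N$ be the space of deviations of $AB$, and let $dv_x,dv_y,dv_z$ be the components of the deviation of $AB$ in an orthonormal basis of the orthogonal complement of $AB$. Then the same inclusion holds for the new triangulation, the space $U\oplus N$ is mapped isomorphically onto the new kernel $\operatorname{Ker}(\partial\Omega_a/\partial S_i)$, and, with its form $\bigwedge dS_i$ expressed through edge deviations in $U$ before the move and in $U\oplus N$ after it, the invariant gets multiplied under the move by $$\pm72\,L_{AB}^{5/2}\,dv_x\wedge dv_y\wedge dv_z .$$ This holds for all choices of $\mathcal C$ and $\mathcal D$ before and after the move, the sign depending only on these choices, on the orderings in the exterior products and determinants, and on the basis of the orthogonal complement of $AB$. -/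

import Mathlib

open scoped Pointwise

noncomputable section

namespace Pachner

/-- Euclidean space `ℝ⁴`. -/
abbrev E4 := EuclideanSpace ℝ (Fin 4)

/-! ### Euclidean simplices in terms of squared edge lengths -/

section Simplex

variable {ι : Type*} [Fintype ι] [DecidableEq ι]

/-- Squared distances between the points of a configuration. -/
def sqDist {E : Type*} [NormedAddCommGroup E] (y : ι → E) (p q : ι) : ℝ := ‖y p - y q‖ ^ 2

/-- The Cayley–Menger matrix of the squared edge lengths `ℓ`
(the index `none` is the row and column bordering the matrix `ℓ`). -/
def cayleyMenger (ℓ : ι → ι → ℝ) : Matrix (Option ι) (Option ι) ℝ :=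
  Matrix.of fun
    | none, none => 0
    | none, some _ => 1
    | some _, none => 1
    | some p, some q => ℓ p q

/-- The volume of the Euclidean simplex with vertex set `ι` and squared edge lengths `ℓ`,
in the dimension `k = |ι| - 1` of the simplex (length, area, ..., for `k = 1, 2, ...`):
`(-1)^(k+1) 2^k (k!)² V² = det CM`. -/
def simplexVolume (ℓ : ι → ι → ℝ) : ℝ :=
  Real.sqrt ((-1) ^ Fintype.card ι * (cayleyMenger ℓ).det / 2 ^ (Fintype.card ι - 1)) /
    (Nat.factorial (Fintype.card ι - 1))

/-- The inner dihedral angle of the Euclidean simplex with vertex set `ι` and squared edge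
lengths `ℓ` at the face of codimension two that contains all the vertices except `k` and `l`,
as a function of the squared edge lengths: the entries of the inverse of the Cayley–Menger matrix
are `-1/2` times the inner products of the gradients of barycentric coordinates, which are the
inner normals of the facets. See `dihedralAngle_sqDist` for the geometric meaning. -/
def dihedralAngle (ℓ : ι → ι → ℝ) (k l : ι) : ℝ :=
  Real.arccos ((cayleyMenger ℓ)⁻¹ (some k) (some l) /
    Real.sqrt ((cayleyMenger ℓ)⁻¹ (some k) (some k) * (cayleyMenger ℓ)⁻¹ (some l) (some l)))

set_option linter.unusedSectionVars false in
theorem sum_sqDist_mul {E : Type*} [NormedAddCommGroup E] [InnerProductSpace ℝ E]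
    (y : ι → E) (x : ι → ℝ) (hx : ∑ q, x q = 0) (p : ι) :
    ∑ q, sqDist y p q * x q = -2 * inner ℝ (y p) (∑ q, x q • y q) + ∑ q, ‖y q‖ ^ 2 * x q := by
  have h : ∀ q, sqDist y p q * x q =
      ‖y p‖ ^ 2 * x q + -2 * (x q * inner ℝ (y p) (y q)) + ‖y q‖ ^ 2 * x q := by
    intro q
    rw [sqDist, norm_sub_sq_real]
    ring
  simp only [h, Finset.sum_add_distrib, ← Finset.mul_sum, hx, inner_sum, inner_smul_right]
  ring

theorem isUnit_cayleyMenger {E : Type*} [NormedAddCommGroup E] [InnerProductSpace ℝ E]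
    {y : ι → E} (hy : AffineIndependent ℝ y) (k : ι) :
    IsUnit (cayleyMenger (sqDist y)).det := by
  rw [← Matrix.isUnit_iff_isUnit_det, ← Matrix.mulVec_injective_iff_isUnit]
  refine (injective_iff_map_eq_zero (cayleyMenger (sqDist y)).mulVecLin).2 fun x hx => ?_
  have h0 : ∑ q, x (some q) = 0 := by
    have := congrFun hx none
    simpa [cayleyMenger, Matrix.mulVec, dotProduct, Fintype.sum_option] using this
  have h1 : ∀ p, x none + ∑ q, sqDist y p q * x (some q) = 0 := by
    intro p
    have := congrFun hx (some p)
    simpa [cayleyMenger, Matrix.mulVec, dotProduct, Fintype.sum_option] using this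
  simp only [sum_sqDist_mul y (fun q => x (some q)) h0] at h1
  set Z := ∑ q, x (some q) • y q with hZ
  have hZ0 : inner ℝ Z Z = 0 := by
    conv_lhs => enter [2]; rw [hZ]
    rw [sum_inner]
    have : ∀ q, inner ℝ (x (some q) • y q) Z =
        x (some q) * ((x none + ∑ q, ‖y q‖ ^ 2 * x (some q)) / 2) := by
      intro q
      rw [real_inner_smul_left]
      linear_combination (-x (some q) / 2) * h1 q
    simp only [this, ← Finset.sum_mul, h0, zero_mul]
  have h2 : ∀ q, x (some q) = 0 := fun q =>
    affineIndependent_iff.1 hy Finset.univ (fun q => x (some q)) h0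
      (inner_self_eq_zero.1 hZ0) q (Finset.mem_univ q)
  funext i
  rcases i with _ | q
  · simpa [h2, inner_self_eq_zero.1 hZ0] using h1 k
  · exact h2 q

/-- Geometric meaning of `dihedralAngle`: for a nondegenerate simplex with vertices `y q`, it is the
angle between the components of the vectors to `y k` and to `y l` from a point `y p` of the face
that does not contain `y k` and `y l` which are orthogonal to this face. -/
theorem dihedralAngle_sqDist {E : Type*} [NormedAddCommGroup E] [InnerProductSpace ℝ E]
    {y : ι → E} (hy : AffineIndependent ℝ y) {k l p : ι} (hkl : k ≠ l) (hpk : p ≠ k) (hpl : p ≠ l)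
    {u v : E} (hu : u ∈ (vectorSpan ℝ (y '' {k, l}ᶜ))ᗮ) (hv : v ∈ (vectorSpan ℝ (y '' {k, l}ᶜ))ᗮ)
    (huk : y k - y p - u ∈ vectorSpan ℝ (y '' {k, l}ᶜ))
    (hvl : y l - y p - v ∈ vectorSpan ℝ (y '' {k, l}ᶜ)) :
    dihedralAngle (sqDist y) k l = InnerProductGeometry.angle u v := by
  set F := vectorSpan ℝ (y '' {k, l}ᶜ) with hF
  set M := cayleyMenger (sqDist y) with hM
  have hMM : M * M⁻¹ = 1 := Matrix.mul_nonsing_inv _ (isUnit_cayleyMenger hy k)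
  have hsymm : M⁻¹ (some k) (some l) = M⁻¹ (some l) (some k) := by
    have hT : M.transpose = M := by
      ext i j
      rcases i with _ | i <;> rcases j with _ | j <;>
        simp [hM, cayleyMenger, sqDist, norm_sub_rev]
    have := congrFun (congrFun (Matrix.transpose_nonsing_inv M) (some l)) (some k)
    rwa [hT, Matrix.transpose_apply] at this
  have h0 : ∀ j, ∑ q, M⁻¹ (some q) (some j) = 0 := by
    intro j
    have := congrFun (congrFun hMM none) (some j)
    simpa [hM, cayleyMenger, Matrix.mul_apply, Fintype.sum_option] using this
  have h1 : ∀ i j, M⁻¹ none (some j) + ∑ q, sqDist y i q * M⁻¹ (some q) (some j) =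
      if i = j then 1 else 0 := by
    intro i j
    have := congrFun (congrFun hMM (some i)) (some j)
    simpa [hM, cayleyMenger, Matrix.mul_apply, Fintype.sum_option, Matrix.one_apply] using this
  let Z : ι → E := fun j => ∑ q, M⁻¹ (some q) (some j) • y q
  have h2 : ∀ i i' j, inner ℝ (y i - y i') (Z j) =
      -((if i = j then 1 else 0) - if i' = j then 1 else 0) / 2 := by
    intro i i' j
    have e := h1 i j
    have e' := h1 i' j
    rw [sum_sqDist_mul y (fun q => M⁻¹ (some q) (some j)) (h0 j)] at e e'
    rw [← e, ← e', inner_sub_left]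
    ring
  have hZF : ∀ j, j = k ∨ j = l → ∀ d ∈ F, inner ℝ d (Z j) = 0 := by
    intro j hj d hd
    rw [hF, vectorSpan_def] at hd
    induction hd using Submodule.span_induction with
    | mem d hd =>
      obtain ⟨_, ⟨i, hi, rfl⟩, _, ⟨i', hi', rfl⟩, rfl⟩ := hd
      simp only [Set.mem_compl_iff, Set.mem_insert_iff, Set.mem_singleton_iff, not_or] at hi hi'
      have a1 : i ≠ j := by rcases hj with rfl | rfl <;> tauto
      have a2 : i' ≠ j := by rcases hj with rfl | rfl <;> tauto
      show inner ℝ (y i - y i') (Z j) = 0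
      rw [h2]
      simp [a1, a2]
    | zero => simp
    | add a c _ _ ha hc => rw [inner_add_left, ha, hc, add_zero]
    | smul r a _ ha => rw [inner_smul_left, ha, mul_zero]
  have hw : ∀ w ∈ Fᗮ, ∀ j, inner ℝ w (Z j) =
      M⁻¹ (some k) (some j) * inner ℝ w u + M⁻¹ (some l) (some j) * inner ℝ w v := by
    intro w hw j
    have e1 : Z j = ∑ q, M⁻¹ (some q) (some j) • (y q - y p) := by
      simp only [smul_sub, Finset.sum_sub_distrib, ← Finset.sum_smul, h0 j, zero_smul, sub_zero, Z]
    have hwF : ∀ d ∈ F, inner ℝ w d = 0 := fun d hd => by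
      rw [real_inner_comm]; exact (Submodule.mem_orthogonal F w).1 hw d hd
    have ek : inner ℝ w (y k - y p) = inner ℝ w u := by
      have := hwF _ huk
      rw [inner_sub_right] at this
      linarith
    have el : inner ℝ w (y l - y p) = inner ℝ w v := by
      have := hwF _ hvl
      rw [inner_sub_right] at this
      linarith
    rw [e1, inner_sum, ← ek, ← el]
    simp only [inner_smul_right]
    rw [← Finset.sum_pair (f := fun q => M⁻¹ (some q) (some j) * inner ℝ w (y q - y p)) hkl]
    symm
    refine Finset.sum_subset (Finset.subset_univ _) fun q _ hq => ?_
    simp only [Finset.mem_insert, Finset.mem_singleton, not_or] at hq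
    have : y q - y p ∈ F := vsub_mem_vectorSpan ℝ
      (Set.mem_image_of_mem y (by simp [hq])) (Set.mem_image_of_mem y (by simp [hpk, hpl]))
    rw [hwF _ this, mul_zero]
  have hin : ∀ j, j = k ∨ j = l → Z j ∈ Fᗮ := fun j hj =>
    (Submodule.mem_orthogonal F (Z j)).2 fun d hd => hZF j hj d hd
  have euk : ∀ j, j = k ∨ j = l → inner ℝ u (Z j) = inner ℝ (y k - y p) (Z j) := by
    intro j hj
    have := hZF j hj _ huk
    rw [inner_sub_left] at this
    linarith
  have evl : ∀ j, j = k ∨ j = l → inner ℝ v (Z j) = inner ℝ (y l - y p) (Z j) := by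
    intro j hj
    have := hZF j hj _ hvl
    rw [inner_sub_left] at this
    linarith
  have u_k : inner ℝ u (Z k) = (-1 / 2 : ℝ) := by rw [euk k (Or.inl rfl), h2]; simp [hpk]
  have u_l : inner ℝ u (Z l) = (0 : ℝ) := by rw [euk l (Or.inr rfl), h2]; simp [hpl, hkl]
  have v_k : inner ℝ v (Z k) = (0 : ℝ) := by rw [evl k (Or.inl rfl), h2]; simp [hpk, hkl.symm]
  have v_l : inner ℝ v (Z l) = (-1 / 2 : ℝ) := by rw [evl l (Or.inr rfl), h2]; simp [hpl]
  have g1 := hw u hu k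
  have g2 := hw v hv k
  have g3 := hw u hu l
  have g4 := hw v hv l
  have n1 := hw (Z k) (hin k (Or.inl rfl)) k
  have n2 := hw (Z l) (hin l (Or.inr rfl)) l
  rw [real_inner_comm u (Z k), real_inner_comm v (Z k), u_k, v_k] at n1
  rw [real_inner_comm u (Z l), real_inner_comm v (Z l), u_l, v_l] at n2
  have p1 : 0 < inner ℝ (Z k) (Z k) := real_inner_self_pos.2 fun h => by
    rw [h, inner_zero_right] at u_k; norm_num at u_k
  have p2 : 0 < inner ℝ (Z l) (Z l) := real_inner_self_pos.2 fun h => by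
    rw [h, inner_zero_right] at v_l; norm_num at v_l
  have q1 : 0 < ‖u‖ := norm_pos_iff.2 fun h => by
    rw [h, inner_zero_left] at u_k; norm_num at u_k
  have q2 : 0 < ‖v‖ := norm_pos_iff.2 fun h => by
    rw [h, inner_zero_left] at v_l; norm_num at v_l
  rw [u_k] at g1
  rw [v_k, real_inner_comm u v] at g2
  rw [u_l] at g3
  rw [v_l, real_inner_comm u v] at g4
  rw [real_inner_self_eq_norm_sq] at g1 g2 g3 g4
  rw [InnerProductGeometry.angle, dihedralAngle, ← hM]
  congr 1
  rw [← hsymm] at g1 g2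
  generalize M⁻¹ (some k) (some l) = β at *
  generalize M⁻¹ (some k) (some k) = a at *
  generalize M⁻¹ (some l) (some l) = c at *
  generalize inner ℝ u v = G at *
  have ha : a < 0 := by linarith
  have hc : c < 0 := by linarith
  have hac : 0 < a * c := mul_pos_of_neg_of_neg ha hc
  have hs : 0 < Real.sqrt (a * c) := Real.sqrt_pos.2 hac
  have hs2 : Real.sqrt (a * c) ^ 2 = a * c := Real.sq_sqrt hac.le
  generalize Real.sqrt (a * c) = s at *
  rw [div_eq_div_iff hs.ne' (mul_pos q1 q2).ne']
  have hsq : (G * s) ^ 2 = (β * (‖u‖ * ‖v‖)) ^ 2 := by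
    have e1 : a * G = -(β * ‖v‖ ^ 2) := by linarith
    have e2 : c * G = -(β * ‖u‖ ^ 2) := by linarith
    calc (G * s) ^ 2 = (a * G) * (c * G) := by rw [mul_pow, hs2]; ring
      _ = (β * (‖u‖ * ‖v‖)) ^ 2 := by rw [e1, e2]; ring
  have hsgn : 0 ≤ β * G := by
    have e2 : c * (β * G) = -((β * ‖u‖) ^ 2) := by linear_combination (-β) * g3
    by_contra hneg
    nlinarith [sq_nonneg (β * ‖u‖), mul_pos_of_neg_of_neg hc (not_le.1 hneg)]
  rcases sq_eq_sq_iff_eq_or_eq_neg.1 hsq with h | h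
  · exact h.symm
  · have h3 : 0 ≤ (β * (‖u‖ * ‖v‖)) * (G * s) := by
      have : (β * (‖u‖ * ‖v‖)) * (G * s) = (β * G) * (‖u‖ * ‖v‖ * s) := by ring
      rw [this]; positivity
    rw [h] at h3
    have h4 : β * (‖u‖ * ‖v‖) = 0 := by nlinarith [sq_nonneg (β * (‖u‖ * ‖v‖))]
    rw [h, h4, neg_zero]

end Simplex

/-! ### Developed triangulations -/

/-- Points `pos w` of `ℝ⁴` for the vertices `w` of a covering complex on which the group `Γ` of
covering transformations acts, equivariant under a representation `hol` of `Γ` by Euclidean motions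
of `ℝ⁴`. -/
structure Development (Γ W : Type*) [Group Γ] [MulAction Γ W] where
  /-- the image of a vertex in `ℝ⁴` -/
  pos : W → E4
  /-- the holonomy representation -/
  hol : Γ →* (E4 ≃ᵃⁱ[ℝ] E4)
  pos_smul : ∀ (g : Γ) (w : W), pos (g • w) = hol g (pos w)

variable {Γ W : Type*} [Group Γ] [MulAction Γ W] [DecidableEq W]

/-- A triangulation of a closed oriented four-dimensional manifold (more generally, pseudomanifold) `M`, given through
a covering complex `M̃` (for instance the universal cover) with vertices in `W` and with group of
covering transformations `Γ`, together with the signs of the 4-simplices, and mapped into `ℝ⁴`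
by `X`. A cell of `M̃` is the finite set of its vertices; the cells of `M` are `Γ`-orbits of cells
of `M̃`. -/
structure Triangulation (X : Development Γ W) where
  /-- the 4-simplices of the covering complex -/
  simplices : Set (Finset W)
  card_eq : ∀ σ ∈ simplices, σ.card = 5
  smul_mem : ∀ (g : Γ), ∀ σ ∈ simplices, g • σ ∈ simplices
  /-- `Γ` acts freely: no cell is mapped to itself by a nontrivial element. -/
  free : ∀ (g : Γ), ∀ σ ∈ simplices, ∀ s ⊆ σ, s.Nonempty → g • s = s → g = 1
  /-- `M` is compact: it has finitely many 4-simplices. -/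
  finite_orbits : (Set.image (Quotient.mk (MulAction.orbitRel Γ (Finset W))) simplices).Finite
  /-- Every tetrahedron is a common facet of exactly two 4-simplices. -/
  two_sides : ∀ σ ∈ simplices, ∀ τ ⊆ σ, τ.card = 4 → {σ' ∈ simplices | τ ⊆ σ'}.ncard = 2
  /-- Every 4-simplex of the covering complex is mapped to a nondegenerate simplex of `ℝ⁴`. -/
  nondegenerate : ∀ σ ∈ simplices, AffineIndependent ℝ fun p : σ => X.pos p
  /-- The sign of a 4-simplex: `1` or `-1` according to whether the map into `ℝ⁴` preserves
  or reverses its orientation. -/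
  sign : Finset W → ℤˣ
  sign_smul : ∀ (g : Γ), ∀ σ ∈ simplices, sign (g • σ) = sign σ
  /-- The orientation is consistent: two 4-simplices with a common facet have equal signs
  if and only if their images lie on different sides of the image of that facet. -/
  sign_adj : ∀ (τ : Finset W) (p q : W), τ.card = 4 → p ∉ τ → q ∉ τ → p ≠ q →
    insert p τ ∈ simplices → insert q τ ∈ simplices →
    (sign (insert p τ) = sign (insert q τ) ↔
      (affineSpan ℝ (X.pos '' (τ : Set W))).SOppSide (X.pos p) (X.pos q))

/-- Cells of the quotient `M`: orbits of cells of the covering complex. -/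
abbrev Cell (Γ W : Type*) [Group Γ] [MulAction Γ W] [DecidableEq W] : Type _ :=
  MulAction.orbitRel.Quotient Γ (Finset W)

/-- The orbit of a cell of the covering complex. -/
def cell (Γ : Type*) {W : Type*} [Group Γ] [MulAction Γ W] [DecidableEq W] (s : Finset W) :
    Cell Γ W :=
  Quotient.mk (MulAction.orbitRel Γ (Finset W)) s

/-- Edge deviations as vector fields on the edges of the covering complex. -/
abbrev EdgeField (W : Type*) : Type _ := Finset W → E4

/-- The midpoint of the edge `e` (more generally, the centroid of `e`). -/
def Development.midpoint (X : Development Γ W) (e : Finset W) : E4 :=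
  (e.card : ℝ)⁻¹ • ∑ p ∈ e, X.pos p

/-- The squared length `L` of the edge `e = {p, q}` of the covering complex. -/
def Development.sqLength (X : Development Γ W) (e : Finset W) : ℝ :=
  (∑ p ∈ e, ∑ q ∈ e, ‖X.pos p - X.pos q‖ ^ 2) / 2

/-- The area of a triangle, or the four-dimensional volume of a 4-simplex, of the
covering complex. -/
def Development.volume (X : Development Γ W) (s : Finset W) : ℝ :=
  simplexVolume (sqDist fun p : s => X.pos p)

/-- The area of the triangle whose three vertices `y e` correspond to the three edges `e` of the
triangle `t`. -/
def midArea (t : Finset W) (y : t.powersetCard 2 → E4) : ℝ :=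
  simplexVolume (sqDist y)

/-- The differential `dS_t` of the area of the triangle `t` as a linear function of edge
deviations: `S_t` is four times the area of the triangle formed by the midpoints of
the edges of `t`, and the deviations `v e` are displacements of these midpoints. -/
def Development.areaDiff (X : Development Γ W) (t : Finset W) : EdgeField W →ₗ[ℝ] ℝ :=
  (4 : ℝ) • ((fderiv ℝ (midArea t) fun e => X.midpoint e).toLinearMap ∘ₗ
    LinearMap.funLeft ℝ E4 fun e : t.powersetCard 2 => (e : Finset W))

namespace Triangulation

variable {X : Development Γ W} (T : Triangulation X)

/-- The set of cells with `n` vertices of the covering complex. -/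
def coverCells (n : ℕ) : Set (Finset W) := {s | s.card = n ∧ ∃ σ ∈ T.simplices, s ⊆ σ}

/-- The set of cells with `n` vertices of the triangulation. -/
def cells (n : ℕ) : Set (Cell Γ W) := cell Γ '' T.coverCells n

theorem finite_cells (n : ℕ) : (T.cells n).Finite := by
  classical
  refine (T.finite_orbits.biUnion (t := fun q => cell Γ '' (q.out.powerset : Set (Finset W)))
    fun q _ => (Finset.finite_toSet _).image _).subset ?_
  rintro _ ⟨s, ⟨-, σ, hσ, hs⟩, rfl⟩
  refine Set.mem_biUnion (Set.mem_image_of_mem _ hσ) ?_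
  obtain ⟨g, hg⟩ : ∃ g : Γ, g • σ =
      (Quotient.mk (MulAction.orbitRel Γ (Finset W)) σ).out :=
    MulAction.orbitRel_apply.1 (Quotient.mk_out (s := MulAction.orbitRel Γ (Finset W)) σ)
  refine ⟨g • s, ?_, Quotient.sound (s := MulAction.orbitRel Γ (Finset W))
    (MulAction.orbitRel_apply.2 ⟨g, rfl⟩)⟩
  rw [← hg, Finset.mem_coe, Finset.mem_powerset]
  exact Finset.smul_finset_subset_smul_finset hs

instance (n : ℕ) : Fintype (T.cells n) := (T.finite_cells n).fintype

/-- The edges of the triangulation. -/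
abbrev Edge := T.cells 2

/-- The two-dimensional faces of the triangulation. -/
abbrev Face := T.cells 3

/-- The squared length `L p q` of the edge `pq` of the covering complex, for a function `L` on edges
of the triangulation. -/
def pullLength (L : Cell Γ W → ℝ) (p q : W) : ℝ := if p = q then 0 else L (cell Γ {p, q})

/-- The dihedral angle of the 4-simplex `σ` at its two-dimensional face `t`
(each unordered pair of the vertices not in `t` enters the sum twice). -/
def faceAngle (L : Cell Γ W → ℝ) (σ t : Finset W) : ℝ :=
  (∑ k : σ, ∑ l : σ, if k.1 ∉ t ∧ l.1 ∉ t ∧ k ≠ l then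
    dihedralAngle (fun p q : σ => pullLength L p.1 q.1) k l else 0) / 2

/-- The deficit angle at the face `t` (modulo `2π`) as a function of the squared edge lengths
of the triangulation: minus the algebraic sum of dihedral angles. -/
def deficit (L : Cell Γ W → ℝ) (t : Finset W) : ℝ :=
  -∑ᶠ σ ∈ {σ ∈ T.simplices | t ⊆ σ}, ((T.sign σ : ℤ) : ℝ) * faceAngle L σ t

/-- The squared edge lengths of the triangulation determined by the images of vertices
in `ℝ⁴`. -/
def flatLength (X : Development Γ W) (a : Cell Γ W) : ℝ := X.sqLength a.out

open Classical in
/-- The matrix `∂ω_i / ∂L_a` of partial derivatives of deficit angles at two-dimensional faces `i`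
with respect to squared lengths of edges `a`, taken at the lengths of the development. -/
def curvatureMatrix : Matrix T.Face T.Edge ℝ :=
  Matrix.of fun i a =>
    deriv (fun s => T.deficit (Function.update (flatLength X) a.1 s) i.1.out) (flatLength X a.1)

/-- The linear map `(dL_a) → (dω_i)`. -/
def dω : (T.Edge → ℝ) →ₗ[ℝ] (T.Face → ℝ) := T.curvatureMatrix.mulVecLin

/-- The linear map `(dS_i) → (dΩ_a)`, whose matrix `∂Ω_a / ∂S_i` is conjugate
(transposed) to `∂ω_i / ∂L_a`. -/
def dΩ : (T.Face → ℝ) →ₗ[ℝ] (T.Edge → ℝ) := T.curvatureMatrix.transpose.mulVecLin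

/-- The space of edge deviations of the triangulation: a vector orthogonal to the edge for every
edge of the covering complex, the vectors at edges of the same orbit being related by the
corresponding motion of `ℝ⁴`. -/
def deviations : Submodule ℝ (EdgeField W) where
  carrier := {v | (∀ e ∉ T.coverCells 2, v e = 0) ∧
    (∀ e ∈ T.coverCells 2, ∀ p ∈ e, ∀ q ∈ e, inner ℝ (v e) (X.pos p - X.pos q) = 0) ∧
    ∀ (g : Γ), ∀ e ∈ T.coverCells 2, v (g • e) = (X.hol g).linearIsometryEquiv (v e)}
  add_mem' := by
    rintro v w ⟨h1, h2, h3⟩ ⟨k1, k2, k3⟩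
    refine ⟨fun e he => by simp [h1 e he, k1 e he], fun e he p hp q hq => ?_, fun g e he => ?_⟩
    · rw [Pi.add_apply, inner_add_left, h2 e he p hp q hq, k2 e he p hp q hq, add_zero]
    · rw [Pi.add_apply, Pi.add_apply, map_add, h3 g e he, k3 g e he]
  zero_mem' := by simp
  smul_mem' := by
    rintro c v ⟨h1, h2, h3⟩
    refine ⟨fun e he => by simp [h1 e he], fun e he p hp q hq => ?_, fun g e he => ?_⟩
    · rw [Pi.smul_apply, inner_smul_left, h2 e he p hp q hq, mul_zero]
    · rw [Pi.smul_apply, Pi.smul_apply, map_smul, h3 g e he]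

/-- Edge deviations all of which vanish outside the orbit of the edge `e`. -/
def deviationsAt (e : Finset W) : Submodule ℝ (EdgeField W) where
  carrier := {v | v ∈ T.deviations ∧ ∀ e', cell Γ e' ≠ cell Γ e → v e' = 0}
  add_mem' := by
    rintro v w ⟨h1, h2⟩ ⟨k1, k2⟩
    exact ⟨add_mem h1 k1, fun e' he => by simp [h2 e' he, k2 e' he]⟩
  zero_mem' := ⟨zero_mem _, fun _ _ => rfl⟩
  smul_mem' := by
    rintro c v ⟨h1, h2⟩
    exact ⟨Submodule.smul_mem _ c h1, fun e' he => by simp [h2 e' he]⟩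

/-- The map `(dv_a) → (dS_i)` with matrix `∂S_i / ∂v_a`. -/
def dS : EdgeField W →ₗ[ℝ] (T.Face → ℝ) := LinearMap.pi fun i => X.areaDiff i.1.out

/-- The inclusion `Ker (∂Ω_a / ∂S_i) ⊆ Im (∂S_i / ∂v_a)`. -/
def KerSubsetIm : Prop := LinearMap.ker T.dΩ ≤ T.deviations.map T.dS

/-- The values on the edges of `T` of a function on cells. -/
def onEdges (h : Cell Γ W → ℝ) : T.Edge → ℝ := fun a => h a.1

/-- A choice of a maximal nondegenerate square submatrix `B` of the matrix `∂ω_i / ∂L_a`: the edges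
`edges (inl _)` form the subset `𝒞`, the faces `faces (inl _)` form the subset `𝒟`, and those with
`inr` form their complements; all four sets come with an ordering. -/
structure MinorChoice (r m d : ℕ) where
  edges : Fin r ⊕ Fin m ≃ T.Edge
  faces : Fin r ⊕ Fin d ≃ T.Face
  rank_eq : T.curvatureMatrix.rank = r
  det_ne_zero : (T.curvatureMatrix.submatrix (faces ∘ Sum.inl) (edges ∘ Sum.inl)).det ≠ 0

end Triangulation

/-- The exterior product `⋀_i f_i` of linear functions. -/
def wedgeForms {V ι : Type*} [AddCommGroup V] [Module ℝ V] [Fintype ι] [DecidableEq ι]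
    (f : ι → V →ₗ[ℝ] ℝ) : V [⋀^ι]→ₗ[ℝ] ℝ :=
  (Matrix.detRowAlternating (R := ℝ) (n := ι)).compLinearMap (LinearMap.pi f)

/-- The exterior product of two exterior forms. -/
def wedge {V ι κ : Type*} [AddCommGroup V] [Module ℝ V] [Fintype ι] [DecidableEq ι]
    [Fintype κ] [DecidableEq κ] (α : V [⋀^ι]→ₗ[ℝ] ℝ) (β : V [⋀^κ]→ₗ[ℝ] ℝ) :
    V [⋀^ι ⊕ κ]→ₗ[ℝ] ℝ :=
  (LinearMap.mul' ℝ ℝ).compAlternatingMap (α.domCoprod β)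

namespace Triangulation

variable {X : Development Γ W} (T : Triangulation X)

/-- The invariant of moves `3 → 3`, for a given choice of `𝒞` and `𝒟`:
`(∏ S_i / ∏ V_σ) · (det B)⁻¹ · ⋀_{a ∉ 𝒞} dL_a ⊗ ⋀_{i ∉ 𝒟} dS_i`,
the products being over all two-dimensional faces and all 4-simplices. It is a product of two
exterior forms on two different spaces; it is written here as a form on the space `(dL_a)`
whose values are forms on the space `(dS_i)`. -/
def invariant {r m d : ℕ} (φ : T.MinorChoice r m d) :
    (T.Edge → ℝ) [⋀^Fin m]→ₗ[ℝ] ((T.Face → ℝ) [⋀^Fin d]→ₗ[ℝ] ℝ) :=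
  (((∏ i : T.Face, X.volume i.1.out) / (∏ σ : T.cells 5, X.volume σ.1.out)) *
    (T.curvatureMatrix.submatrix (φ.faces ∘ Sum.inl) (φ.edges ∘ Sum.inl)).det⁻¹) •
  (LinearMap.toSpanSingleton ℝ _
    (wedgeForms fun j : Fin d => LinearMap.proj (φ.faces (Sum.inr j)))).compAlternatingMap
    (wedgeForms fun j : Fin m => LinearMap.proj (φ.edges (Sum.inr j)))

/-- The invariant with its factor `⋀ dS` expressed through edge deviations by means of the map
`(dv_a) → (dS_i)`, and with its factor `⋀ dL` evaluated at `h`. -/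
def invariantDev {r m d : ℕ} (φ : T.MinorChoice r m d) (h : Fin m → T.Edge → ℝ) :
    EdgeField W [⋀^Fin d]→ₗ[ℝ] ℝ :=
  (T.invariant φ h).compLinearMap T.dS

end Triangulation

/-- `T'` is obtained from `T` by the Pachner move `2 → 4` that replaces two adjoining 4-simplices
`A * κ` and `B * κ`, `κ = CDEF`, with the four 4-simplices having the edge `AB` in common and
a face `κ \ {c}` of `κ` opposite to it. In the covering complex this is done in all copies of the
two 4-simplices. The orientation is left unchanged outside these simplices and on
the tetrahedra of the common boundary of the two clusters. -/
structure IsMove24 {X : Development Γ W} (T T' : Triangulation X) (A B : W) (κ : Finset W) :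
    Prop where
  card_eq : κ.card = 4
  ne : A ≠ B
  notMem_left : A ∉ κ
  notMem_right : B ∉ κ
  mem_left : insert A κ ∈ T.simplices
  mem_right : insert B κ ∈ T.simplices
  /-- The two 4-simplices of the triangulation are different. -/
  cell_ne : cell Γ (insert A κ) ≠ cell Γ (insert B κ)
  /-- The edge `AB` is new. -/
  edge_new : {A, B} ∉ T.coverCells 2
  simplices_eq : T'.simplices =
    (T.simplices \ {σ | cell Γ σ = cell Γ (insert A κ) ∨ cell Γ σ = cell Γ (insert B κ)}) ∪
      {σ | ∃ c ∈ κ, cell Γ σ = cell Γ (insert A (insert B (κ.erase c)))}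
  sign_old : ∀ σ ∈ T.simplices, σ ∈ T'.simplices → T'.sign σ = T.sign σ
  sign_left : ∀ c ∈ κ, (T'.sign (insert A (insert B (κ.erase c))) = T.sign (insert A κ) ↔
    (affineSpan ℝ (X.pos '' (insert A (κ.erase c) : Finset W))).SSameSide (X.pos B) (X.pos c))
  sign_right : ∀ c ∈ κ, (T'.sign (insert A (insert B (κ.erase c))) = T.sign (insert B κ) ↔
    (affineSpan ℝ (X.pos '' (insert B (κ.erase c) : Finset W))).SSameSide (X.pos A) (X.pos c))

/-- The form `dv_x ∧ dv_y ∧ dv_z`, where `dv_x, dv_y, dv_z` are the components of the deviation of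
the edge `e` in the directions `b 0, b 1, b 2`. -/
def deviationForm (b : Fin 3 → E4) (e : Finset W) : EdgeField W [⋀^Fin 3]→ₗ[ℝ] ℝ :=
  wedgeForms fun k => (innerₗ E4 (b k)) ∘ₗ LinearMap.proj e

end Pachner

end

/-!
Why the invariant changes by `±72 L_{AB}^{5/2} dv_x ∧ dv_y ∧ dv_z`.

The six vertices `K = {A, B} ∪ κ` of the cluster lie in `ℝ⁴`, so they have an affine dependency `w`, which
is unique up to a scalar and is normalized here so that `|w p|` is the volume of the 4-simplex omitting
`p` (`IsWeight`, `exists_isWeight`). Its signs record the sides of the tetrahedra on which the points lie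
(`IsWeight.sSameSide_iff`), hence also the signs of the 4-simplices.

*Curvature.* The Cayley–Menger determinant of a simplex is that of a face times the Gram determinant
of the heights over this face (`det_cayleyMenger_sum`, `cmDet_union`). This gives the derivative of a
dihedral angle with respect to squared lengths as a quadratic form (`hasDerivAt_dihedralAngle`). In
the sum of the angles over the boundary of the 5-simplex `K` all these forms
combine to a multiple of the single form `(w, N w)` (`IsWeight.sum_angles`): a flat variation does not
change the sum of the angles. Consequently the move changes the matrix `∂ω/∂L` by
a matrix of rank one, `∓ y_i ψ_a` with `y_i` the sum of `S_t / (24 ∏_{p ∉ t} w_p)` over the faces `t`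
of the cluster in the orbit `i` (`faceWeight`) and `ψ_a` the sum of `w_p w_q` over the edges `pq` of the
cluster in the orbit `a` (`edgeWeight`): this is `IsMove24.exists_curvature_eq`. The old matrix has
zeros at the new edge and the new faces.

*Kernels.* An element of the new `Ker (∂ω/∂L)` restricts to one of the old kernel
(`IsMove24.ker_dω_old`). A vector `x` lies in the new `Ker (∂Ω/∂S)` if and only if its restriction lies in the old
one and `∑ y_i x_i = 0` (`IsMove24.mem_ker_dΩ_iff`). The vectors `dS` coming from edge
deviations satisfy the last relation automatically (`sum_areaDiff_eq_zero`,
`IsMove24.sum_faceWeight_dS`), and the deviation of `AB` moves the areas of three of the four new faces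
independently, so that every element of the new kernel is represented by a deviation in `U ⊕ N`
(`IsMove24.exists_dS_add_eq`).

*The form.* Up to sign, `(det B)⁻¹ ⋀ dL ⊗ ⋀ dS` does not depend on the maximal minor `B`
(`invariant_choice_independent`). It is therefore enough to compare a minor before the move with the one
obtained by adding to it the edge `AB` and one new face `ABc₁`. Its determinant acquires the factor
`∓ y_{ABc₁} w_A w_B` (`IsMove24.det_extend`), and `⋀ dS` acquires the Jacobian of the
areas of the other three new faces with respect to the deviation of `AB`
(`IsMove24.det_dS_extend`, `IsMove24.abs_det_areaJacobian`). Together with the new areas and volumes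
these factors combine to `72 L_{AB}^{5/2}` (`IsMove24.exists_factor`).
-/

noncomputable section

set_option linter.unusedSectionVars false

namespace Pachner

/-! ### Minors of maximal order and forms on kernels -/

section Minors

variable {E F R M D : Type*} [Fintype E] [Fintype F] [Fintype R] [Fintype M] [Fintype D]
  [DecidableEq E] [DecidableEq F] [DecidableEq R] [DecidableEq M] [DecidableEq D]

theorem wedgeForms_apply {V ι : Type*} [AddCommGroup V] [Module ℝ V] [Fintype ι] [DecidableEq ι]
    (f : ι → V →ₗ[ℝ] ℝ) (v : ι → V) :
    wedgeForms f v = (Matrix.of fun i j => f j (v i)).det := rfl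

theorem wedgeForms_eq_alternatization {V ι : Type*} [AddCommGroup V] [Module ℝ V] [Fintype ι]
    [DecidableEq ι] (f : ι → V →ₗ[ℝ] ℝ) : wedgeForms f =
      MultilinearMap.alternatization ((MultilinearMap.mkPiAlgebra ℝ ι ℝ).compLinearMap f) := by
  ext v
  rw [wedgeForms_apply, Matrix.det_apply]
  simp [MultilinearMap.alternatization_apply]

theorem wedge_wedgeForms {V ι κ : Type*} [AddCommGroup V] [Module ℝ V] [Fintype ι] [DecidableEq ι]
    [Fintype κ] [DecidableEq κ] (f : ι → V →ₗ[ℝ] ℝ) (g : κ → V →ₗ[ℝ] ℝ) :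
    wedge (wedgeForms f) (wedgeForms g) = wedgeForms (Sum.elim f g) := by
  ext v
  rw [wedge, wedgeForms_eq_alternatization f, wedgeForms_eq_alternatization g,
    wedgeForms_eq_alternatization (Sum.elim f g), ← MultilinearMap.domCoprod_alternization]
  simp [MultilinearMap.alternatization_apply]

/-- If the rows of `H` lie in the kernel of `P`, complementary maximal minors of `P` and `H` are
proportional, up to the sign of the permutation relating the two splittings of the columns. -/
theorem det_submatrix_mul_det_compl (P : Matrix R E ℝ) (H : Matrix M E ℝ)
    (hPH : P * H.transpose = 0) (e e' : R ⊕ M ≃ E) :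
    ((Equiv.Perm.sign (e.trans e'.symm) : ℤ) : ℝ) *
      ((P.submatrix id (e' ∘ Sum.inl)).det * (H.submatrix id (e ∘ Sum.inr)).det) =
      (P.submatrix id (e ∘ Sum.inl)).det * (H.submatrix id (e' ∘ Sum.inr)).det := by
  let Y : Matrix E R ℝ := (1 : Matrix E E ℝ).submatrix id (e ∘ Sum.inl)
  let N : Matrix E (R ⊕ M) ℝ := Matrix.fromCols Y H.transpose
  have hN : (N.submatrix e id).det = (H.submatrix id (e ∘ Sum.inr)).det := by
    have : N.submatrix e id = Matrix.fromBlocks 1 (H.transpose.submatrix (e ∘ Sum.inl) id) 0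
        (H.submatrix id (e ∘ Sum.inr)).transpose := by
      ext i j
      rcases i with i | i <;> rcases j with j | j <;> simp [N, Y, Matrix.one_apply]
    rw [this, Matrix.det_fromBlocks_zero₂₁, Matrix.det_one, one_mul, Matrix.det_transpose]
  have hN' : (N.submatrix e' id).det =
      ((Equiv.Perm.sign (e.trans e'.symm) : ℤ) : ℝ) * (N.submatrix e id).det := by
    have h1 : N.submatrix e' id = (N.submatrix e id).submatrix (e.trans e'.symm).symm id := by
      ext i j; simp
    rw [h1, Matrix.det_permute, Equiv.Perm.sign_symm]
  let J : Matrix (R ⊕ M) E ℝ :=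
    Matrix.fromRows P ((1 : Matrix E E ℝ).submatrix (e' ∘ Sum.inr) id)
  have hJN : J * N = Matrix.fromBlocks (P.submatrix id (e ∘ Sum.inl)) 0
      (Y.submatrix (e' ∘ Sum.inr) id) (H.submatrix id (e' ∘ Sum.inr)).transpose := by
    simp only [J, N, Matrix.fromRows_mul_fromCols, hPH]
    congr 1
    · ext i j; simp [Y, Matrix.mul_apply, Matrix.one_apply]
    · ext i j; simp [Matrix.mul_apply, Matrix.one_apply]
    · ext i j; simp [Matrix.mul_apply, Matrix.one_apply]
  have hJ : (J.submatrix id e').det = (P.submatrix id (e' ∘ Sum.inl)).det := by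
    have : J.submatrix id e' = Matrix.fromBlocks (P.submatrix id (e' ∘ Sum.inl))
        (P.submatrix id (e' ∘ Sum.inr)) 0 1 := by
      ext i j
      rcases i with i | i <;> rcases j with j | j <;> simp [J, Matrix.one_apply]
    rw [this, Matrix.det_fromBlocks_zero₂₁, Matrix.det_one, mul_one]
  have key : (J * N).det = (J.submatrix id e').det * (N.submatrix e' id).det := by
    rw [← Matrix.det_mul, Matrix.submatrix_mul_equiv]
    rfl
  rw [hJN, Matrix.det_fromBlocks_zero₁₂, Matrix.det_transpose, hJ, hN', hN] at key
  rw [key]; ring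

/-- A real matrix of rank `r` is a product of matrices with `r` columns and `r` rows. -/
theorem exists_rank_factorization (Q : Matrix F E ℝ) (hQ : Q.rank = Fintype.card R) :
    ∃ (A : Matrix F R ℝ) (G : Matrix R E ℝ), Q = A * G := by
  have hfr : Module.finrank ℝ (LinearMap.range Q.mulVecLin) = Fintype.card R := hQ
  let b : Module.Basis R ℝ (LinearMap.range Q.mulVecLin) :=
    (Module.finBasisOfFinrankEq ℝ _ hfr).reindex (Fintype.equivFin R).symm
  refine ⟨Matrix.of fun i k => (b k : F → ℝ) i,
    Matrix.of fun k a => b.repr ⟨Q.mulVecLin (Pi.single a 1), LinearMap.mem_range_self _ _⟩ k, ?_⟩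
  ext i a
  have h := congrArg Subtype.val
    (b.sum_repr ⟨Q.mulVecLin (Pi.single a 1), LinearMap.mem_range_self _ _⟩)
  have h' := congrFun h i
  simp only [Submodule.coe_sum, Submodule.coe_smul, Finset.sum_apply, Pi.smul_apply,
    smul_eq_mul, Matrix.mulVecLin_apply, Matrix.mulVec_single_one, Matrix.col_apply] at h'
  rw [Matrix.mul_apply, ← h']
  refine Finset.sum_congr rfl fun k _ => ?_
  simp only [Matrix.of_apply, Matrix.mulVecLin_apply, Matrix.mulVec_single_one]
  exact mul_comm _ _

/-- The value of `(det B)⁻¹ ⋀_{a ∉ 𝒞} dL_a ⊗ ⋀_{i ∉ 𝒟} dS_i` on vectors of the kernels of `Q` and of its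
transpose does not depend on the maximal minor `B`, up to a sign which does not depend on the vectors. -/
theorem invariant_choice_independent {Q : Matrix F E ℝ} (hQ : Q.rank = Fintype.card R)
    (e e' : R ⊕ M ≃ E) (f f' : R ⊕ D ≃ F)
    (h : (Q.submatrix (f ∘ Sum.inl) (e ∘ Sum.inl)).det ≠ 0)
    (h' : (Q.submatrix (f' ∘ Sum.inl) (e' ∘ Sum.inl)).det ≠ 0) :
    ∃ ε : ℝ, (ε = 1 ∨ ε = -1) ∧ ∀ (H : Matrix M E ℝ) (X : Matrix D F ℝ),
      Q * H.transpose = 0 → X * Q = 0 →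
      (Q.submatrix (f' ∘ Sum.inl) (e' ∘ Sum.inl)).det⁻¹ * (H.submatrix id (e' ∘ Sum.inr)).det *
          (X.submatrix id (f' ∘ Sum.inr)).det =
        ε * ((Q.submatrix (f ∘ Sum.inl) (e ∘ Sum.inl)).det⁻¹ *
          (H.submatrix id (e ∘ Sum.inr)).det * (X.submatrix id (f ∘ Sum.inr)).det) := by
  obtain ⟨A, G, rfl⟩ := exists_rank_factorization (R := R) Q hQ
  have hsub : ∀ (f : R ⊕ D ≃ F) (e : R ⊕ M ≃ E),
      ((A * G).submatrix (f ∘ Sum.inl) (e ∘ Sum.inl)).det =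
        (A.submatrix (f ∘ Sum.inl) id).det * (G.submatrix id (e ∘ Sum.inl)).det := by
    intro f e
    rw [← Matrix.det_mul]
    rfl
  rw [hsub] at h h'
  obtain ⟨hA, hG⟩ := mul_ne_zero_iff.1 h
  obtain ⟨hA', hG'⟩ := mul_ne_zero_iff.1 h'
  refine ⟨((Equiv.Perm.sign (e.trans e'.symm) * Equiv.Perm.sign (f.trans f'.symm) : ℤˣ) : ℤ),
    ?_, fun H X hH hX => ?_⟩
  · rcases Int.units_eq_one_or
      (Equiv.Perm.sign (e.trans e'.symm) * Equiv.Perm.sign (f.trans f'.symm)) with h | h <;>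
      simp [h]
  -- left and right cancellation of the factors of full rank
  have hGH : G * H.transpose = 0 := by
    have h1 : A.submatrix (f ∘ Sum.inl) id * (G * H.transpose) = 0 := by
      have := congrArg (fun Z : Matrix F M ℝ => Z.submatrix (f ∘ Sum.inl) id) hH
      simp only [Matrix.mul_assoc] at this
      exact this
    have h2 := congrArg (fun Z => (A.submatrix (f ∘ Sum.inl) id)⁻¹ * Z) h1
    simpa [← Matrix.mul_assoc, Matrix.nonsing_inv_mul _ (isUnit_iff_ne_zero.2 hA)] using h2
  have hXA : X * A = 0 := by
    have h1 : (X * A) * G.submatrix id (e ∘ Sum.inl) = 0 := by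
      have := congrArg (fun Z : Matrix D E ℝ => Z.submatrix id (e ∘ Sum.inl)) hX
      simp only [← Matrix.mul_assoc] at this
      exact this
    have h2 := congrArg (fun Z => Z * (G.submatrix id (e ∘ Sum.inl))⁻¹) h1
    simpa [Matrix.mul_assoc, Matrix.mul_nonsing_inv _ (isUnit_iff_ne_zero.2 hG)] using h2
  have k1 := det_submatrix_mul_det_compl G H hGH e e'
  have k2 := det_submatrix_mul_det_compl A.transpose X
    (by rw [← Matrix.transpose_mul, hXA, Matrix.transpose_zero]) f f'
  have hT : ∀ f : R ⊕ D ≃ F, (A.transpose.submatrix id (f ∘ Sum.inl)).det =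
      (A.submatrix (f ∘ Sum.inl) id).det := fun f => by
    rw [← Matrix.det_transpose]; rfl
  rw [hT, hT] at k2
  rw [hsub, hsub]
  push_cast
  generalize (G.submatrix id (e ∘ Sum.inl)).det = g at *
  generalize (G.submatrix id (e' ∘ Sum.inl)).det = g' at *
  generalize (A.submatrix (f ∘ Sum.inl) id).det = a at *
  generalize (A.submatrix (f' ∘ Sum.inl) id).det = a' at *
  generalize (H.submatrix id (e' ∘ Sum.inr)).det = b' at *
  generalize (H.submatrix id (e ∘ Sum.inr)).det = b at *
  generalize (X.submatrix id (f' ∘ Sum.inr)).det = c' at *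
  generalize (X.submatrix id (f ∘ Sum.inr)).det = c at *
  generalize (((Equiv.Perm.sign (e.trans e'.symm) : ℤˣ) : ℤ) : ℝ) = s1 at *
  generalize (((Equiv.Perm.sign (f.trans f'.symm) : ℤˣ) : ℤ) : ℝ) = s2 at *
  field_simp
  calc b' * c' * a * g = (g * b') * (a * c') := by ring
    _ = _ := by rw [← k1, ← k2]; ring

theorem exists_equiv_extending {r d : ℕ} (c : Fin r → F) (hc : Function.Injective c)
    (hd : Fintype.card F = r + d) : ∃ f : Fin r ⊕ Fin d ≃ F, f ∘ Sum.inl = c := by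
  classical
  have hcard : Fintype.card ((Set.range c)ᶜ : Set F) = Fintype.card (Fin d) := by
    rw [Fintype.card_compl_set, Set.card_range_of_injective hc, hd]; simp
  refine ⟨((Equiv.ofInjective c hc).sumCongr (Fintype.equivOfCardEq hcard).symm).trans
    (Equiv.Set.sumCompl _), ?_⟩
  ext i; simp

theorem exists_columns_det_ne_zero {r : ℕ} (G : Matrix (Fin r) E ℝ) (hG : G.rank = r) :
    ∃ c : Fin r → E, Function.Injective c ∧ (G.submatrix id c).det ≠ 0 := by
  have h1 : Module.finrank ℝ (Submodule.span ℝ (Set.range G.col)) = r := by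
    rw [← Matrix.rank_eq_finrank_span_cols, hG]
  have h2 := Submodule.exists_fun_fin_finrank_span_eq ℝ (Set.range G.col)
  rw [h1] at h2
  obtain ⟨v, hv, -, hli⟩ := h2
  choose c hc using hv
  refine ⟨c, fun i j hij => hli.injective (by rw [← hc, ← hc, hij]), ?_⟩
  have h2 : LinearIndependent ℝ (G.submatrix id c).col := by
    have : (G.submatrix id c).col = v := funext hc
    rw [this]
    exact hli
  exact ((Matrix.isUnit_iff_isUnit_det _).1
    (Matrix.linearIndependent_cols_iff_isUnit.1 h2)).ne_zero

/-- A nondegenerate square submatrix of maximal order. -/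
theorem exists_maximal_minor (Q : Matrix F E ℝ) :
    ∃ (r m d : ℕ) (e : Fin r ⊕ Fin m ≃ E) (f : Fin r ⊕ Fin d ≃ F), Q.rank = r ∧
      (Q.submatrix (f ∘ Sum.inl) (e ∘ Sum.inl)).det ≠ 0 := by
  obtain ⟨r, hr⟩ : ∃ r, Q.rank = r := ⟨_, rfl⟩
  obtain ⟨A, G, rfl⟩ := exists_rank_factorization (R := Fin r) Q (by simp [hr])
  have hGr : G.rank = r := by
    apply le_antisymm
    · simpa using G.rank_le_card_height
    · exact hr.symm.le.trans (Matrix.rank_mul_le_right A G)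
  have hAr : A.transpose.rank = r := by
    rw [Matrix.rank_transpose]
    apply le_antisymm
    · simpa using A.rank_le_card_width
    · exact hr.symm.le.trans (Matrix.rank_mul_le_left A G)
  obtain ⟨c, hc, hc'⟩ := exists_columns_det_ne_zero G hGr
  obtain ⟨d, hd, hd'⟩ := exists_columns_det_ne_zero A.transpose hAr
  have hE : r ≤ Fintype.card E := hr ▸ Matrix.rank_le_card_width _
  have hF : r ≤ Fintype.card F := hr ▸ Matrix.rank_le_card_height _
  obtain ⟨e, he⟩ := exists_equiv_extending (d := Fintype.card E - r) c hc (by omega)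
  obtain ⟨f, hf⟩ := exists_equiv_extending (d := Fintype.card F - r) d hd (by omega)
  refine ⟨_, _, _, e, f, hr, ?_⟩
  rw [he, hf]
  have : ((A * G).submatrix d c) = (A.submatrix d id) * (G.submatrix id c) := rfl
  rw [this, Matrix.det_mul]
  refine mul_ne_zero ?_ hc'
  rw [← Matrix.det_transpose]
  exact hd'

end Minors

/-! ### Cayley–Menger matrices: volumes and derivatives of dihedral angles -/

section CayleyMenger

variable {ι κ : Type*} [Fintype ι] [DecidableEq ι] [Fintype κ] [DecidableEq κ]
  {E : Type*} [NormedAddCommGroup E] [InnerProductSpace ℝ E]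

theorem cayleyMenger_transpose {ℓ : ι → ι → ℝ} (h : ∀ p q, ℓ p q = ℓ q p) :
    (cayleyMenger ℓ).transpose = cayleyMenger ℓ := by
  ext i j
  rcases i with _ | i <;> rcases j with _ | j <;> simp [cayleyMenger]
  exact h j i

theorem det_cayleyMenger_reindex (e : κ ≃ ι) (ℓ : ι → ι → ℝ) :
    (cayleyMenger fun p q => ℓ (e p) (e q)).det = (cayleyMenger ℓ).det := by
  rw [← Matrix.det_submatrix_equiv_self (Equiv.optionCongr e)]
  congr 1
  ext i j
  rcases i with _ | i <;> rcases j with _ | j <;> simp [cayleyMenger]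

theorem simplexVolume_reindex (e : κ ≃ ι) (ℓ : ι → ι → ℝ) :
    simplexVolume (fun p q => ℓ (e p) (e q)) = simplexVolume ℓ := by
  rw [simplexVolume, simplexVolume, det_cayleyMenger_reindex, Fintype.card_congr e]

/-- Base times height: if the components orthogonal to the face with vertices `y (inl i)` of the vectors to
the points `y (inr k)` are `h k`, then the Cayley–Menger determinant is the one of the
face times the Gram determinant of the `h k`, up to powers of `-2`. -/
theorem det_cayleyMenger_sum [Nonempty ι] (y : ι ⊕ κ → E) (t : κ → ι → ℝ) (h : κ → E)
    (ht : ∀ k, ∑ i, t k i = -1) (hh : ∀ k, h k = y (Sum.inr k) + ∑ i, t k i • y (Sum.inl i))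
    (horth : ∀ k i j, inner ℝ (h k) (y (Sum.inl i) - y (Sum.inl j)) = 0) :
    (cayleyMenger (sqDist y)).det = (cayleyMenger (sqDist (y ∘ Sum.inl))).det *
      (Matrix.of fun k k' => -2 * inner ℝ (h k) (h k')).det := by
  obtain ⟨i₀⟩ := ‹Nonempty ι›
  let x : κ → ι ⊕ κ → ℝ := fun k => Sum.elim (t k) (Pi.single k 1)
  have hx0 : ∀ k, ∑ q, x k q = 0 := fun k => by
    simp [x, Fintype.sum_sum_type, ht]
  have hxy : ∀ k, ∑ q, x k q • y q = h k := fun k => by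
    rw [hh, Fintype.sum_sum_type, add_comm]
    simp [x, Pi.single_apply]
  have hs := fun k p => sum_sqDist_mul y (x k) (hx0 k) p
  simp only [hxy] at hs
  let t0 : κ → ℝ := fun k => 2 * inner ℝ (y (Sum.inl i₀)) (h k) - ∑ q, ‖y q‖ ^ 2 * x k q
  have hs' : ∀ k p, t0 k + (∑ i, sqDist y p (Sum.inl i) * t k i + sqDist y p (Sum.inr k)) =
      -2 * inner ℝ (y p - y (Sum.inl i₀)) (h k) := by
    intro k p
    have e1 : ∑ q, sqDist y p q * x k q =
        ∑ i, sqDist y p (Sum.inl i) * t k i + sqDist y p (Sum.inr k) := by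
      rw [Fintype.sum_sum_type]
      simp [x, Pi.single_apply]
    rw [← e1, hs, inner_sub_left]
    simp only [t0]
    ring
  let T : Matrix (Option ι) κ ℝ := Matrix.of fun i k => i.elim (t0 k) (t k)
  let e : Option ι ⊕ κ ≃ Option (ι ⊕ κ) :=
    { toFun := Sum.elim (fun i => i.map Sum.inl) (fun k => some (Sum.inr k))
      invFun := fun o => o.elim (Sum.inl none) (Sum.elim (fun i => Sum.inl (some i)) Sum.inr)
      left_inv := by rintro ((_ | i) | k) <;> rfl
      right_inv := by rintro (_ | (i | k)) <;> rfl }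
  have key : (cayleyMenger (sqDist y)).submatrix e e * Matrix.fromBlocks 1 T 0 1 =
      Matrix.fromBlocks (cayleyMenger (sqDist (y ∘ Sum.inl))) 0
        ((cayleyMenger (sqDist y)).submatrix (e ∘ Sum.inr) (e ∘ Sum.inl))
        (Matrix.of fun k k' => -2 * inner ℝ (h k) (h k')) := by
    have hb : (cayleyMenger (sqDist y)).submatrix e e = Matrix.fromBlocks
        (cayleyMenger (sqDist (y ∘ Sum.inl)))
        ((cayleyMenger (sqDist y)).submatrix (e ∘ Sum.inl) (e ∘ Sum.inr))
        ((cayleyMenger (sqDist y)).submatrix (e ∘ Sum.inr) (e ∘ Sum.inl))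
        ((cayleyMenger (sqDist y)).submatrix (e ∘ Sum.inr) (e ∘ Sum.inr)) := by
      ext i j
      rcases i with (_ | i) | i <;> rcases j with (_ | j) | j <;> rfl
    rw [hb, Matrix.fromBlocks_multiply]
    congr 1
    · simp
    · ext i k
      rcases i with _ | i
      · simp [T, e, cayleyMenger, Matrix.mul_apply, Fintype.sum_option, ht]
      · have := hs' k (Sum.inl i)
        rw [real_inner_comm, horth, mul_zero] at this
        simp only [Matrix.add_apply, Matrix.mul_apply, Fintype.sum_option, Matrix.mul_one]
        change 1 * t0 k + ∑ j, sqDist y (Sum.inl i) (Sum.inl j) * t k j +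
          sqDist y (Sum.inl i) (Sum.inr k) = 0
        rw [one_mul, add_assoc]
        exact this
    · simp
    · ext k' k
      have hk' : inner ℝ (y (Sum.inr k') - y (Sum.inl i₀)) (h k) = inner ℝ (h k') (h k) := by
        have : h k' = (y (Sum.inr k') - y (Sum.inl i₀)) +
            ∑ i, t k' i • (y (Sum.inl i) - y (Sum.inl i₀)) := by
          simp only [smul_sub, Finset.sum_sub_distrib, ← Finset.sum_smul, ht, hh]
          module
        rw [this, inner_add_left, sum_inner]
        have h0 : ∀ i, inner ℝ (t k' i • (y (Sum.inl i) - y (Sum.inl i₀))) (h k) = 0 := fun i => by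
          rw [real_inner_smul_left, real_inner_comm, horth, mul_zero]
        simp [h0]
      have := hs' k (Sum.inr k')
      rw [hk'] at this
      simp only [Matrix.add_apply, Matrix.mul_apply, Fintype.sum_option, Matrix.mul_one]
      change 1 * t0 k + ∑ j, sqDist y (Sum.inr k') (Sum.inl j) * t k j +
        sqDist y (Sum.inr k') (Sum.inr k) = -2 * inner ℝ (h k') (h k)
      rw [one_mul, add_assoc]
      exact this
  have hdet := congrArg Matrix.det key
  rwa [Matrix.det_mul, Matrix.det_fromBlocks_zero₂₁, Matrix.det_fromBlocks_zero₁₂,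
    Matrix.det_submatrix_equiv_self, Matrix.det_one, Matrix.det_one, mul_one, mul_one] at hdet

theorem differentiableAt_det {A : ℝ → Matrix ι ι ℝ} {s : ℝ}
    (hA : ∀ i j, DifferentiableAt ℝ (fun s => A s i j) s) :
    DifferentiableAt ℝ (fun s => (A s).det) s := by
  simp only [Matrix.det_apply']
  refine DifferentiableAt.fun_sum fun σ _ => DifferentiableAt.const_mul ?_ _
  exact DifferentiableAt.fun_finsetProd fun i _ => hA _ _

theorem hasDerivAt_inv_apply {A : ℝ → Matrix ι ι ℝ} {A' : Matrix ι ι ℝ} {s : ℝ}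
    (hA : ∀ i j, HasDerivAt (fun s => A s i j) (A' i j) s) (hs : IsUnit (A s).det) (i j : ι) :
    HasDerivAt (fun s => (A s)⁻¹ i j) (-((A s)⁻¹ * A' * (A s)⁻¹) i j) s := by
  have hdet := differentiableAt_det fun i j => (hA i j).differentiableAt
  have hB : ∀ i j, DifferentiableAt ℝ (fun s => (A s)⁻¹ i j) s := by
    intro i j
    have h1 : DifferentiableAt ℝ (fun s => (A s).adjugate i j) s := by
      simp only [Matrix.adjugate_apply]
      refine differentiableAt_det fun k l => ?_
      simp only [Matrix.updateRow_apply]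
      split_ifs
      · exact differentiableAt_const _
      · exact (hA k l).differentiableAt
    have h2 : (fun s => (A s)⁻¹ i j) = fun s => (A s).det⁻¹ * (A s).adjugate i j := by
      ext s
      rw [Matrix.inv_def, Matrix.smul_apply, Ring.inverse_eq_inv', smul_eq_mul]
    rw [h2]
    exact (hdet.inv hs.ne_zero).mul h1
  let B' : Matrix ι ι ℝ := Matrix.of fun i j => deriv (fun s => (A s)⁻¹ i j) s
  have hB' : ∀ i j, HasDerivAt (fun s => (A s)⁻¹ i j) (B' i j) s := fun i j => (hB i j).hasDerivAt
  have hprod : A' * (A s)⁻¹ + A s * B' = 0 := by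
    ext k l
    have h1 : HasDerivAt (fun s => (A s * (A s)⁻¹) k l) ((A' * (A s)⁻¹ + A s * B') k l) s := by
      simp only [Matrix.mul_apply, Matrix.add_apply, ← Finset.sum_add_distrib]
      exact HasDerivAt.fun_sum fun q _ => (hA k q).mul (hB' q l)
    have h2 : (fun s => (A s * (A s)⁻¹) k l) =ᶠ[nhds s] fun _ => (1 : Matrix ι ι ℝ) k l := by
      filter_upwards [hdet.continuousAt.eventually_ne hs.ne_zero] with r hr
      rw [Matrix.mul_nonsing_inv _ (isUnit_iff_ne_zero.2 hr)]
    exact h1.unique ((hasDerivAt_const s _).congr_of_eventuallyEq h2)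
  have hfin : B' = -((A s)⁻¹ * A' * (A s)⁻¹) := by
    have h1 : (A s)⁻¹ * (A s * B') = B' := by
      rw [← Matrix.mul_assoc, Matrix.nonsing_inv_mul _ hs, Matrix.one_mul]
    rw [← h1, eq_neg_of_add_eq_zero_right hprod, Matrix.mul_neg, Matrix.mul_assoc]
  have := hB' i j
  rwa [hfin, Matrix.neg_apply] at this

/-- The derivative of `arccos (x / √(y z))` when `x`, `y`, `z` are entries of the inverse of a matrix. -/
theorem hasDerivAt_arccos_div_sqrt {x y z : ℝ → ℝ} {s a b c γ qa qb qc : ℝ} (ha : 0 < a)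
    (hc : 0 < c) (hγ : 0 < γ) (hγ' : γ = a * c - b ^ 2) (hx : x s = b / (2 * γ))
    (hy : y s = -c / (2 * γ)) (hz : z s = -a / (2 * γ))
    (hx' : HasDerivAt x (-(y s * x s * qa + (y s * z s + x s ^ 2) * qb + x s * z s * qc)) s)
    (hy' : HasDerivAt y (-(y s ^ 2 * qa + 2 * (y s * x s) * qb + x s ^ 2 * qc)) s)
    (hz' : HasDerivAt z (-(x s ^ 2 * qa + 2 * (x s * z s) * qb + z s ^ 2 * qc)) s) :
    HasDerivAt (fun s => Real.arccos (x s / Real.sqrt (y s * z s)))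
      ((qb - b * (qa / a + qc / c) / 2) / (2 * Real.sqrt γ)) s := by
  have hyz : y s * z s = a * c / (2 * γ) ^ 2 := by
    rw [hy, hz]; field_simp
  have hyz0 : 0 < y s * z s := by rw [hyz]; positivity
  have hsq : Real.sqrt (y s * z s) = Real.sqrt (a * c) / (2 * γ) := by
    rw [hyz, Real.sqrt_div (by positivity), Real.sqrt_sq (by positivity)]
  have hu : 0 < Real.sqrt (a * c) := Real.sqrt_pos.2 (by positivity)
  have hu2 : Real.sqrt (a * c) ^ 2 = a * c := Real.sq_sqrt (by positivity)
  have hv : 0 < Real.sqrt γ := Real.sqrt_pos.2 hγ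
  have hv2 : Real.sqrt γ ^ 2 = γ := Real.sq_sqrt hγ.le
  have harg : x s / Real.sqrt (y s * z s) = b / Real.sqrt (a * c) := by
    rw [hsq, hx]; field_simp
  have h1 : 1 - (x s / Real.sqrt (y s * z s)) ^ 2 = γ / (a * c) := by
    rw [harg, div_pow, hu2, hγ']; field_simp
  have h1s : Real.sqrt (1 - (x s / Real.sqrt (y s * z s)) ^ 2) =
      Real.sqrt γ / Real.sqrt (a * c) := by
    rw [h1, Real.sqrt_div hγ.le]
  have hpos : 0 < 1 - (x s / Real.sqrt (y s * z s)) ^ 2 := by rw [h1]; positivity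
  have hne1 : x s / Real.sqrt (y s * z s) ≠ -1 := fun h => by rw [h] at hpos; norm_num at hpos
  have hne2 : x s / Real.sqrt (y s * z s) ≠ 1 := fun h => by rw [h] at hpos; norm_num at hpos
  have hd := (Real.hasDerivAt_arccos hne1 hne2).comp s
    (hx'.fun_div ((hy'.fun_mul hz').sqrt hyz0.ne') (Real.sqrt_pos.2 hyz0).ne')
  refine hd.congr_deriv ?_
  rw [h1s, hsq]
  rw [hx, hy, hz]
  generalize Real.sqrt (a * c) = u at *
  generalize Real.sqrt γ = v at *
  have hγ0 := hγ.ne'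
  have hstep : ∀ X Y : ℝ, -(1 / (v / u)) * ((X * (u / (2 * γ)) -
      b / (2 * γ) * (Y / (2 * (u / (2 * γ))))) / (u / (2 * γ)) ^ 2) =
      -(2 * γ / v) * (X - b * γ * Y / (a * c)) := by
    intro X Y
    rw [← hu2]
    field_simp
  rw [hstep]
  clear hstep hd hx' hy' hz' harg h1 h1s hpos hne1 hne2 hyz hyz0 hsq hx hy hz hu2 hu hv2
  subst hγ'
  field_simp
  ring

end CayleyMenger

section Angle

variable {ι : Type*} [Fintype ι] [DecidableEq ι]
  {E : Type*} [NormedAddCommGroup E] [InnerProductSpace ℝ E]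

/-- The derivative of a dihedral angle when the squared edge lengths of a nondegenerate simplex vary with
velocity `N`. The vectors `hk` and `hl` from the face of codimension two to the vertices `k` and `l`
orthogonal to it are given by affine dependencies `tk` and `tl`. -/
theorem hasDerivAt_dihedralAngle {y : ι → E} (hy : AffineIndependent ℝ y) {k l p₀ : ι}
    (hkl : k ≠ l) (hpk : p₀ ≠ k) (hpl : p₀ ≠ l) {tk tl : ι → ℝ} {hk hl : E}
    (tkk : tk k = 1) (tkl : tk l = 0) (tlk : tl k = 0) (tll : tl l = 1)
    (tk0 : ∑ q, tk q = 0) (tl0 : ∑ q, tl q = 0)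
    (htk : ∑ q, tk q • y q = hk) (htl : ∑ q, tl q • y q = hl)
    (ok : ∀ a b, a ≠ k → a ≠ l → b ≠ k → b ≠ l → inner ℝ (y a - y b) hk = 0)
    (ol : ∀ a b, a ≠ k → a ≠ l → b ≠ k → b ≠ l → inner ℝ (y a - y b) hl = 0)
    {ℓ : ℝ → ι → ι → ℝ} {N : ι → ι → ℝ} {s : ℝ} (hN : ∀ p q, N p q = N q p)
    (hℓ : ∀ p q, HasDerivAt (fun s => ℓ s p q) (N p q) s) (hs : ℓ s = sqDist y) :
    0 < inner ℝ hk hk * inner ℝ hl hl - inner ℝ hk hl ^ 2 ∧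
    0 < inner ℝ hk hk ∧ 0 < inner ℝ hl hl ∧
    HasDerivAt (fun s => dihedralAngle (ℓ s) k l)
      (((∑ p, ∑ q, tk p * N p q * tl q) - inner ℝ hk hl *
        ((∑ p, ∑ q, tk p * N p q * tk q) / inner ℝ hk hk +
          (∑ p, ∑ q, tl p * N p q * tl q) / inner ℝ hl hl) / 2) /
        (2 * Real.sqrt (inner ℝ hk hk * inner ℝ hl hl - inner ℝ hk hl ^ 2))) s := by
  set M := cayleyMenger (sqDist y) with hM
  have hdet : IsUnit M.det := isUnit_cayleyMenger hy k
  have hMM : M⁻¹ * M = 1 := Matrix.nonsing_inv_mul _ hdet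
  have hsym : ∀ i j, M⁻¹ i j = M⁻¹ j i := by
    intro i j
    have hT : M.transpose = M := cayleyMenger_transpose fun p q => by
      rw [sqDist, sqDist, norm_sub_rev]
    have := congrFun (congrFun (Matrix.transpose_nonsing_inv M) j) i
    rwa [hT, Matrix.transpose_apply] at this
  -- the dependency `t`, extended to a vector on which the matrix `M` is concentrated at `k` and `l`
  have hT : ∀ (t : ι → ℝ) (h : E), ∑ q, t q = 0 → ∑ q, t q • y q = h →
      (∀ a b, a ≠ k → a ≠ l → b ≠ k → b ≠ l → inner ℝ (y a - y b) h = 0) →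
      ∃ T : Option ι → ℝ, (∀ q, T (some q) = t q) ∧
        M.mulVec T = -(2 * inner ℝ (y k - y p₀) h) • Pi.single (some k) 1 -
          (2 * inner ℝ (y l - y p₀) h) • Pi.single (some l) 1 := by
    intro t h t0 ht o
    refine ⟨fun i => i.elim (2 * inner ℝ (y p₀) h - ∑ q, ‖y q‖ ^ 2 * t q) t, fun q => rfl, ?_⟩
    ext i
    rcases i with _ | p
    · simp [hM, cayleyMenger, Matrix.mulVec, dotProduct, Fintype.sum_option, t0]
    · have h1 := sum_sqDist_mul y t t0 p
      rw [ht] at h1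
      have h2 : M.mulVec (fun i => i.elim (2 * inner ℝ (y p₀) h - ∑ q, ‖y q‖ ^ 2 * t q) t)
          (some p) = (2 * inner ℝ (y p₀) h - ∑ q, ‖y q‖ ^ 2 * t q) +
            ∑ q, sqDist y p q * t q := by
        simp [hM, cayleyMenger, Matrix.mulVec, dotProduct, Fintype.sum_option]
      rw [h2, h1]
      have h3 : -2 * inner ℝ (y p - y p₀) h = -(2 * inner ℝ (y k - y p₀) h) *
          (if p = k then 1 else 0) - (2 * inner ℝ (y l - y p₀) h) * (if p = l then 1 else 0) := by
        by_cases e1 : p = k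
        · subst e1; simp [hkl]
        by_cases e2 : p = l
        · subst e2; simp [hkl.symm]
        · rw [o p p₀ e1 e2 hpk hpl]; simp [e1, e2]
      simp only [Pi.sub_apply, Pi.smul_apply, Pi.single_apply, smul_eq_mul, Option.some.injEq]
      rw [← h3, inner_sub_left]
      ring
  have hin : ∀ (t : ι → ℝ) (h h' : E), ∑ q, t q = 0 → ∑ q, t q • y q = h →
      (∀ a b, a ≠ k → a ≠ l → b ≠ k → b ≠ l → inner ℝ (y a - y b) h' = 0) →
      inner ℝ h h' = t k * inner ℝ (y k - y p₀) h' + t l * inner ℝ (y l - y p₀) h' := by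
    intro t h h' t0 ht o
    have e1 : h = ∑ q, t q • (y q - y p₀) := by
      simp only [smul_sub, Finset.sum_sub_distrib, ← Finset.sum_smul, t0, zero_smul, sub_zero, ht]
    rw [e1, sum_inner]
    simp only [real_inner_smul_left]
    rw [← Finset.sum_pair (f := fun q => t q * inner ℝ (y q - y p₀) h') hkl]
    symm
    refine Finset.sum_subset (Finset.subset_univ _) fun q _ hq => ?_
    simp only [Finset.mem_insert, Finset.mem_singleton, not_or] at hq
    rw [o q p₀ hq.1 hq.2 hpk hpl, mul_zero]
  have e1 := hin tk hk hk tk0 htk ok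
  have e2 := hin tl hl hk tl0 htl ok
  have e3 := hin tk hk hl tk0 htk ol
  have e4 := hin tl hl hl tl0 htl ol
  rw [tkk, tkl, one_mul, zero_mul, add_zero] at e1 e3
  rw [tlk, tll, one_mul, zero_mul, zero_add] at e2 e4
  rw [real_inner_comm] at e2
  obtain ⟨Tk, hTk, hMk⟩ := hT tk hk tk0 htk ok
  obtain ⟨Tl, hTl, hMl⟩ := hT tl hl tl0 htl ol
  rw [← e1, ← e2] at hMk
  rw [← e3, ← e4] at hMl
  clear e1 e2 e3 e4 hin hT
  have hinv : ∀ (T : Option ι → ℝ) (u v : ℝ),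
      M.mulVec T = -(2 * u) • Pi.single (some k) 1 - (2 * v) • Pi.single (some l) 1 →
      ∀ i, T i = -(2 * u) * M⁻¹ i (some k) - (2 * v) * M⁻¹ i (some l) := by
    intro T u v h i
    have := congrFun (congrArg (M⁻¹.mulVec) h) i
    rw [Matrix.mulVec_mulVec, hMM, Matrix.one_mulVec] at this
    rw [this, Matrix.mulVec_sub, Matrix.mulVec_smul, Matrix.mulVec_smul]
    simp
  have rk := hinv Tk _ _ hMk
  have rl := hinv Tl _ _ hMl
  have k1 := rk (some k)
  have k2 := rk (some l)
  have l1 := rl (some k)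
  have l2 := rl (some l)
  rw [hTk, tkk] at k1
  rw [hTk, tkl] at k2
  rw [hTl, tlk] at l1
  rw [hTl, tll] at l2
  rw [hsym (some l) (some k)] at k2 l2
  have hγ0 : 0 ≤ inner ℝ hk hk * inner ℝ hl hl - inner ℝ hk hl ^ 2 := by
    have := real_inner_mul_inner_self_le hk hl
    nlinarith
  have ha0 : 0 ≤ inner ℝ hk hk := real_inner_self_nonneg
  have hc0 : 0 ≤ inner ℝ hl hl := real_inner_self_nonneg
  have hcol : ∀ i, M⁻¹ i (some k) = M⁻¹ (some k) (some k) * Tk i + M⁻¹ (some k) (some l) * Tl i := by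
    intro i
    rw [rk, rl]
    linear_combination (M⁻¹ i (some k)) * k1 + (M⁻¹ i (some l)) * l1
  have hcol' : ∀ i, M⁻¹ i (some l) = M⁻¹ (some k) (some l) * Tk i + M⁻¹ (some l) (some l) * Tl i := by
    intro i
    rw [rk, rl]
    linear_combination (M⁻¹ i (some k)) * k2 + (M⁻¹ i (some l)) * l2
  have hnum : 0 < inner ℝ hk hk * inner ℝ hl hl - inner ℝ hk hl ^ 2 := by
    refine lt_of_le_of_ne hγ0 fun h => ?_
    have : (inner ℝ hk hk * inner ℝ hl hl - inner ℝ hk hl ^ 2) * (4 *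
      (M⁻¹ (some k) (some k) * M⁻¹ (some l) (some l) - M⁻¹ (some k) (some l) ^ 2)) = 1 := by
      generalize M⁻¹ (some k) (some k) = mkk at *
      generalize M⁻¹ (some k) (some l) = mkl at *
      generalize M⁻¹ (some l) (some l) = mll at *
      generalize (inner ℝ hk hk : ℝ) = a at *
      generalize (inner ℝ hk hl : ℝ) = b at *
      generalize (inner ℝ hl hl : ℝ) = c at *
      linear_combination (-(2 * b) * mkl - 2 * c * mll) * (-k1) - (-(2 * a) * mkl - 2 * b * mll) * (-l1) - l2
    rw [← h, zero_mul] at this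
    norm_num at this
  have ha : 0 < inner ℝ hk hk := by
    refine lt_of_le_of_ne ha0 fun h => ?_
    rw [← h] at hnum; nlinarith [sq_nonneg (inner ℝ hk hl)]
  have hc : 0 < inner ℝ hl hl := by
    refine lt_of_le_of_ne hc0 fun h => ?_
    rw [← h] at hnum; nlinarith [sq_nonneg (inner ℝ hk hl)]
  refine ⟨hnum, ha, hc, ?_⟩
  -- the derivative of the Cayley–Menger matrix is `N` bordered by zeros
  let N' : Matrix (Option ι) (Option ι) ℝ := Matrix.of fun i j =>
    i.elim 0 fun p => j.elim 0 fun q => N p q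
  have hd : ∀ i j, HasDerivAt (fun s => cayleyMenger (ℓ s) i j) (N' i j) s := by
    intro i j
    rcases i with _ | p <;> rcases j with _ | q
    · exact hasDerivAt_const _ _
    · exact hasDerivAt_const _ _
    · exact hasDerivAt_const _ _
    · exact hℓ p q
  have hdinv := fun i j => hasDerivAt_inv_apply hd (by rw [hs]; exact hdet) i j
  have hform : ∀ i j, (M⁻¹ * N' * M⁻¹) i j = ∑ p, ∑ q, M⁻¹ (some p) i * N p q * M⁻¹ (some q) j := by
    intro i j
    simp only [Matrix.mul_apply, Fintype.sum_option]
    simp only [N', Matrix.of_apply, Option.elim]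
    simp only [mul_zero, zero_mul, Finset.sum_const_zero, add_zero, zero_add, Finset.sum_mul]
    rw [Finset.sum_comm]
    exact Finset.sum_congr rfl fun p _ => Finset.sum_congr rfl fun q _ => by rw [hsym i (some p)]
  have hsymq : (∑ p, ∑ q, tl p * N p q * tk q) = ∑ p, ∑ q, tk p * N p q * tl q := by
    rw [Finset.sum_comm]
    exact Finset.sum_congr rfl fun p _ => Finset.sum_congr rfl fun q _ => by rw [hN q p]; ring
  have hbil : ∀ (u v u' v' : ℝ), ∑ p, ∑ q, (u * tk p + v * tl p) * N p q * (u' * tk q + v' * tl q) =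
      u * u' * (∑ p, ∑ q, tk p * N p q * tk q) + (u * v' + v * u') * (∑ p, ∑ q, tk p * N p q * tl q) +
        v * v' * (∑ p, ∑ q, tl p * N p q * tl q) := by
    intro u v u' v'
    have h1 : ∀ p q, (u * tk p + v * tl p) * N p q * (u' * tk q + v' * tl q) =
        u * u' * (tk p * N p q * tk q) + u * v' * (tk p * N p q * tl q) +
        v * u' * (tl p * N p q * tk q) + v * v' * (tl p * N p q * tl q) := fun p q => by ring
    simp only [h1, Finset.sum_add_distrib, ← Finset.mul_sum, hsymq]
    ring
  have hquad : ∀ (i j : Option ι) (u v u' v' : ℝ), (∀ q, M⁻¹ q i = u * Tk q + v * Tl q) →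
      (∀ q, M⁻¹ q j = u' * Tk q + v' * Tl q) → (M⁻¹ * N' * M⁻¹) i j =
      u * u' * (∑ p, ∑ q, tk p * N p q * tk q) + (u * v' + v * u') * (∑ p, ∑ q, tk p * N p q * tl q) +
        v * v' * (∑ p, ∑ q, tl p * N p q * tl q) := by
    intro i j u v u' v' hi hj
    rw [hform, ← hbil]
    refine Finset.sum_congr rfl fun p _ => Finset.sum_congr rfl fun q _ => ?_
    rw [hi, hj, hTk, hTk, hTl, hTl]
  have vx : M⁻¹ (some k) (some l) = inner ℝ hk hl /
      (2 * (inner ℝ hk hk * inner ℝ hl hl - inner ℝ hk hl ^ 2)) := by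
    rw [eq_div_iff (by positivity)]
    linear_combination -(inner ℝ hk hl) * k1 + inner ℝ hk hk * l1
  have vy : M⁻¹ (some k) (some k) = -inner ℝ hl hl /
      (2 * (inner ℝ hk hk * inner ℝ hl hl - inner ℝ hk hl ^ 2)) := by
    rw [eq_div_iff (by positivity)]
    linear_combination inner ℝ hl hl * k1 - inner ℝ hk hl * l1
  have vz : M⁻¹ (some l) (some l) = -inner ℝ hk hk /
      (2 * (inner ℝ hk hk * inner ℝ hl hl - inner ℝ hk hl ^ 2)) := by
    rw [eq_div_iff (by positivity)]
    linear_combination -(inner ℝ hk hl) * k2 + inner ℝ hk hk * l2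
  rw [hM, ← hs] at vx vy vz
  refine hasDerivAt_arccos_div_sqrt
    (x := fun s => (cayleyMenger (ℓ s))⁻¹ (some k) (some l))
    (y := fun s => (cayleyMenger (ℓ s))⁻¹ (some k) (some k))
    (z := fun s => (cayleyMenger (ℓ s))⁻¹ (some l) (some l))
    (qa := ∑ p, ∑ q, tk p * N p q * tk q) (qb := ∑ p, ∑ q, tk p * N p q * tl q)
    (qc := ∑ p, ∑ q, tl p * N p q * tl q) ha hc hnum rfl vx vy vz ?_ ?_ ?_
  · refine (hdinv (some k) (some l)).congr_deriv ?_
    simp only [hs, ← hM]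
    rw [hquad _ _ _ _ _ _ hcol hcol']
    ring
  · refine (hdinv (some k) (some k)).congr_deriv ?_
    simp only [hs, ← hM]
    rw [hquad _ _ _ _ _ _ hcol hcol]
    ring
  · refine (hdinv (some l) (some l)).congr_deriv ?_
    simp only [hs, ← hM]
    rw [hquad _ _ _ _ _ _ hcol' hcol']
    ring

end Angle

/-! ### Heights of simplices over their faces -/

section Heights

variable {W : Type*} [DecidableEq W] {E : Type*} [NormedAddCommGroup E] [InnerProductSpace ℝ E]

/-- `h` is the component orthogonal to the face with vertices `x a`, `a ∈ F`, of the vectors from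
this face to the point `x q`; it is written as `∑ t p • x p` with coefficients of sum zero. -/
structure IsHeight (x : W → E) (F : Finset W) (q : W) (t : W → ℝ) (h : E) : Prop where
  self : t q = 1
  supp : ∀ p ∉ insert q F, t p = 0
  sum_eq : ∑ p ∈ insert q F, t p = 0
  smul_eq : ∑ p ∈ insert q F, t p • x p = h
  orth : ∀ a ∈ F, ∀ b ∈ F, inner ℝ (x a - x b) h = 0

theorem exists_sum_eq_of_mem_vectorSpan (x : W → E) (F : Finset W) {z : E}
    (hz : z ∈ vectorSpan ℝ (x '' F)) : ∃ c : W → ℝ, ∑ p ∈ F, c p = 0 ∧ ∑ p ∈ F, c p • x p = z := by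
  rw [vectorSpan_def] at hz
  induction hz using Submodule.span_induction with
  | mem d hd =>
    obtain ⟨_, ⟨a, ha, rfl⟩, _, ⟨b, hb, rfl⟩, rfl⟩ := hd
    refine ⟨fun p => (if p = a then 1 else 0) - (if p = b then 1 else 0), ?_, ?_⟩
    · rw [Finset.sum_sub_distrib, Finset.sum_ite_eq', Finset.sum_ite_eq', if_pos (by simpa using ha),
        if_pos (by simpa using hb), sub_self]
    · simp only [sub_smul, ite_smul, one_smul, zero_smul]
      rw [Finset.sum_sub_distrib, Finset.sum_ite_eq', Finset.sum_ite_eq', if_pos (by simpa using ha),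
        if_pos (by simpa using hb)]
      rfl
  | zero => exact ⟨0, by simp, by simp⟩
  | add a c _ _ ha hc =>
    obtain ⟨u, hu, hu'⟩ := ha
    obtain ⟨v, hv, hv'⟩ := hc
    refine ⟨u + v, ?_, ?_⟩
    · simp [Finset.sum_add_distrib, hu, hv]
    · simp [Finset.sum_add_distrib, add_smul, hu', hv']
  | smul r a _ ha =>
    obtain ⟨u, hu, hu'⟩ := ha
    refine ⟨r • u, ?_, ?_⟩
    · simp [← Finset.mul_sum, hu]
    · simp [mul_smul, ← Finset.smul_sum, hu']

/-- Every point has a height over a face: project it orthogonally to the span of the face and write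
the projection as an affine combination of the vertices. -/
theorem exists_isHeight (x : W → E) {F : Finset W} (hF : F.Nonempty) {q : W} (hq : q ∉ F) :
    ∃ t h, IsHeight x F q t h := by
  obtain ⟨f, hf⟩ := hF
  let S := vectorSpan ℝ (x '' F)
  have : FiniteDimensional ℝ S :=
    finiteDimensional_vectorSpan_of_finite ℝ (F.finite_toSet.image x)
  obtain ⟨c, hc, hc'⟩ := exists_sum_eq_of_mem_vectorSpan x F
    (S.starProjection_apply_mem (x q - x f))
  refine ⟨fun p => (if p = q then 1 else 0) -
    if p ∈ F then (if p = f then 1 else 0) + c p else 0,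
    (x q - x f) - S.starProjection (x q - x f), ?_, ?_, ?_, ?_, ?_⟩
  · simp [hq]
  · intro p hp
    rw [Finset.mem_insert, not_or] at hp
    simp [hp]
  · rw [Finset.sum_insert hq]
    simp only [if_true, if_neg hq]
    have : ∀ p ∈ F, ((if p = q then (1 : ℝ) else 0) - if p ∈ F then (if p = f then 1 else 0) + c p
        else 0) = -((if p = f then 1 else 0) + c p) := by
      intro p hp
      rw [if_neg (ne_of_mem_of_not_mem hp hq), if_pos hp, zero_sub]
    rw [Finset.sum_congr rfl this, Finset.sum_neg_distrib, Finset.sum_add_distrib, hc,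
      Finset.sum_ite_eq', if_pos hf]
    ring
  · rw [Finset.sum_insert hq]
    simp only [if_true, if_neg hq]
    have : ∀ p ∈ F, ((if p = q then (1 : ℝ) else 0) - if p ∈ F then (if p = f then 1 else 0) + c p
        else 0) • x p = -((if p = f then x p else 0) + c p • x p) := by
      intro p hp
      rw [if_neg (ne_of_mem_of_not_mem hp hq), if_pos hp, zero_sub, neg_smul, add_smul, ite_smul,
        one_smul, zero_smul]
    rw [Finset.sum_congr rfl this, Finset.sum_neg_distrib, Finset.sum_add_distrib, hc',
      Finset.sum_ite_eq', if_pos hf]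
    module
  · intro a ha b hb
    have h1 : x a - x b ∈ S := vsub_mem_vectorSpan ℝ (Set.mem_image_of_mem x (by simpa using ha))
      (Set.mem_image_of_mem x (by simpa using hb))
    exact (Submodule.mem_orthogonal S _).1 (S.sub_starProjection_mem_orthogonal _) _ h1

namespace IsHeight

variable {x : W → E} {F : Finset W} {q : W} {t : W → ℝ} {h : E}

theorem sum_eq_of_subset (H : IsHeight x F q t h) {K : Finset W} (hK : insert q F ⊆ K) :
    ∑ p ∈ K, t p = 0 := by
  rw [← H.sum_eq]
  exact (Finset.sum_subset hK fun p _ hp => H.supp p hp).symm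

theorem smul_eq_of_subset (H : IsHeight x F q t h) {K : Finset W} (hK : insert q F ⊆ K) :
    ∑ p ∈ K, t p • x p = h := by
  rw [← H.smul_eq]
  exact (Finset.sum_subset hK fun p _ hp => by rw [H.supp p hp, zero_smul]).symm

theorem eq_zero (H : IsHeight x F q t h) {p : W} (hp : p ∉ F) (hpq : p ≠ q) : t p = 0 :=
  H.supp p (by simp [hp, hpq])

/-- The inner product of a height with a vector orthogonal to the face. -/
theorem inner_eq (H : IsHeight x F q t h) (hq : q ∉ F) {f : W} (hf : f ∈ F) {v : E}
    (hv : ∀ a ∈ F, ∀ b ∈ F, inner ℝ (x a - x b) v = 0) :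
    inner ℝ h v = inner ℝ (x q - x f) v := by
  have e1 : h = ∑ p ∈ insert q F, t p • (x p - x f) := by
    simp only [smul_sub, Finset.sum_sub_distrib, ← Finset.sum_smul, H.sum_eq, zero_smul, sub_zero,
      H.smul_eq]
  rw [e1, Finset.sum_insert hq, inner_add_left, H.self, one_smul, sum_inner,
    Finset.sum_eq_zero, add_zero]
  intro p hp
  rw [real_inner_smul_left, hv p hp f hf, mul_zero]

end IsHeight

theorem affineIndependent_finset_iff {x : W → E} {s : Finset W} :
    AffineIndependent ℝ (fun p : s => x p) ↔ ∀ u : W → ℝ, ∑ p ∈ s, u p = 0 →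
      ∑ p ∈ s, u p • x p = 0 → ∀ p ∈ s, u p = 0 := by
  constructor
  · intro hs u hu hux p hp
    have := affineIndependent_iff.1 hs Finset.univ (fun p => u p)
      (by rw [Finset.sum_coe_sort s u]; exact hu)
      (by rw [Finset.sum_coe_sort s fun p => u p • x p]; exact hux)
      ⟨p, hp⟩ (Finset.mem_univ _)
    exact this
  · intro hs
    rw [affineIndependent_iff_of_fintype]
    intro u hu hux p
    rw [Finset.weightedVSub_eq_linear_combination (hw := hu)] at hux
    have h1 : ∀ p : s, (fun p => if h : p ∈ s then u ⟨p, h⟩ else 0) p.1 = u p := fun p => by simp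
    have := hs (fun p => if h : p ∈ s then u ⟨p, h⟩ else 0)
      (by rw [← Finset.sum_coe_sort]; simpa using hu)
      (by
        rw [← Finset.sum_coe_sort s fun p => (if h : p ∈ s then u ⟨p, h⟩ else 0) • x p]
        simpa using hux) p p.2
    simpa using this

theorem affineIndependent_subset {x : W → E} {s s' : Finset W}
    (h : AffineIndependent ℝ (fun p : s' => x p)) (hs : s ⊆ s') :
    AffineIndependent ℝ (fun p : s => x p) :=
  h.comp_embedding ⟨fun p : s => (⟨p, hs p.2⟩ : s'), fun _ _ hab =>
    Subtype.ext (congrArg (fun z : s' => z.1) hab)⟩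

/-- An affine dependency is the combination of heights over a face with its own coefficients. -/
theorem dependency_eq_sum_heights {x : W → E} {F K : Finset W} (hFK : F ⊆ K)
    (hF : AffineIndependent ℝ fun p : F => x p) {w : W → ℝ} (hw : ∑ p ∈ K, w p = 0)
    (hwx : ∑ p ∈ K, w p • x p = 0) {t : W → W → ℝ} {h : W → E}
    (H : ∀ q ∈ K \ F, IsHeight x F q (t q) (h q)) :
    ∑ q ∈ K \ F, w q • h q = 0 ∧ ∀ p ∈ K, w p = ∑ q ∈ K \ F, w q * t q p := by
  let u : W → ℝ := fun p => w p - ∑ q ∈ K \ F, w q * t q p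
  have hsub : ∀ q ∈ K \ F, insert q F ⊆ K := fun q hq =>
    Finset.insert_subset (Finset.mem_sdiff.1 hq).1 hFK
  have u0 : ∀ p ∈ K \ F, u p = 0 := by
    intro p hp
    have : ∑ q ∈ K \ F, w q * t q p = w p := by
      rw [Finset.sum_eq_single_of_mem p hp, (H p hp).self, mul_one]
      intro q hq hqp
      rw [(H q hq).eq_zero (Finset.mem_sdiff.1 hp).2 hqp.symm, mul_zero]
    simp only [u, this, sub_self]
  have uF : ∑ p ∈ F, u p = 0 := by
    rw [Finset.sum_subset hFK fun p hp hpF => u0 p (Finset.mem_sdiff.2 ⟨hp, hpF⟩)]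
    simp only [u]
    rw [Finset.sum_sub_distrib, hw, Finset.sum_comm, zero_sub, neg_eq_zero]
    refine Finset.sum_eq_zero fun q hq => ?_
    rw [← Finset.mul_sum, (H q hq).sum_eq_of_subset (hsub q hq), mul_zero]
  have ux : ∑ p ∈ F, u p • x p = -∑ q ∈ K \ F, w q • h q := by
    rw [Finset.sum_subset hFK fun p hp hpF => by
      rw [u0 p (Finset.mem_sdiff.2 ⟨hp, hpF⟩), zero_smul]]
    simp only [u, sub_smul, Finset.sum_smul]
    rw [Finset.sum_sub_distrib, hwx, Finset.sum_comm, zero_sub, neg_inj]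
    refine Finset.sum_congr rfl fun q hq => ?_
    rw [← (H q hq).smul_eq_of_subset (hsub q hq), Finset.smul_sum]
    simp only [mul_smul]
  have hz : ∑ q ∈ K \ F, w q • h q = 0 := by
    rw [← inner_self_eq_zero (𝕜 := ℝ)]
    rcases F.eq_empty_or_nonempty with rfl | ⟨f, hf⟩
    · rw [Finset.sum_empty] at ux
      rw [neg_eq_zero.1 ux.symm, inner_zero_left]
    have h1 : ∑ q ∈ K \ F, w q • h q = -∑ p ∈ F, u p • (x p - x f) := by
      simp only [smul_sub, Finset.sum_sub_distrib, ← Finset.sum_smul, uF, zero_smul, sub_zero, ux,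
        neg_neg]
    conv_lhs => enter [2]; rw [h1]
    rw [inner_neg_left, sum_inner, neg_eq_zero]
    refine Finset.sum_eq_zero fun p hp => ?_
    rw [real_inner_smul_left, inner_sum, Finset.sum_eq_zero, mul_zero]
    intro q hq
    rw [real_inner_smul_right, (H q hq).orth p hp f hf, mul_zero]
  refine ⟨hz, fun p hp => ?_⟩
  rw [hz, neg_zero] at ux
  by_cases hpF : p ∈ F
  · have := affineIndependent_finset_iff.1 hF u uF ux p hpF
    exact sub_eq_zero.1 this
  · exact sub_eq_zero.1 (u0 p (Finset.mem_sdiff.2 ⟨hp, hpF⟩))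

/-- The Cayley–Menger determinant of the points `x p`, `p ∈ s`. -/
def cmDet (x : W → E) (s : Finset W) : ℝ := (cayleyMenger (sqDist fun p : s => x p)).det

/-- The volume of the simplex with vertices `x p`, `p ∈ s`. -/
def vol (x : W → E) (s : Finset W) : ℝ := simplexVolume (sqDist fun p : s => x p)

/-- Base times height for a simplex whose vertices split into a face `F` and the remaining
points `P`. -/
theorem cmDet_union (x : W → E) {F P : Finset W} (hF : F.Nonempty) (hFP : Disjoint F P)
    {t : W → W → ℝ} {h : W → E} (H : ∀ q ∈ P, IsHeight x F q (t q) (h q)) :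
    cmDet x (F ∪ P) = cmDet x F * (Matrix.of fun k k' : P => -2 * inner ℝ (h k) (h k')).det := by
  obtain ⟨f, hf⟩ := hF
  have : Nonempty F := ⟨⟨f, hf⟩⟩
  have hqF : ∀ q ∈ P, q ∉ F := fun q hq hqF => Finset.disjoint_left.1 hFP hqF hq
  have := det_cayleyMenger_sum (ι := F) (κ := P) (Sum.elim (fun p => x p) (fun p => x p))
    (fun q p => t q p) (fun q => h q) ?_ ?_ ?_
  · rw [cmDet, cmDet, ← det_cayleyMenger_reindex (Equiv.Finset.union F P hFP)]
    rw [show (fun p : F => x p) = (Sum.elim (fun p : F => x p) fun p : P => x p) ∘ Sum.inl from rfl,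
      ← this]
    congr 2
    ext p q
    rcases p with p | p <;> rcases q with q | q <;> simp [sqDist]
  · rintro ⟨q, hq⟩
    have h1 := (H q hq).sum_eq
    rw [Finset.sum_insert (hqF q hq), (H q hq).self] at h1
    rw [Finset.sum_coe_sort F fun p => t q p]
    linarith
  · rintro ⟨q, hq⟩
    have h1 := (H q hq).smul_eq
    rw [Finset.sum_insert (hqF q hq), (H q hq).self, one_smul] at h1
    simp only [Sum.elim_inl, Sum.elim_inr]
    rw [Finset.sum_coe_sort F fun p => t q p • x p, h1]
  · rintro ⟨q, hq⟩ ⟨a, ha⟩ ⟨b, hb⟩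
    rw [real_inner_comm]
    exact (H q hq).orth a ha b hb

theorem cmDet_insert {x : W → E} {F : Finset W} (hF : F.Nonempty) {q : W} (hq : q ∉ F)
    {t : W → ℝ} {h : E} (H : IsHeight x F q t h) :
    cmDet x (insert q F) = cmDet x F * (-2 * inner ℝ h h) := by
  have := cmDet_union x (P := {q}) hF (by simpa using hq) (t := fun _ => t) (h := fun _ => h)
    (fun q' hq' => by rw [Finset.mem_singleton.1 hq']; exact H)
  rw [Finset.union_comm, ← Finset.insert_eq] at this
  rw [this, Matrix.det_unique]
  rfl

theorem cmDet_singleton (x : W → E) (p : W) : cmDet x {p} = -1 := by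
  have e : cmDet x {p} = (cayleyMenger (ι := Fin 1) fun _ _ => 0).det := by
    let e : Fin 1 ≃ ({p} : Finset W) := Equiv.ofUnique _ _
    rw [cmDet, ← det_cayleyMenger_reindex e]
    congr 2
    ext i j
    rw [Subsingleton.elim i j]
    simp [sqDist]
  let e' : Fin 2 ≃ Option (Fin 1) := (finSuccEquiv 1)
  rw [e, ← Matrix.det_submatrix_equiv_self e', Matrix.det_fin_two]
  have h0 : e' 0 = none := rfl
  have h1 : e' 1 = some 0 := rfl
  simp [h0, h1, cayleyMenger]

theorem cmDet_pair (x : W → E) {p q : W} (hpq : p ≠ q) :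
    cmDet x {p, q} = 2 * ‖x p - x q‖ ^ 2 := by
  have H : IsHeight x {q} p (fun a => if a = p then 1 else if a = q then -1 else 0)
      (x p - x q) := by
    refine ⟨by simp, ?_, ?_, ?_, ?_⟩
    · intro a ha
      simp only [Finset.mem_insert, Finset.mem_singleton, not_or] at ha
      simp [ha]
    · rw [Finset.sum_pair hpq]; simp [hpq.symm]
    · rw [Finset.sum_pair hpq]; simp [hpq.symm, sub_eq_add_neg]
    · intro a ha b hb
      rw [Finset.mem_singleton.1 ha, Finset.mem_singleton.1 hb, sub_self, inner_zero_left]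
  rw [cmDet_insert (by simp) (by simpa using hpq) H, cmDet_singleton, real_inner_self_eq_norm_sq]
  ring

end Heights

/-! ### Volumes and angles over a common face -/

section Cluster

variable {W : Type*} [DecidableEq W] {E : Type*} [NormedAddCommGroup E] [InnerProductSpace ℝ E]

theorem vol_eq {x : W → E} {s : Finset W} {n : ℕ} (hs : s.card = n) :
    vol x s = Real.sqrt ((-1) ^ n * cmDet x s / 2 ^ (n - 1)) / (Nat.factorial (n - 1)) := by
  rw [vol, simplexVolume, Fintype.card_coe, hs]
  rfl

/-- The area of a triangle, in terms of a side and the height over it. -/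
theorem vol_triangle {x : W → E} {a b c : W} (hab : a ≠ b) (hc : c ∉ ({a, b} : Finset W))
    {t : W → ℝ} {h : E} (H : IsHeight x {a, b} c t h) :
    vol x (insert c {a, b}) = ‖x a - x b‖ * ‖h‖ / 2 := by
  rw [vol_eq (n := 3) (by rw [Finset.card_insert_of_notMem hc, Finset.card_pair hab]),
    cmDet_insert (by simp) hc H, cmDet_pair x hab, real_inner_self_eq_norm_sq]
  have h1 : (-1) ^ 3 * (2 * ‖x a - x b‖ ^ 2 * (-2 * ‖h‖ ^ 2)) / 2 ^ (3 - 1) =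
      (‖x a - x b‖ * ‖h‖) ^ 2 := by
    norm_num; ring
  rw [h1, Real.sqrt_sq (by positivity)]
  norm_num [Nat.factorial]

/-- The volume of a 4-simplex, in terms of a facet and the height over it. -/
theorem vol_insert {x : W → E} {F : Finset W} (hF : F.card = 4) {q : W} (hq : q ∉ F)
    {t : W → ℝ} {h : E} (H : IsHeight x F q t h) :
    vol x (insert q F) = Real.sqrt (cmDet x F / 8) * ‖h‖ / 24 := by
  rw [vol_eq (n := 5) (by rw [Finset.card_insert_of_notMem hq, hF]),
    cmDet_insert (Finset.card_pos.1 (by omega)) hq H, real_inner_self_eq_norm_sq]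
  have h1 : (-1) ^ 5 * (cmDet x F * (-2 * ‖h‖ ^ 2)) / 2 ^ (5 - 1) = cmDet x F / 8 * ‖h‖ ^ 2 := by
    norm_num; ring
  rw [h1, Real.sqrt_mul' _ (sq_nonneg _), Real.sqrt_sq (norm_nonneg _)]
  norm_num [Nat.factorial]

theorem det_finset_pair {k l : W} (hkl : k ≠ l) (f : W → W → ℝ) :
    (Matrix.of fun a b : ({k, l} : Finset W) => f a b).det = f k k * f l l - f k l * f l k := by
  let e : Fin 2 ≃ ({k, l} : Finset W) := Equiv.ofBijective
    ![⟨k, by simp⟩, ⟨l, by simp⟩] ⟨by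
      intro i j
      fin_cases i <;> fin_cases j <;> simp [hkl, hkl.symm], by
      rintro ⟨a, ha⟩
      rcases Finset.mem_insert.1 ha with rfl | ha
      · exact ⟨0, rfl⟩
      · obtain rfl := Finset.mem_singleton.1 ha
        exact ⟨1, rfl⟩⟩
  rw [← Matrix.det_submatrix_equiv_self e, Matrix.det_fin_two]
  rfl

/-- The volume of a 4-simplex, in terms of a two-dimensional face and the heights over it. -/
theorem vol_insert_insert {x : W → E} {F : Finset W} (hF : F.card = 3) {k l : W} (hkl : k ≠ l)
    (hk : k ∉ F) (hl : l ∉ F) {tk tl : W → ℝ} {hk' hl' : E} (Hk : IsHeight x F k tk hk')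
    (Hl : IsHeight x F l tl hl') :
    vol x (insert k (insert l F)) =
      vol x F * Real.sqrt (inner ℝ hk' hk' * inner ℝ hl' hl' - inner ℝ hk' hl' ^ 2) / 12 := by
  have hγ : 0 ≤ inner ℝ hk' hk' * inner ℝ hl' hl' - inner ℝ hk' hl' ^ 2 := by
    have := real_inner_mul_inner_self_le hk' hl'
    nlinarith
  have h1 := cmDet_union x (F := F) (P := {k, l}) (Finset.card_pos.1 (by omega))
    (by simp [hk, hl]) (t := fun p => if p = k then tk else tl)
    (h := fun p => if p = k then hk' else hl') (by
      intro q hq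
      rcases Finset.mem_insert.1 hq with rfl | hq
      · simpa using Hk
      · obtain rfl := Finset.mem_singleton.1 hq
        simpa [hkl.symm] using Hl)
  rw [det_finset_pair hkl fun a b => -2 * inner ℝ (if a = k then hk' else hl')
    (if b = k then hk' else hl')] at h1
  simp only [if_true, if_neg hkl.symm] at h1
  have hu : F ∪ {k, l} = insert k (insert l F) := by
    ext a; simp only [Finset.mem_union, Finset.mem_insert, Finset.mem_singleton]; tauto
  rw [hu] at h1
  rw [vol_eq (n := 5) (by
    rw [Finset.card_insert_of_notMem (by simp [hkl, hk]), Finset.card_insert_of_notMem hl, hF]),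
    h1, vol_eq (n := 3) hF, real_inner_comm hk' hl']
  have h2 : (-1) ^ 5 * (cmDet x F * (-2 * inner ℝ hk' hk' * (-2 * inner ℝ hl' hl') -
      -2 * inner ℝ hk' hl' * (-2 * inner ℝ hk' hl'))) / 2 ^ (5 - 1) =
      (-1) ^ 3 * cmDet x F / 2 ^ (3 - 1) *
        (inner ℝ hk' hk' * inner ℝ hl' hl' - inner ℝ hk' hl' ^ 2) := by
    norm_num; ring
  rw [h2, Real.sqrt_mul' _ hγ]
  norm_num [Nat.factorial]
  ring

theorem inner_height_self_pos {x : W → E} {F : Finset W} {q : W}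
    (hF : AffineIndependent ℝ fun p : (insert q F : Finset W) => x p)
    {t : W → ℝ} {h : E} (H : IsHeight x F q t h) : 0 < inner ℝ h h := by
  refine real_inner_self_pos.2 fun h0 => ?_
  have := affineIndependent_finset_iff.1 hF t H.sum_eq (H.smul_eq.trans h0) q
    (Finset.mem_insert_self _ _)
  rw [H.self] at this
  exact one_ne_zero this

/-- The dihedral angle of the simplex `σ` at its face `t` as a function of squared edge lengths. -/
def faceAng (ℓ : W → W → ℝ) (σ t : Finset W) : ℝ :=
  (∑ k : σ, ∑ l : σ, if k.1 ∉ t ∧ l.1 ∉ t ∧ k ≠ l then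
    dihedralAngle (fun p q : σ => ℓ p.1 q.1) k l else 0) / 2

theorem faceAng_eq (ℓ : W → W → ℝ) {σ t : Finset W} {k l : σ} (hkl : k ≠ l) (hk : k.1 ∉ t)
    (hl : l.1 ∉ t) (h : ∀ p : σ, p.1 ∉ t → p = k ∨ p = l) : faceAng ℓ σ t =
      (dihedralAngle (fun p q : σ => ℓ p.1 q.1) k l +
        dihedralAngle (fun p q : σ => ℓ p.1 q.1) l k) / 2 := by
  rw [faceAng]
  congr 1
  rw [Fintype.sum_eq_add k l hkl]
  · congr 1
    · rw [Fintype.sum_eq_single l, if_pos ⟨hk, hl, hkl⟩]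
      intro p hp
      refine if_neg fun h1 => ?_
      rcases h p h1.2.1 with rfl | rfl
      · exact h1.2.2 rfl
      · exact hp rfl
    · rw [Fintype.sum_eq_single k, if_pos ⟨hl, hk, hkl.symm⟩]
      intro p hp
      refine if_neg fun h1 => ?_
      rcases h p h1.2.1 with rfl | rfl
      · exact hp rfl
      · exact h1.2.2 rfl
  · intro p hp
    refine Finset.sum_eq_zero fun q _ => if_neg fun h1 => ?_
    rcases h p h1.1 with rfl | rfl
    · exact hp.1 rfl
    · exact hp.2 rfl

/-- The quadratic form of the velocities `N` of squared lengths. -/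
def quadForm (K : Finset W) (N : W → W → ℝ) (u v : W → ℝ) : ℝ :=
  ∑ a ∈ K, ∑ b ∈ K, u a * N a b * v b

theorem quadForm_symm {K : Finset W} {N : W → W → ℝ} (hN : ∀ p q, N p q = N q p) (u v : W → ℝ) :
    quadForm K N u v = quadForm K N v u := by
  rw [quadForm, quadForm, Finset.sum_comm]
  exact Finset.sum_congr rfl fun p _ => Finset.sum_congr rfl fun q _ => by rw [hN q p]; ring

/-- The derivative of the dihedral angle at the face `t`, in terms of the quadratic form of the velocities
`N` of the squared lengths, evaluated on the affine dependencies `tk`, `tl` that express the heights of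
the two other vertices. -/
theorem hasDerivAt_faceAng {x : W → E} {t σ K : Finset W} (ht : t.Nonempty) {k l : W} (hk : k ∉ t)
    (hl : l ∉ t) (hkl : k ≠ l) (hσ : σ = insert k (insert l t)) (hσK : σ ⊆ K)
    (hind : AffineIndependent ℝ fun p : σ => x p)
    {tk tl : W → ℝ} {hk' hl' : E} (Hk : IsHeight x t k tk hk') (Hl : IsHeight x t l tl hl')
    {ℓ : ℝ → W → W → ℝ} {N : W → W → ℝ} {s : ℝ} (hN : ∀ p q, N p q = N q p)
    (hℓ : ∀ p ∈ σ, ∀ q ∈ σ, HasDerivAt (fun s => ℓ s p q) (N p q) s)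
    (hs : ∀ p ∈ σ, ∀ q ∈ σ, ℓ s p q = sqDist x p q) :
    0 < inner ℝ hk' hk' * inner ℝ hl' hl' - inner ℝ hk' hl' ^ 2 ∧
    HasDerivAt (fun s => faceAng (ℓ s) σ t)
      ((quadForm K N tk tl - inner ℝ hk' hl' * (quadForm K N tk tk / inner ℝ hk' hk' +
          quadForm K N tl tl / inner ℝ hl' hl') / 2) /
        (2 * Real.sqrt (inner ℝ hk' hk' * inner ℝ hl' hl' - inner ℝ hk' hl' ^ 2))) s := by
  obtain ⟨f, hf⟩ := ht
  have mk : k ∈ σ := by simp [hσ]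
  have ml : l ∈ σ := by simp [hσ]
  have mf : f ∈ σ := by simp [hσ, hf]
  have mt : ∀ p : σ, p ≠ ⟨k, mk⟩ → p ≠ ⟨l, ml⟩ → p.1 ∈ t := by
    rintro ⟨p, hp⟩ h1 h2
    rw [hσ, Finset.mem_insert, Finset.mem_insert] at hp
    rcases hp with rfl | rfl | hp
    · exact absurd rfl h1
    · exact absurd rfl h2
    · exact hp
  have sk : insert k t ⊆ σ := by
    rw [hσ]; exact Finset.insert_subset_insert _ (Finset.subset_insert _ _)
  have sl : insert l t ⊆ σ := by rw [hσ]; exact Finset.subset_insert _ _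
  have hq : ∀ {u v : W → ℝ}, (∀ p ∉ σ, u p = 0) → (∀ p ∉ σ, v p = 0) →
      ∑ p : σ, ∑ q : σ, u p * N p q * v q = quadForm K N u v := by
    intro u v hu hv
    have h1 : ∀ p : σ, ∑ q : σ, u p * N p q * v q = ∑ q ∈ K, u p * N p q * v q := by
      intro p
      rw [Finset.sum_coe_sort σ fun q => u p * N p q * v q]
      exact Finset.sum_subset hσK fun q _ hq => by rw [hv q hq, mul_zero]
    simp only [h1]
    rw [Finset.sum_coe_sort σ fun p => ∑ q ∈ K, u p * N p q * v q]
    exact Finset.sum_subset hσK fun q _ hq => by simp [hu q hq]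
  have zk : ∀ p ∉ σ, tk p = 0 := fun p hp => Hk.supp p fun h => hp (sk h)
  have zl : ∀ p ∉ σ, tl p = 0 := fun p hp => Hl.supp p fun h => hp (sl h)
  have hkl' : (⟨k, mk⟩ : σ) ≠ ⟨l, ml⟩ := fun h => hkl (congrArg Subtype.val h)
  have hs' : (fun p q : σ => ℓ s p q) = sqDist fun p : σ => x p := by
    ext p q; exact hs p p.2 q q.2
  have main := hasDerivAt_dihedralAngle hind hkl' (p₀ := ⟨f, mf⟩)
    (by simpa [Subtype.ext_iff] using ne_of_mem_of_not_mem hf hk)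
    (by simpa [Subtype.ext_iff] using ne_of_mem_of_not_mem hf hl)
    (tk := fun p => tk p) (tl := fun p => tl p) Hk.self (Hk.eq_zero hl hkl.symm)
    (Hl.eq_zero hk hkl) Hl.self
    ((Finset.sum_coe_sort σ tk).trans (Hk.sum_eq_of_subset sk))
    ((Finset.sum_coe_sort σ tl).trans (Hl.sum_eq_of_subset sl))
    ((Finset.sum_coe_sort σ fun p => tk p • x p).trans (Hk.smul_eq_of_subset sk))
    ((Finset.sum_coe_sort σ fun p => tl p • x p).trans (Hl.smul_eq_of_subset sl))
    (fun a b a1 a2 b1 b2 => Hk.orth a (mt a a1 a2) b (mt b b1 b2))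
    (fun a b a1 a2 b1 b2 => Hl.orth a (mt a a1 a2) b (mt b b1 b2))
    (ℓ := fun s p q => ℓ s p q) (N := fun p q => N p q) (s := s) (fun p q => hN p q)
    (fun p q => hℓ p p.2 q q.2) hs'
  have main' := hasDerivAt_dihedralAngle hind hkl'.symm (p₀ := ⟨f, mf⟩)
    (by simpa [Subtype.ext_iff] using ne_of_mem_of_not_mem hf hl)
    (by simpa [Subtype.ext_iff] using ne_of_mem_of_not_mem hf hk)
    (tk := fun p => tl p) (tl := fun p => tk p) Hl.self (Hl.eq_zero hk hkl)
    (Hk.eq_zero hl hkl.symm) Hk.self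
    ((Finset.sum_coe_sort σ tl).trans (Hl.sum_eq_of_subset sl))
    ((Finset.sum_coe_sort σ tk).trans (Hk.sum_eq_of_subset sk))
    ((Finset.sum_coe_sort σ fun p => tl p • x p).trans (Hl.smul_eq_of_subset sl))
    ((Finset.sum_coe_sort σ fun p => tk p • x p).trans (Hk.smul_eq_of_subset sk))
    (fun a b a1 a2 b1 b2 => Hl.orth a (mt a a2 a1) b (mt b b2 b1))
    (fun a b a1 a2 b1 b2 => Hk.orth a (mt a a2 a1) b (mt b b2 b1))
    (ℓ := fun s p q => ℓ s p q) (N := fun p q => N p q) (s := s) (fun p q => hN p q)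
    (fun p q => hℓ p p.2 q q.2) hs'
  obtain ⟨hγ, -, -, hd⟩ := main
  obtain ⟨-, -, -, hd'⟩ := main'
  refine ⟨hγ, ?_⟩
  rw [hq zk zl, hq zk zk, hq zl zl] at hd
  rw [hq zl zk, hq zk zk, hq zl zl, real_inner_comm hk' hl', quadForm_symm hN tl tk,
    mul_comm (inner ℝ hl' hl' : ℝ), add_comm (quadForm K N tl tl / _)] at hd'
  have hsum := (hd.add hd').div_const 2
  refine (hsum.congr_deriv (by ring)).congr_of_eventuallyEq (Filter.Eventually.of_forall fun s => ?_)
  exact faceAng_eq (ℓ s) hkl' hk hl fun p hp => by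
    by_contra hcon
    rw [not_or] at hcon
    exact hp (mt p hcon.1 hcon.2)

end Cluster

/-! ### Affine dependencies of six points -/

section Weights

variable {W : Type*} [DecidableEq W] {E : Type*} [NormedAddCommGroup E] [InnerProductSpace ℝ E]

/-- An affine dependency `w` of the six points `x p`, `p ∈ K`, normalized so that
its coefficients are, up to the sign, the volumes of the 4-simplices omitting one of the points. -/
structure IsWeight (x : W → E) (K : Finset W) (w : W → ℝ) : Prop where
  card_eq : K.card = 6
  indep : ∀ p ∈ K, AffineIndependent ℝ fun a : (K.erase p : Finset W) => x a
  ne_zero : ∀ p ∈ K, w p ≠ 0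
  sum_eq : ∑ p ∈ K, w p = 0
  smul_eq : ∑ p ∈ K, w p • x p = 0
  abs_eq : ∀ p ∈ K, |w p| = vol x (K.erase p)

theorem vol_triangle_pos {x : W → E} {s : Finset W} (hs : s.card = 3)
    (h : AffineIndependent ℝ fun p : s => x p) : 0 < vol x s := by
  obtain ⟨c, a, b, hca, hcb, hab, rfl⟩ := Finset.card_eq_three.1 hs
  have hc : c ∉ ({a, b} : Finset W) := by simp [hca, hcb]
  obtain ⟨t, h', H⟩ := exists_isHeight x (F := {a, b}) (by simp) hc
  rw [vol_triangle hab hc H]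
  have h1 : 0 < ‖h'‖ := by
    have := inner_height_self_pos h H
    rw [real_inner_self_eq_norm_sq] at this
    exact (norm_nonneg _).lt_of_ne fun h0 => by rw [← h0] at this; norm_num at this
  have h2 : 0 < ‖x a - x b‖ := by
    rw [norm_pos_iff, sub_ne_zero]
    intro hx
    exact hab (congrArg Subtype.val (h.injective (a₁ := ⟨a, by simp⟩) (a₂ := ⟨b, by simp⟩) hx))
  positivity

theorem vol_four_simplex_pos {x : W → E} {s : Finset W} (hs : s.card = 5)
    (h : AffineIndependent ℝ fun p : s => x p) : 0 < vol x s := by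
  obtain ⟨F, hF, hFc⟩ := Finset.exists_subset_card_eq (s := s) (n := 3) (by omega)
  have h2 : (s \ F).card = 2 := by rw [Finset.card_sdiff_of_subset hF]; omega
  obtain ⟨k, l, hkl, hs2⟩ := Finset.card_eq_two.1 h2
  have mk : k ∈ s \ F := by simp [hs2]
  have ml : l ∈ s \ F := by simp [hs2]
  rw [Finset.mem_sdiff] at mk ml
  have hsF : s = insert k (insert l F) := by
    rw [← Finset.sdiff_union_of_subset hF, hs2]
    ext a; simp only [Finset.mem_union, Finset.mem_insert, Finset.mem_singleton]; tauto
  have hFn : F.Nonempty := Finset.card_pos.1 (by omega)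
  obtain ⟨tk, hk, Hk⟩ := exists_isHeight x hFn mk.2
  obtain ⟨tl, hl, Hl⟩ := exists_isHeight x hFn ml.2
  have hγ := (hasDerivAt_faceAng hFn mk.2 ml.2 hkl hsF subset_rfl h Hk Hl (N := fun _ _ => 0)
    (ℓ := fun _ => sqDist x) (s := 0) (fun _ _ => rfl) (fun p _ q _ => hasDerivAt_const _ _)
    (fun p _ q _ => rfl)).1
  rw [hsF, vol_insert_insert hFc hkl mk.2 ml.2 Hk Hl]
  have := vol_triangle_pos hFc (affineIndependent_subset h hF)
  have := Real.sqrt_pos.2 hγ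
  positivity

/-- Six points of a four-dimensional space have an affine dependency; in general position its
coefficients are nonzero. Over the common face of the 4-simplices omitting `p` and `q`, the heights of `p` and
`q` are inversely proportional to the coefficients, so the volumes are proportional to them. -/
theorem exists_isWeight [FiniteDimensional ℝ E] (hE : Module.finrank ℝ E = 4) {x : W → E}
    {K : Finset W} (hK : K.card = 6)
    (hind : ∀ p ∈ K, AffineIndependent ℝ fun a : (K.erase p : Finset W) => x a) :
    ∃ w, IsWeight x K w := by
  have hdep : ¬ AffineIndependent ℝ fun p : K => x p := fun h => by
    have := h.card_le_finrank_succ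
    rw [Fintype.card_coe, hK] at this
    have h2 := Submodule.finrank_le (vectorSpan ℝ (Set.range fun p : K => x p))
    omega
  rw [affineIndependent_finset_iff] at hdep
  push Not at hdep
  obtain ⟨w, hw, hwx, p₀, hp₀, hwp₀⟩ := hdep
  have hne : ∀ p ∈ K, w p ≠ 0 := by
    intro p hp h0
    have h1 := affineIndependent_finset_iff.1 (hind p hp) w
      (by rw [← hw, ← Finset.add_sum_erase K w hp, h0, zero_add])
      (by rw [← hwx, ← Finset.add_sum_erase K (fun p => w p • x p) hp, h0, zero_smul, zero_add])
    by_cases h2 : p₀ = p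
    · exact hwp₀ (h2 ▸ h0)
    · exact hwp₀ (h1 p₀ (Finset.mem_erase.2 ⟨h2, hp₀⟩))
  -- the ratio of the volume to the coefficient is the same for any two points
  have hratio : ∀ p ∈ K, ∀ q ∈ K, |w q| * vol x (K.erase p) = |w p| * vol x (K.erase q) := by
    intro p hp q hq
    by_cases hpq : p = q
    · rw [hpq]
    let F := K \ {p, q}
    have hFc : F.card = 4 := by
      rw [Finset.card_sdiff_of_subset (Finset.insert_subset hp (by simpa using hq)),
        Finset.card_pair hpq, hK]
    have hFK : F ⊆ K := Finset.sdiff_subset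
    have hKF : K \ F = {p, q} :=
      Finset.sdiff_sdiff_eq_self (Finset.insert_subset hp (by simpa using hq))
    have pF : p ∉ F := by simp [F]
    have qF : q ∉ F := by simp [F]
    have hFn : F.Nonempty := Finset.card_pos.1 (by omega)
    have ep : K.erase p = insert q F := by
      ext a
      simp only [F, Finset.mem_erase, Finset.mem_insert, Finset.mem_sdiff, Finset.mem_singleton]
      by_cases h : a = q
      · subst h; simp [hq, Ne.symm hpq]
      · simp [h]; tauto
    have eq : K.erase q = insert p F := by
      ext a
      simp only [F, Finset.mem_erase, Finset.mem_insert, Finset.mem_sdiff, Finset.mem_singleton]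
      by_cases h : a = p
      · subst h; simp [hp, hpq]
      · simp [h]; tauto
    have hex : ∀ a ∈ K \ F, ∃ th : (W → ℝ) × E, IsHeight x F a th.1 th.2 := fun a ha => by
      obtain ⟨t, h, H⟩ := exists_isHeight x hFn (Finset.mem_sdiff.1 ha).2
      exact ⟨(t, h), H⟩
    choose! th H using hex
    have h1 := (dependency_eq_sum_heights hFK
      (affineIndependent_subset (hind p hp) (by rw [ep]; exact Finset.subset_insert _ _)) hw hwx
      (t := fun q => (th q).1) (h := fun q => (th q).2) H).1
    rw [hKF, Finset.sum_pair hpq] at h1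
    have h2 : |w p| * ‖(th p).2‖ = |w q| * ‖(th q).2‖ := by
      rw [← Real.norm_eq_abs, ← Real.norm_eq_abs, ← norm_smul, ← norm_smul,
        eq_neg_of_add_eq_zero_left h1, norm_neg]
    rw [ep, eq, vol_insert hFc qF (H q (by simp [hKF])), vol_insert hFc pF (H p (by simp [hKF]))]
    linear_combination (-Real.sqrt (cmDet x F / 8) / 24) * h2
  let c := vol x (K.erase p₀) / |w p₀|
  have hv0 : 0 < vol x (K.erase p₀) :=
    vol_four_simplex_pos (by rw [Finset.card_erase_of_mem hp₀, hK]) (hind p₀ hp₀)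
  have hc : 0 < c := div_pos hv0 (abs_pos.2 hwp₀)
  refine ⟨fun p => c * w p, hK, hind, fun p hp => mul_ne_zero hc.ne' (hne p hp), ?_, ?_, ?_⟩
  · rw [← Finset.mul_sum, hw, mul_zero]
  · simp only [mul_smul, ← Finset.smul_sum, hwx, smul_zero]
  · intro p hp
    have h1 := hratio p hp p₀ hp₀
    have h2 : |w p₀| ≠ 0 := abs_ne_zero.2 hwp₀
    rw [abs_mul, abs_of_pos hc]
    simp only [c]
    field_simp
    linarith

/-- The algebraic identity behind the total variation of the angles around a face: the
contributions of the three 4-simplices add up to a multiple of `(w, N w)`. -/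
theorem sum_three_angles {a b c q u v x y z α β γ δ ε ζ : ℝ} (ha : a ≠ 0) (hb : b ≠ 0)
    (hc : c ≠ 0) (hx : x ≠ 0) (hy : y ≠ 0) (hz : z ≠ 0)
    (e1 : a * x + b * α + c * β = 0) (e2 : a * α + b * y + c * γ = 0)
    (e3 : a * β + b * γ + c * z = 0) :
    1 / a * (ζ - γ * (v / y + u / z) / 2) + 1 / b * (ε - β * (q / x + u / z) / 2) +
      1 / c * (δ - α * (q / x + v / y) / 2) =
      (a ^ 2 * q + b ^ 2 * v + c ^ 2 * u + 2 * (a * b * δ + a * c * ε + b * c * ζ)) /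
        (2 * (a * b * c)) := by
  have h1 : x = -(b * α + c * β) / a := by field_simp; linarith
  have k1 : (β / b + α / c) / x = -a / (b * c) := by
    rw [div_eq_div_iff hx (by positivity)]; field_simp; linarith
  have k2 : (γ / a + α / c) / y = -b / (a * c) := by
    rw [div_eq_div_iff hy (by positivity)]; field_simp; linarith
  have k3 : (γ / a + β / b) / z = -c / (a * b) := by
    rw [div_eq_div_iff hz (by positivity)]; field_simp; linarith
  have h2 : 1 / a * (ζ - γ * (v / y + u / z) / 2) + 1 / b * (ε - β * (q / x + u / z) / 2) +
      1 / c * (δ - α * (q / x + v / y) / 2) = ζ / a + ε / b + δ / c -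
      (q * ((β / b + α / c) / x) + v * ((γ / a + α / c) / y) + u * ((γ / a + β / b) / z)) / 2 := by
    ring
  rw [h2, k1, k2, k3]
  field_simp
  ring

theorem quadForm_sum (K S : Finset W) (N : W → W → ℝ) (c : W → ℝ) (f : W → W → ℝ) :
    quadForm K N (fun i => ∑ a ∈ S, c a * f a i) (fun i => ∑ a ∈ S, c a * f a i) =
      ∑ a ∈ S, ∑ b ∈ S, c a * c b * quadForm K N (f a) (f b) := by
  calc _ = ∑ i ∈ K, ∑ j ∈ K, ∑ a ∈ S, ∑ b ∈ S, c a * c b * (f a i * N i j * f b j) := by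
        refine Finset.sum_congr rfl fun i _ => Finset.sum_congr rfl fun j _ => ?_
        rw [Finset.sum_mul, Finset.sum_mul_sum]
        exact Finset.sum_congr rfl fun a _ => Finset.sum_congr rfl fun b _ => by ring
    _ = ∑ i ∈ K, ∑ a ∈ S, ∑ j ∈ K, ∑ b ∈ S, c a * c b * (f a i * N i j * f b j) :=
        Finset.sum_congr rfl fun i _ => Finset.sum_comm
    _ = ∑ a ∈ S, ∑ i ∈ K, ∑ j ∈ K, ∑ b ∈ S, c a * c b * (f a i * N i j * f b j) :=
        Finset.sum_comm
    _ = ∑ a ∈ S, ∑ i ∈ K, ∑ b ∈ S, ∑ j ∈ K, c a * c b * (f a i * N i j * f b j) :=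
        Finset.sum_congr rfl fun a _ => Finset.sum_congr rfl fun i _ => Finset.sum_comm
    _ = ∑ a ∈ S, ∑ b ∈ S, ∑ i ∈ K, ∑ j ∈ K, c a * c b * (f a i * N i j * f b j) :=
        Finset.sum_congr rfl fun a _ => Finset.sum_comm
    _ = _ := by simp only [quadForm, Finset.mul_sum]

/-- The total variation of the angles at the face `t` of the 4-simplices of the cluster: with the
signs of the boundary of a 5-simplex, it vanishes for variations of lengths
which keep the six points in a four-dimensional space, that is, for `(w, N w) = 0`. -/
theorem IsWeight.sum_angles {x : W → E} {K : Finset W} {w : W → ℝ} (hw : IsWeight x K w)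
    {t : Finset W} (htK : t ⊆ K) (ht : t.card = 3)
    {ℓ : ℝ → W → W → ℝ} {N : W → W → ℝ} {s : ℝ} (hN : ∀ p q, N p q = N q p)
    (hℓ : ∀ p ∈ K, ∀ q ∈ K, HasDerivAt (fun s => ℓ s p q) (N p q) s)
    (hs : ∀ p ∈ K, ∀ q ∈ K, ℓ s p q = sqDist x p q) :
    ∑ p ∈ K \ t, w p / |w p| * deriv (fun s => faceAng (ℓ s) (K.erase p) t) s =
      vol x t / (24 * ∏ p ∈ K \ t, w p) * (quadForm K N w w / 2) := by
  have htn : t.Nonempty := Finset.card_pos.1 (by omega)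
  have hex : ∀ a ∈ K \ t, ∃ th : (W → ℝ) × E, IsHeight x t a th.1 th.2 := fun a ha => by
    obtain ⟨t, h, H⟩ := exists_isHeight x htn (Finset.mem_sdiff.1 ha).2
    exact ⟨(t, h), H⟩
  choose! th H using hex
  -- the angle in one simplex
  have one : ∀ p k l, p ≠ k → p ≠ l → k ≠ l → K \ t = {p, k, l} →
      w p / |w p| * deriv (fun s => faceAng (ℓ s) (K.erase p) t) s = vol x t / 24 * (1 / w p *
        (quadForm K N (th k).1 (th l).1 - inner ℝ (th k).2 (th l).2 *
          (quadForm K N (th k).1 (th k).1 / inner ℝ (th k).2 (th k).2 +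
            quadForm K N (th l).1 (th l).1 / inner ℝ (th l).2 (th l).2) / 2)) ∧
      0 < inner ℝ (th k).2 (th k).2 := by
    intro p k l hpk hpl hkl h3
    have mp : p ∈ K \ t := by simp [h3]
    have mk : k ∈ K \ t := by simp [h3]
    have ml : l ∈ K \ t := by simp [h3]
    have hKp := (Finset.mem_sdiff.1 mp).1
    have hσ : K.erase p = insert k (insert l t) := by
      rw [← Finset.sdiff_union_of_subset htK, h3]
      ext a
      simp only [Finset.mem_erase, Finset.mem_union, Finset.mem_insert, Finset.mem_singleton]
      have : a ∈ t → a ≠ p := fun ha => ne_of_mem_of_not_mem ha (Finset.mem_sdiff.1 mp).2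
      by_cases a = p <;> by_cases a = k <;> by_cases a = l <;> simp_all
    have hd := hasDerivAt_faceAng htn (Finset.mem_sdiff.1 mk).2 (Finset.mem_sdiff.1 ml).2 hkl hσ
      (Finset.erase_subset _ _) (hw.indep p hKp) (H k mk) (H l ml) (ℓ := ℓ) (s := s) hN
      (fun a ha b hb => hℓ a (Finset.mem_of_mem_erase ha) b (Finset.mem_of_mem_erase hb))
      (fun a ha b hb => hs a (Finset.mem_of_mem_erase ha) b (Finset.mem_of_mem_erase hb))
    obtain ⟨hγ, hd⟩ := hd
    have hv := vol_insert_insert ht hkl (Finset.mem_sdiff.1 mk).2 (Finset.mem_sdiff.1 ml).2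
      (H k mk) (H l ml)
    rw [← hσ, ← hw.abs_eq p hKp] at hv
    refine ⟨?_, ?_⟩
    · rw [hd.deriv]
      have hsq := Real.sqrt_pos.2 hγ
      have hw0 := abs_pos.2 (hw.ne_zero p hKp)
      have hw1 := hw.ne_zero p hKp
      have hw2 := sq_abs (w p)
      generalize Real.sqrt _ = r at *
      have hS : vol x t = 12 * |w p| / r := by rw [hv]; field_simp
      rw [hS]
      field_simp
      rw [hw2]
      ring
    · exact inner_height_self_pos (affineIndependent_subset (hw.indep p hKp) (by
        rw [hσ]; exact Finset.insert_subset_insert _ (Finset.subset_insert _ _))) (H k mk)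
  obtain ⟨p, q, r, hpq, hpr, hqr, h3⟩ := Finset.card_eq_three.1
    (show (K \ t).card = 3 by rw [Finset.card_sdiff_of_subset htK, hw.card_eq, ht])
  have mp : p ∈ K := (Finset.mem_sdiff.1 (show p ∈ K \ t by simp [h3])).1
  have mq : q ∈ K := (Finset.mem_sdiff.1 (show q ∈ K \ t by simp [h3])).1
  have mr : r ∈ K := (Finset.mem_sdiff.1 (show r ∈ K \ t by simp [h3])).1
  have o1 := one p q r hpq hpr hqr h3
  have o2 := one q p r hpq.symm hqr hpr (by rw [h3]; ext; simp; tauto)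
  have o3 := one r p q hpr.symm hqr.symm hpq (by rw [h3]; ext; simp; tauto)
  have o4 := one q r p hqr hpq.symm hpr.symm (by rw [h3]; ext; simp; tauto)
  obtain ⟨hsum, hdep⟩ := dependency_eq_sum_heights htK
    (affineIndependent_subset (hw.indep p mp) (by
      intro a ha
      exact Finset.mem_erase.2 ⟨fun h => (Finset.mem_sdiff.1 (show p ∈ K \ t by simp [h3])).2
        (h ▸ ha), htK ha⟩)) hw.sum_eq hw.smul_eq
    (t := fun q => (th q).1) (h := fun q => (th q).2) H
  have hp3 : p ∉ ({q, r} : Finset W) := by simp [hpq, hpr]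
  have hquad : quadForm K N w w = ∑ a ∈ K \ t, ∑ b ∈ K \ t,
      w a * w b * quadForm K N (th a).1 (th b).1 := by
    rw [← quadForm_sum]
    exact Finset.sum_congr rfl fun i hi => Finset.sum_congr rfl fun j hj => by
      rw [hdep i hi, hdep j hj]
  rw [h3, Finset.sum_insert hp3, Finset.sum_pair hqr] at hsum ⊢
  rw [h3] at hquad
  simp only [Finset.sum_insert hp3, Finset.sum_pair hqr] at hquad
  rw [quadForm_symm hN (th q).1 (th p).1, quadForm_symm hN (th r).1 (th p).1,
    quadForm_symm hN (th r).1 (th q).1] at hquad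
  rw [Finset.prod_insert hp3, Finset.prod_pair hqr, o1.1, o2.1, o3.1, hquad]
  have e1 := congrArg (inner ℝ (th p).2) hsum
  have e2 := congrArg (inner ℝ (th q).2) hsum
  have e3 := congrArg (inner ℝ (th r).2) hsum
  simp only [inner_add_right, real_inner_smul_right, inner_zero_right] at e1 e2 e3
  rw [real_inner_comm (th p).2 (th q).2] at e2
  rw [real_inner_comm (th p).2 (th r).2, real_inner_comm (th q).2 (th r).2] at e3
  have key := sum_three_angles (hw.ne_zero p mp) (hw.ne_zero q mq) (hw.ne_zero r mr) o2.2.ne'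
    o1.2.ne' o4.2.ne' (by rw [← add_assoc] at e1; exact e1) (by rw [← add_assoc] at e2; exact e2)
    (by rw [← add_assoc] at e3; exact e3)
    (q := quadForm K N (th p).1 (th p).1) (v := quadForm K N (th q).1 (th q).1)
    (u := quadForm K N (th r).1 (th r).1) (δ := quadForm K N (th p).1 (th q).1)
    (ε := quadForm K N (th p).1 (th r).1) (ζ := quadForm K N (th q).1 (th r).1)
  rw [← add_assoc, ← mul_add, ← mul_add, key]
  ring

end Weights

/-! ### Sides of hyperplanes and the affine dependency -/

section Sides

variable {W : Type*} [DecidableEq W] {E : Type*} [NormedAddCommGroup E] [InnerProductSpace ℝ E]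

theorem inner_eq_zero_of_mem_affineSpan {x : W → E} {F : Finset W} {f : W} (hf : f ∈ F) {h y : E}
    (hh : ∀ a ∈ F, ∀ b ∈ F, inner ℝ (x a - x b) h = 0)
    (hy : y ∈ affineSpan ℝ (x '' (F : Set W))) : inner ℝ (y - x f) h = 0 := by
  have h1 : y - x f ∈ vectorSpan ℝ (x '' (F : Set W)) := by
    rw [← direction_affineSpan]
    exact AffineSubspace.vsub_mem_direction hy
      (subset_affineSpan ℝ _ (Set.mem_image_of_mem x (by simpa using hf)))
  obtain ⟨c, hc, hc'⟩ := exists_sum_eq_of_mem_vectorSpan x F h1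
  have h2 : y - x f = ∑ p ∈ F, c p • (x p - x f) := by
    simp only [smul_sub, Finset.sum_sub_distrib, ← Finset.sum_smul, hc, zero_smul, sub_zero, hc']
  rw [h2, sum_inner]
  exact Finset.sum_eq_zero fun p hp => by rw [real_inner_smul_left, hh p hp f hf, mul_zero]

/-- Two points of the cluster lie on the same side of the hyperplane through the other four if
and only if their coefficients in the affine dependency have opposite signs. -/
theorem IsWeight.sSameSide_iff {x : W → E} {K : Finset W} {w : W → ℝ} (hw : IsWeight x K w)
    {F : Finset W} {p q : W} (hp : p ∉ F) (hq : q ∉ F) (hpq : p ≠ q)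
    (hK : K = insert p (insert q F)) :
    (affineSpan ℝ (x '' (F : Set W))).SSameSide (x p) (x q) ↔ w p * w q < 0 := by
  have hFc : F.card = 4 := by
    have := hw.card_eq
    rw [hK, Finset.card_insert_of_notMem (by simp [hp, hpq]), Finset.card_insert_of_notMem hq]
      at this
    omega
  have hFn : F.Nonempty := Finset.card_pos.1 (by omega)
  obtain ⟨f, hf⟩ := id hFn
  have mp : p ∈ K := by simp [hK]
  have mq : q ∈ K := by simp [hK]
  have hFK : F ⊆ K := by
    rw [hK]; exact (Finset.subset_insert _ _).trans (Finset.subset_insert _ _)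
  have hKF : K \ F = {p, q} := by
    rw [hK]
    ext a
    simp only [Finset.mem_sdiff, Finset.mem_insert, Finset.mem_singleton]
    constructor
    · tauto
    · rintro (rfl | rfl) <;> simp [hp, hq]
  have ep : K.erase p = insert q F := by
    rw [hK, Finset.erase_insert (by simp [hp, hpq])]
  have eq : K.erase q = insert p F := by
    rw [hK, Finset.insert_comm, Finset.erase_insert (by simp [hq, hpq.symm])]
  obtain ⟨tp, h, Hp⟩ := exists_isHeight x hFn hp
  obtain ⟨tq, h', Hq⟩ := exists_isHeight x hFn hq
  have hpos : 0 < inner ℝ h h := inner_height_self_pos (by rw [← eq]; exact hw.indep q mq) Hp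
  have hdep := (dependency_eq_sum_heights hFK
    (affineIndependent_subset (hw.indep p mp) (by rw [ep]; exact Finset.subset_insert _ _))
    hw.sum_eq hw.smul_eq (t := fun a => if a = p then tp else tq)
    (h := fun a => if a = p then h else h') (by
      intro a ha
      rw [hKF] at ha
      rcases Finset.mem_insert.1 ha with rfl | ha
      · simpa using Hp
      · obtain rfl := Finset.mem_singleton.1 ha
        simpa [hpq.symm] using Hq)).1
  rw [hKF, Finset.sum_pair hpq] at hdep
  simp only [if_true, if_neg hpq.symm] at hdep
  have wp := hw.ne_zero p mp
  have wq := hw.ne_zero q mq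
  have gp : inner ℝ (x p - x f) h = inner ℝ h h := (Hp.inner_eq hp hf Hp.orth).symm
  have gq : w q * inner ℝ (x q - x f) h = -w p * inner ℝ h h := by
    rw [← Hq.inner_eq hq hf Hp.orth]
    have := congrArg (fun z => inner ℝ z h) hdep
    simp only [inner_add_left, real_inner_smul_left, inner_zero_left] at this
    linarith
  have hS := fun y hy => inner_eq_zero_of_mem_affineSpan (x := x) hf Hp.orth (y := y) hy
  have np : x p ∉ affineSpan ℝ (x '' (F : Set W)) := fun hy => by
    have := hS _ hy
    rw [gp] at this
    exact hpos.ne' this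
  have nq : x q ∉ affineSpan ℝ (x '' (F : Set W)) := fun hy => by
    have := hS _ hy
    rw [this, mul_zero] at gq
    exact mul_ne_zero (neg_ne_zero.2 wp) hpos.ne' gq.symm
  have mf : x f ∈ affineSpan ℝ (x '' (F : Set W)) :=
    subset_affineSpan ℝ _ (Set.mem_image_of_mem x (by simpa using hf))
  rw [AffineSubspace.sSameSide_iff_exists_left mf]
  constructor
  · rintro ⟨-, -, y, hy, hray⟩
    rcases hray with h0 | h0 | ⟨r₁, r₂, h1, h2, h3⟩
    · exact absurd (vsub_eq_zero_iff_eq.1 h0 ▸ mf) np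
    · exact absurd (vsub_eq_zero_iff_eq.1 h0 ▸ hy) nq
    · have h4 := congrArg (fun z => inner ℝ z h) h3
      simp only [real_inner_smul_left, vsub_eq_sub] at h4
      have h5 : inner ℝ (x q - y) h = inner ℝ (x q - x f) h := by
        have := hS y hy
        rw [inner_sub_left] at this ⊢
        rw [inner_sub_left]
        linarith
      rw [gp, h5] at h4
      have h6 : w q * (r₁ * inner ℝ h h) = -r₂ * w p * inner ℝ h h := by
        rw [h4]; linear_combination r₂ * gq
      have h7 : r₁ * w q = -r₂ * w p := mul_right_cancel₀ hpos.ne' (by linarith)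
      have h8 : r₁ * (w p * w q) = -r₂ * w p ^ 2 := by linear_combination w p * h7
      by_contra hcon
      have : 0 ≤ r₁ * (w p * w q) := mul_nonneg h1.le (not_lt.1 hcon)
      have : 0 < r₂ * w p ^ 2 := mul_pos h2 (by positivity)
      linarith
  · intro hneg
    refine ⟨np, nq, x q + (w p / w q) • (x p - x f), ?_, ?_⟩
    · have e1 : x q + (w p / w q) • (x p - x f) - x f =
          (-(w q)⁻¹) • ∑ a ∈ F, w a • (x a - x f) := by
        have s1 : ∑ a ∈ K, w a • (x a - x f) = 0 := by
          simp only [smul_sub, Finset.sum_sub_distrib, ← Finset.sum_smul, hw.sum_eq, hw.smul_eq,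
            zero_smul, sub_zero]
        rw [hK, Finset.sum_insert (by simp [hp, hpq]), Finset.sum_insert hq] at s1
        have s2 : ∑ a ∈ F, w a • (x a - x f) = -(w p • (x p - x f) + w q • (x q - x f)) := by
          rw [eq_neg_iff_add_eq_zero, ← s1]; abel
        rw [s2, smul_neg, neg_smul, neg_neg, smul_add, smul_smul, smul_smul,
          inv_mul_cancel₀ wq, one_smul, div_eq_inv_mul]
        abel
      have e2 : x q + (w p / w q) • (x p - x f) - x f ∈
          (affineSpan ℝ (x '' (F : Set W))).direction := by
        rw [e1]
        refine Submodule.smul_mem _ _ (Submodule.sum_mem _ fun a ha => Submodule.smul_mem _ _ ?_)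
        exact AffineSubspace.vsub_mem_direction
          (subset_affineSpan ℝ _ (Set.mem_image_of_mem x (by simpa using ha))) mf
      have := AffineSubspace.vadd_mem_of_mem_direction e2 mf
      simpa using this
    · have hr : 0 < -(w p / w q) := by
        have : w p / w q = w p * w q / (w q) ^ 2 := by field_simp
        rw [this, ← neg_div]
        exact div_pos (by linarith) (by positivity)
      refine Or.inr (Or.inr ⟨-(w p / w q), 1, hr, one_pos, ?_⟩)
      simp only [vsub_eq_sub, one_smul]
      module

end Sides

/-! ### The differential of the area -/

section Area

theorem simplexVolume_fin_three {E : Type*} [NormedAddCommGroup E] [InnerProductSpace ℝ E]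
    (y : Fin 3 → E) : simplexVolume (sqDist y) =
      Real.sqrt (inner ℝ (y 1 - y 0) (y 1 - y 0) * inner ℝ (y 2 - y 0) (y 2 - y 0) -
        inner ℝ (y 1 - y 0) (y 2 - y 0) ^ 2) / 2 := by
  have hdet : (cayleyMenger (sqDist y)).det =
      -4 * (inner ℝ (y 1 - y 0) (y 1 - y 0) * inner ℝ (y 2 - y 0) (y 2 - y 0) -
        inner ℝ (y 1 - y 0) (y 2 - y 0) ^ 2) := by
    rw [← Matrix.det_submatrix_equiv_self (finSuccEquiv 3)]
    have e : (cayleyMenger (sqDist y)).submatrix (finSuccEquiv 3) (finSuccEquiv 3) =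
        !![0, 1, 1, 1; 1, 0, sqDist y 0 1, sqDist y 0 2; 1, sqDist y 1 0, 0, sqDist y 1 2;
          1, sqDist y 2 0, sqDist y 2 1, 0] := by
      have f0 : finSuccEquiv 3 0 = none := rfl
      have f1 : finSuccEquiv 3 1 = some 0 := rfl
      have f2 : finSuccEquiv 3 2 = some 1 := rfl
      have f3 : finSuccEquiv 3 3 = some 2 := rfl
      ext i j
      fin_cases i <;> fin_cases j <;> simp [cayleyMenger, f0, f1, f2, f3, sqDist]
    have s1 : sqDist y 0 1 = inner ℝ (y 1 - y 0) (y 1 - y 0) := by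
      rw [sqDist, real_inner_self_eq_norm_sq, norm_sub_rev]
    have s2 : sqDist y 0 2 = inner ℝ (y 2 - y 0) (y 2 - y 0) := by
      rw [sqDist, real_inner_self_eq_norm_sq, norm_sub_rev]
    have s3 : sqDist y 1 2 = inner ℝ (y 1 - y 0) (y 1 - y 0) -
        2 * inner ℝ (y 1 - y 0) (y 2 - y 0) + inner ℝ (y 2 - y 0) (y 2 - y 0) := by
      rw [sqDist, real_inner_self_eq_norm_sq, real_inner_self_eq_norm_sq, ← norm_sub_sq_real,
        sub_sub_sub_cancel_right]
    have s4 : ∀ i j, sqDist y i j = sqDist y j i := fun i j => by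
      rw [sqDist, sqDist, norm_sub_rev]
    rw [e, s4 1 0, s4 2 0, s4 2 1, s1, s2, s3]
    simp [Matrix.det_succ_row_zero, Fin.sum_univ_succ, Fin.succAbove]
    ring
  rw [simplexVolume, hdet, Fintype.card_fin]
  norm_num

variable {Γ W : Type*} [Group Γ] [MulAction Γ W] [DecidableEq W]

/-- The derivative of the area of a triangle whose vertices `y + s • v` move. -/
theorem fderiv_area {E ι : Type*} [NormedAddCommGroup E] [InnerProductSpace ℝ E] [Fintype ι]
    [DecidableEq ι] (e : Fin 3 ≃ ι) (y v : ι → E) {u w u' w' : E} (hu : y (e 1) - y (e 0) = u)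
    (hw : y (e 2) - y (e 0) = w) (hu' : v (e 1) - v (e 0) = u') (hw' : v (e 2) - v (e 0) = w')
    {S : ℝ} (hS : 0 < S) (hSq : inner ℝ u u * inner ℝ w w - inner ℝ u w ^ 2 = S ^ 2) :
    fderiv ℝ (fun y : ι → E => simplexVolume (sqDist y)) y v =
      (inner ℝ u u' * inner ℝ w w + inner ℝ u u * inner ℝ w w' -
        inner ℝ u w * (inner ℝ u' w + inner ℝ u w')) / (2 * S) := by
  have hf : (fun y : ι → E => simplexVolume (sqDist y)) = fun y =>
      Real.sqrt (inner ℝ (y (e 1) - y (e 0)) (y (e 1) - y (e 0)) *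
        inner ℝ (y (e 2) - y (e 0)) (y (e 2) - y (e 0)) -
        inner ℝ (y (e 1) - y (e 0)) (y (e 2) - y (e 0)) ^ 2) / 2 := by
    ext y
    rw [← simplexVolume_reindex e]
    exact simplexVolume_fin_three (y ∘ e)
  rw [hf]
  have hne : inner ℝ (y (e 1) - y (e 0)) (y (e 1) - y (e 0)) *
        inner ℝ (y (e 2) - y (e 0)) (y (e 2) - y (e 0)) -
        inner ℝ (y (e 1) - y (e 0)) (y (e 2) - y (e 0)) ^ 2 ≠ 0 := by
    rw [hu, hw, hSq]; positivity
  have hdiff : DifferentiableAt ℝ (fun y : ι → E =>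
      Real.sqrt (inner ℝ (y (e 1) - y (e 0)) (y (e 1) - y (e 0)) *
        inner ℝ (y (e 2) - y (e 0)) (y (e 2) - y (e 0)) -
        inner ℝ (y (e 1) - y (e 0)) (y (e 2) - y (e 0)) ^ 2) / 2) y := by
    have ha : ∀ i, DifferentiableAt ℝ (fun y : ι → E => y i) y := fun i =>
      differentiableAt_pi.1 differentiableAt_id i
    have hb : ∀ i j, DifferentiableAt ℝ (fun y : ι → E => y i - y j) y := fun i j =>
      (ha i).sub (ha j)
    simp only [div_eq_mul_inv]
    exact (((((hb _ _).inner ℝ (hb _ _)).mul ((hb _ _).inner ℝ (hb _ _))).sub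
      (((hb _ _).inner ℝ (hb _ _)).pow 2)).sqrt hne).mul_const _
  have hline : HasDerivAt (fun s : ℝ => y + s • v) v 0 := by
    simpa using ((hasDerivAt_id (0 : ℝ)).smul_const v).const_add y
  have h0 : y + (0 : ℝ) • v = y := by simp
  have hdiff' := hdiff
  rw [← h0] at hdiff'
  have hcomp := hdiff'.hasFDerivAt.comp_hasDerivAt (0 : ℝ) hline
  rw [h0] at hcomp
  refine hcomp.unique ?_
  have hU : HasDerivAt (fun s : ℝ => (y + s • v) (e 1) - (y + s • v) (e 0)) u' 0 := by
    rw [← hu']; exact ((hasDerivAt_pi.1 hline (e 1)).sub (hasDerivAt_pi.1 hline (e 0)))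
  have hV : HasDerivAt (fun s : ℝ => (y + s • v) (e 2) - (y + s • v) (e 0)) w' 0 := by
    rw [← hw']; exact ((hasDerivAt_pi.1 hline (e 2)).sub (hasDerivAt_pi.1 hline (e 0)))
  have hP := ((((hU.inner ℝ hU).mul (hV.inner ℝ hV)).sub ((hU.inner ℝ hV).pow 2)).sqrt (by
    simp only [h0, Pi.sub_apply, Pi.mul_apply, Pi.pow_apply]; exact hne)).div_const 2
  refine hP.congr_deriv ?_
  simp only [h0, hu, hw, Pi.sub_apply, Pi.mul_apply, Pi.pow_apply, hSq, Real.sqrt_sq hS.le]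
  rw [real_inner_comm u u', real_inner_comm w w']
  field_simp
  ring

/-- `S dS = -1/2 ∑ L_e ⟨x_g - m_e, v_e⟩` where the edge `e`, with midpoint `m_e`,
is opposite to the vertex `g`. -/
theorem volume_mul_areaDiff (X : Development Γ W) {t : Finset W} (ht : t.card = 3)
    (hind : AffineIndependent ℝ fun p : t => X.pos p) (v : EdgeField W)
    (hv : ∀ g ∈ t, ∀ p ∈ t.erase g, ∀ q ∈ t.erase g,
      inner ℝ (v (t.erase g)) (X.pos p - X.pos q) = 0) :
    X.volume t * X.areaDiff t v = -(∑ g ∈ t, X.sqLength (t.erase g) *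
      inner ℝ (X.pos g - X.midpoint (t.erase g)) (v (t.erase g))) / 2 := by
  have hS : 0 < X.volume t := vol_triangle_pos ht hind
  obtain ⟨a, b, c, hab, hac, hbc, rfl⟩ := Finset.card_eq_three.1 ht
  have ea : ({a, b, c} : Finset W).erase a = {b, c} := by
    ext z; simp only [Finset.mem_erase, Finset.mem_insert, Finset.mem_singleton]
    constructor
    · tauto
    · rintro (rfl | rfl) <;> simp [hab.symm, hac.symm]
  have eb : ({a, b, c} : Finset W).erase b = {a, c} := by
    ext z; simp only [Finset.mem_erase, Finset.mem_insert, Finset.mem_singleton]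
    constructor
    · tauto
    · rintro (rfl | rfl) <;> simp [hab, hbc.symm]
  have ec : ({a, b, c} : Finset W).erase c = {a, b} := by
    ext z; simp only [Finset.mem_erase, Finset.mem_insert, Finset.mem_singleton]
    constructor
    · tauto
    · rintro (rfl | rfl) <;> simp [hac, hbc]
  have va := hv a (by simp)
  have vb := hv b (by simp)
  have vc := hv c (by simp)
  rw [ea] at va
  rw [eb] at vb
  rw [ec] at vc
  have va := va b (by simp) c (by simp)
  have vb := vb a (by simp) c (by simp)
  have vc := vc a (by simp) b (by simp)
  rw [Finset.sum_insert (by simp [hab, hac]), Finset.sum_pair hbc, ea, eb, ec]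
  -- the area in terms of two sides
  have hV : X.volume {a, b, c} = Real.sqrt (inner ℝ (X.pos b - X.pos a) (X.pos b - X.pos a) *
      inner ℝ (X.pos c - X.pos a) (X.pos c - X.pos a) -
        inner ℝ (X.pos b - X.pos a) (X.pos c - X.pos a) ^ 2) / 2 := by
    let e : Fin 3 ≃ ({a, b, c} : Finset W) := Equiv.ofBijective
      ![⟨a, by simp⟩, ⟨b, by simp⟩, ⟨c, by simp⟩] ⟨by
        intro i j
        fin_cases i <;> fin_cases j <;> simp [hab, hac, hbc, hab.symm, hac.symm, hbc.symm], by
        rintro ⟨z, hz⟩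
        simp only [Finset.mem_insert, Finset.mem_singleton] at hz
        rcases hz with rfl | rfl | rfl
        · exact ⟨0, rfl⟩
        · exact ⟨1, rfl⟩
        · exact ⟨2, rfl⟩⟩
    rw [Development.volume, ← simplexVolume_reindex e]
    exact simplexVolume_fin_three fun i => X.pos (e i)
  let e : Fin 3 ≃ ({a, b, c} : Finset W).powersetCard 2 := Equiv.ofBijective
      ![⟨{b, c}, Finset.mem_powersetCard.2 ⟨by
          intro z; simp only [Finset.mem_insert, Finset.mem_singleton]; tauto, Finset.card_pair hbc⟩⟩,
        ⟨{a, c}, Finset.mem_powersetCard.2 ⟨by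
          intro z; simp only [Finset.mem_insert, Finset.mem_singleton]; tauto, Finset.card_pair hac⟩⟩,
        ⟨{a, b}, Finset.mem_powersetCard.2 ⟨by
          intro z; simp only [Finset.mem_insert, Finset.mem_singleton]; tauto, Finset.card_pair hab⟩⟩]
      ((Fintype.bijective_iff_surjective_and_card _).2 ⟨by
        rintro ⟨s, hs⟩
        rw [Finset.mem_powersetCard] at hs
        obtain ⟨g, hg⟩ := Finset.card_eq_one.1 (show (({a, b, c} : Finset W) \ s).card = 1 by
          rw [Finset.card_sdiff_of_subset hs.1, ht, hs.2])
        have hgt : g ∈ ({a, b, c} : Finset W) := (Finset.mem_sdiff.1 (hg ▸ Finset.mem_singleton_self g)).1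
        have hs' : s = ({a, b, c} : Finset W).erase g := by
          rw [← Finset.sdiff_singleton_eq_erase, ← hg, Finset.sdiff_sdiff_eq_self hs.1]
        simp only [Finset.mem_insert, Finset.mem_singleton] at hgt
        rcases hgt with rfl | rfl | rfl
        · exact ⟨0, Subtype.ext (hs'.trans ea).symm⟩
        · exact ⟨1, Subtype.ext (hs'.trans eb).symm⟩
        · exact ⟨2, Subtype.ext (hs'.trans ec).symm⟩,
      by rw [Fintype.card_coe, Finset.card_powersetCard, ht]; rfl⟩)
  have m : ∀ p q, p ≠ q → X.midpoint {p, q} = (2 : ℝ)⁻¹ • (X.pos p + X.pos q) := by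
    intro p q hpq
    rw [Development.midpoint, Finset.sum_pair hpq, Finset.card_pair hpq]; norm_num
  have L : ∀ p q, p ≠ q → X.sqLength {p, q} = inner ℝ (X.pos p - X.pos q) (X.pos p - X.pos q) := by
    intro p q hpq
    rw [Development.sqLength, Finset.sum_pair hpq, Finset.sum_pair hpq, Finset.sum_pair hpq,
      real_inner_self_eq_norm_sq, norm_sub_rev (X.pos q)]
    simp
  obtain ⟨u, hu⟩ : ∃ u, u = (2 : ℝ)⁻¹ • (X.pos a - X.pos b) := ⟨_, rfl⟩
  obtain ⟨w, hw⟩ : ∃ w, w = (2 : ℝ)⁻¹ • (X.pos a - X.pos c) := ⟨_, rfl⟩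
  have d1 : X.pos a - X.pos b = (2 : ℝ) • u := by rw [hu]; module
  have d2 : X.pos a - X.pos c = (2 : ℝ) • w := by rw [hw]; module
  have d3 : X.pos b - X.pos c = (2 : ℝ) • (w - u) := by rw [hu, hw]; module
  have d4 : X.pos b - X.pos a = (-2 : ℝ) • u := by rw [hu]; module
  have d5 : X.pos c - X.pos a = (-2 : ℝ) • w := by rw [hw]; module
  have m1 : X.pos a - X.midpoint {b, c} = u + w := by rw [m _ _ hbc, hu, hw]; module
  have m2 : X.pos b - X.midpoint {a, c} = w - (2 : ℝ) • u := by rw [m _ _ hac, hu, hw]; module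
  have m3 : X.pos c - X.midpoint {a, b} = u - (2 : ℝ) • w := by rw [m _ _ hab, hu, hw]; module
  have hG : inner ℝ u u * inner ℝ w w - inner ℝ u w ^ 2 = (X.volume {a, b, c} / 2) ^ 2 := by
    rw [d4, d5] at hV
    simp only [real_inner_smul_left, real_inner_smul_right] at hV
    have h0 : 0 ≤ inner ℝ u u * inner ℝ w w - inner ℝ u w ^ 2 := by
      have := real_inner_mul_inner_self_le u w
      nlinarith
    rw [hV, div_div, div_pow, Real.sq_sqrt (by nlinarith)]
    ring
  have key := fderiv_area e (fun i => X.midpoint i) (fun i => v i) (u := u) (w := w)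
    (u' := v {a, c} - v {b, c}) (w' := v {a, b} - v {b, c}) (S := X.volume {a, b, c} / 2)
    (by
      change X.midpoint {a, c} - X.midpoint {b, c} = _
      rw [m _ _ hac, m _ _ hbc, hu]; module)
    (by
      change X.midpoint {a, b} - X.midpoint {b, c} = _
      rw [m _ _ hab, m _ _ hbc, hw]; module) rfl rfl (by positivity) hG
  have hd : X.areaDiff {a, b, c} v = 4 * fderiv ℝ (fun y : ({a, b, c} : Finset W).powersetCard 2 →
    E4 => simplexVolume (sqDist y)) (fun i => X.midpoint i) (fun i => v i) := rfl
  rw [hd, key, m1, m2, m3, L _ _ hab, L _ _ hac, L _ _ hbc, d1, d2, d3]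
  rw [d3, real_inner_smul_right, real_inner_comm, inner_sub_left] at va
  rw [d2, real_inner_smul_right, real_inner_comm] at vb
  rw [d1, real_inner_smul_right, real_inner_comm] at vc
  simp only [real_inner_smul_left, real_inner_smul_right, inner_sub_left, inner_sub_right,
    inner_add_left, real_inner_comm w (v _), real_inner_comm u w]
  generalize (inner ℝ u u : ℝ) = uu at *
  generalize (inner ℝ w w : ℝ) = ww at *
  generalize (inner ℝ u w : ℝ) = uw at *
  generalize (inner ℝ u (v {b, c}) : ℝ) = u0 at *
  generalize (inner ℝ w (v {b, c}) : ℝ) = w0 at *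
  generalize (inner ℝ u (v {a, c}) : ℝ) = u1 at *
  generalize (inner ℝ w (v {a, c}) : ℝ) = w1 at *
  generalize (inner ℝ u (v {a, b}) : ℝ) = u2 at *
  generalize (inner ℝ w (v {a, b}) : ℝ) = w2 at *
  obtain rfl : w0 = u0 := by linarith
  obtain rfl : w1 = 0 := by linarith
  obtain rfl : u2 = 0 := by linarith
  field_simp
  ring

end Area

/-! ### Cells of the covering complex and of its quotient -/

section Orbits

variable {Γ W : Type*} [Group Γ] [MulAction Γ W] [DecidableEq W]

theorem cell_eq_iff {s t : Finset W} : cell Γ s = cell Γ t ↔ ∃ g : Γ, g • t = s := by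
  rw [cell, cell, Quotient.eq]
  exact MulAction.orbitRel_apply

theorem cell_smul (g : Γ) (s : Finset W) : cell Γ (g • s) = cell Γ s := cell_eq_iff.2 ⟨g, rfl⟩

theorem cell_out (q : Cell Γ W) : cell Γ q.out = q := Quotient.out_eq q

theorem smul_pair (g : Γ) (p q : W) : g • ({p, q} : Finset W) = {g • p, g • q} := by
  rw [Finset.smul_finset_insert, Finset.smul_finset_singleton]

namespace Development

variable (X : Development Γ W)

theorem pos_smul_sub (g : Γ) (p q : W) :
    X.pos (g • p) - X.pos (g • q) = (X.hol g).linearIsometryEquiv (X.pos p - X.pos q) := by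
  rw [X.pos_smul, X.pos_smul, ← vsub_eq_sub, ← vsub_eq_sub, AffineIsometryEquiv.map_vsub]

theorem norm_pos_smul_sub (g : Γ) (p q : W) :
    ‖X.pos (g • p) - X.pos (g • q)‖ = ‖X.pos p - X.pos q‖ := by
  rw [pos_smul_sub, LinearIsometryEquiv.norm_map]

theorem sqLength_smul (g : Γ) (e : Finset W) : X.sqLength (g • e) = X.sqLength e := by
  have h : ∀ f : W → ℝ, ∑ p ∈ g • e, f p = ∑ p ∈ e, f (g • p) := fun f =>
    Finset.sum_image fun p _ q _ hpq => MulAction.injective g hpq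
  rw [sqLength, sqLength, h]
  simp only [h, norm_pos_smul_sub]

/-- The bijection of the vertices of a cell with those of its translate. -/
def smulEquiv (g : Γ) (s : Finset W) : s ≃ (g • s : Finset W) where
  toFun p := ⟨g • p.1, Finset.smul_mem_smul_finset p.2⟩
  invFun p := ⟨g⁻¹ • p.1, by
    obtain ⟨q, hq, h⟩ := Finset.mem_smul_finset.1 p.2
    rw [← h, inv_smul_smul]; exact hq⟩
  left_inv p := by simp
  right_inv p := by simp

theorem volume_smul (g : Γ) (s : Finset W) : X.volume (g • s) = X.volume s := by
  rw [volume, volume, ← simplexVolume_reindex (smulEquiv g s)]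
  congr 1
  ext p q
  simp only [sqDist, smulEquiv, Equiv.coe_fn_mk, norm_pos_smul_sub]

theorem sqLength_pair {p q : W} (hpq : p ≠ q) : X.sqLength {p, q} = ‖X.pos p - X.pos q‖ ^ 2 := by
  rw [Development.sqLength, Finset.sum_pair hpq, Finset.sum_pair hpq, Finset.sum_pair hpq,
    norm_sub_rev (X.pos q)]
  simp

theorem midpoint_pair {p q : W} (hpq : p ≠ q) :
    X.midpoint {p, q} = (2 : ℝ)⁻¹ • (X.pos p + X.pos q) := by
  rw [Development.midpoint, Finset.sum_pair hpq, Finset.card_pair hpq]; norm_num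

theorem pos_sub_midpoint_smul (g : Γ) {e : Finset W} (he : e.card = 2) (a : W) :
    X.pos (g • a) - X.midpoint (g • e) =
      (X.hol g).linearIsometryEquiv (X.pos a - X.midpoint e) := by
  obtain ⟨p, q, hpq, rfl⟩ := Finset.card_eq_two.1 he
  have hpq' : g • p ≠ g • q := fun h => hpq (MulAction.injective g h)
  rw [smul_pair, X.midpoint_pair hpq, X.midpoint_pair hpq']
  have h1 : ∀ a p q : E4, a - (2 : ℝ)⁻¹ • (p + q) = (2 : ℝ)⁻¹ • ((a - p) + (a - q)) := by
    intro a p q; module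
  rw [h1, h1, pos_smul_sub, pos_smul_sub, map_smul, map_add]

theorem volume_out_cell (s : Finset W) : X.volume (cell Γ s).out = X.volume s := by
  obtain ⟨g, hg⟩ := cell_eq_iff.1 (cell_out (cell Γ s))
  rw [← hg, volume_smul]

end Development

theorem dihedralAngle_reindex {ι κ : Type*} [Fintype ι] [DecidableEq ι] [Fintype κ]
    [DecidableEq κ] (e : κ ≃ ι) (ℓ : ι → ι → ℝ) (k l : κ) :
    dihedralAngle (fun p q => ℓ (e p) (e q)) k l = dihedralAngle ℓ (e k) (e l) := by
  have h1 : cayleyMenger (fun p q => ℓ (e p) (e q)) =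
      (cayleyMenger ℓ).submatrix (Equiv.optionCongr e) (Equiv.optionCongr e) := by
    ext i j
    rcases i with _ | i <;> rcases j with _ | j <;> simp [cayleyMenger]
  have h2 : ∀ i j, (cayleyMenger (fun p q => ℓ (e p) (e q)))⁻¹ (some i) (some j) =
      (cayleyMenger ℓ)⁻¹ (some (e i)) (some (e j)) := by
    intro i j
    rw [h1, Matrix.inv_submatrix_equiv]
    rfl
  rw [dihedralAngle, dihedralAngle, h2, h2, h2]

theorem pullLength_smul (L : Cell Γ W → ℝ) (g : Γ) (p q : W) :
    Triangulation.pullLength L (g • p) (g • q) = Triangulation.pullLength L p q := by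
  rw [Triangulation.pullLength, Triangulation.pullLength, ← smul_pair, cell_smul]
  simp only [smul_left_cancel_iff]

theorem faceAng_smul (L : Cell Γ W → ℝ) (g : Γ) (σ t : Finset W) :
    faceAng (Triangulation.pullLength L) (g • σ) (g • t) =
      faceAng (Triangulation.pullLength L) σ t := by
  rw [faceAng, faceAng]
  congr 1
  rw [← Equiv.sum_comp (Development.smulEquiv g σ)]
  refine Finset.sum_congr rfl fun k _ => ?_
  rw [← Equiv.sum_comp (Development.smulEquiv g σ)]
  refine Finset.sum_congr rfl fun l _ => ?_
  have hm : ∀ p : σ, (Development.smulEquiv g σ p).1 ∈ g • t ↔ p.1 ∈ t := fun p =>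
    Finset.smul_mem_smul_finset_iff g
  have hd : dihedralAngle (fun p q : (g • σ : Finset W) => Triangulation.pullLength L p.1 q.1)
      (Development.smulEquiv g σ k) (Development.smulEquiv g σ l) =
      dihedralAngle (fun p q : σ => Triangulation.pullLength L p.1 q.1) k l := by
    rw [← dihedralAngle_reindex (Development.smulEquiv g σ)]
    congr 1
    ext p q
    exact pullLength_smul L g p q
  simp only [hm, (Development.smulEquiv g σ).injective.ne_iff, hd]

theorem flatLength_cell (X : Development Γ W) (e : Finset W) :
    Triangulation.flatLength X (cell Γ e) = X.sqLength e := by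
  obtain ⟨g, hg⟩ := cell_eq_iff.1 (cell_out (cell Γ e))
  rw [Triangulation.flatLength, ← hg, X.sqLength_smul]

theorem pullLength_flatLength (X : Development Γ W) (p q : W) :
    Triangulation.pullLength (Triangulation.flatLength X) p q = sqDist X.pos p q := by
  rw [Triangulation.pullLength, sqDist]
  split_ifs with h
  · simp [h]
  · rw [flatLength_cell, X.sqLength_pair h]

open Classical in
/-- The velocity of the squared length of `pq` when the squared length of the edge `a` of the
quotient varies with unit velocity. -/
def edgeVelocity (a : Cell Γ W) (p q : W) : ℝ := if p ≠ q ∧ cell Γ {p, q} = a then 1 else 0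

theorem edgeVelocity_comm (a : Cell Γ W) (p q : W) : edgeVelocity a p q = edgeVelocity a q p := by
  rw [edgeVelocity, edgeVelocity, Finset.pair_comm p q]
  have h : (p ≠ q ∧ cell Γ {q, p} = a) ↔ (q ≠ p ∧ cell Γ {q, p} = a) := and_congr_left' ne_comm
  split_ifs with h1 h2 h2
  · rfl
  · exact absurd (h.1 h1) h2
  · exact absurd (h.2 h2) h1
  · rfl

open Classical in
theorem hasDerivAt_pullLength (X : Development Γ W) (a : Cell Γ W) (p q : W) (r : ℝ) :
    HasDerivAt (fun s => Triangulation.pullLength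
      (Function.update (Triangulation.flatLength X) a s) p q) (edgeVelocity a p q) r := by
  simp only [Triangulation.pullLength, edgeVelocity]
  by_cases h : p = q
  · simp only [h, if_true, ne_eq, not_true, false_and, if_false]
    exact hasDerivAt_const _ _
  · by_cases h' : cell Γ {p, q} = a
    · subst h'
      simp only [h, if_false, ne_eq, not_false_eq_true, true_and, if_true, Function.update_self]
      exact hasDerivAt_id _
    · simp only [h, h', if_false, ne_eq, not_false_eq_true, and_false,
        Function.update_of_ne (Ne.intro h')]
      exact hasDerivAt_const _ _

open Classical in
/-- The derivative of the dihedral angle of `σ` at `t` with respect to the squared length of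
the edge `a` of the quotient. -/
def angleDeriv (X : Development Γ W) (a : Cell Γ W) (σ t : Finset W) : ℝ :=
  deriv (fun s => faceAng (Triangulation.pullLength
    (Function.update (Triangulation.flatLength X) a s)) σ t) (Triangulation.flatLength X a)

theorem angleDeriv_smul (X : Development Γ W) (a : Cell Γ W) (g : Γ) (σ t : Finset W) :
    angleDeriv X a (g • σ) (g • t) = angleDeriv X a σ t := by
  simp only [angleDeriv, faceAng_smul]

open Classical in
theorem differentiableAt_faceAng (X : Development Γ W) (a : Cell Γ W) {σ t : Finset W}
    (hσ : σ.card = 5) (hind : AffineIndependent ℝ fun p : σ => X.pos p) (ht : t.card = 3)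
    (htσ : t ⊆ σ) : DifferentiableAt ℝ (fun s => faceAng (Triangulation.pullLength
      (Function.update (Triangulation.flatLength X) a s)) σ t)
      (Triangulation.flatLength X a) := by
  have h2 : (σ \ t).card = 2 := by rw [Finset.card_sdiff_of_subset htσ]; omega
  obtain ⟨k, l, hkl, hs2⟩ := Finset.card_eq_two.1 h2
  have mk : k ∈ σ \ t := by simp [hs2]
  have ml : l ∈ σ \ t := by simp [hs2]
  rw [Finset.mem_sdiff] at mk ml
  have hσt : σ = insert k (insert l t) := by
    rw [← Finset.sdiff_union_of_subset htσ, hs2]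
    ext a; simp only [Finset.mem_union, Finset.mem_insert, Finset.mem_singleton]; tauto
  have htn : t.Nonempty := Finset.card_pos.1 (by omega)
  obtain ⟨tk, hk, Hk⟩ := exists_isHeight X.pos htn mk.2
  obtain ⟨tl, hl, Hl⟩ := exists_isHeight X.pos htn ml.2
  exact (hasDerivAt_faceAng htn mk.2 ml.2 hkl hσt subset_rfl hind Hk Hl
    (edgeVelocity_comm a) (fun p _ q _ => hasDerivAt_pullLength X a p q _)
    (fun p _ q _ => by rw [Function.update_eq_self, pullLength_flatLength])).2.differentiableAt

open Classical in
/-- The sum of `F σ t` over the two-dimensional faces `t` of `σ` in the orbit `i`. -/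
def orbitSum (F : Finset W → Finset W → ℝ) (σ : Finset W) (i : Cell Γ W) : ℝ :=
  ∑ t ∈ σ.powersetCard 3 with cell Γ t = i, F σ t

theorem orbitSum_smul {F : Finset W → Finset W → ℝ} {σ : Finset W} (g : Γ)
    (hF : ∀ t, F (g • σ) (g • t) = F σ t) (i : Cell Γ W) :
    orbitSum F (g • σ) i = orbitSum F σ i := by
  classical
  rw [orbitSum, orbitSum]
  symm
  refine Finset.sum_bij (fun t _ => g • t) ?_ ?_ ?_ ?_
  · intro t ht
    rw [Finset.mem_filter, Finset.mem_powersetCard] at ht ⊢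
    rw [cell_smul, Finset.card_smul_finset]
    exact ⟨⟨Finset.smul_finset_subset_smul_finset ht.1.1, ht.1.2⟩, ht.2⟩
  · intro t _ t' _ h
    exact smul_left_cancel g h
  · intro t ht
    rw [Finset.mem_filter, Finset.mem_powersetCard] at ht
    refine ⟨g⁻¹ • t, ?_, smul_inv_smul g t⟩
    rw [Finset.mem_filter, Finset.mem_powersetCard, cell_smul, Finset.card_smul_finset]
    refine ⟨⟨?_, ht.1.2⟩, ht.2⟩
    rw [← inv_smul_smul g σ]
    exact Finset.smul_finset_subset_smul_finset ht.1.1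
  · intro t _
    rw [hF]

theorem orbitSum_congr {F F' : Finset W → Finset W → ℝ} {σ : Finset W} (h : ∀ t, F σ t = F' σ t)
    (i : Cell Γ W) : orbitSum F σ i = orbitSum F' σ i :=
  Finset.sum_congr rfl fun t _ => h t

namespace Triangulation

variable {X : Development Γ W} (T : Triangulation X)

theorem smul_mem_coverCells {n : ℕ} {s : Finset W} (hs : s ∈ T.coverCells n) (g : Γ) :
    g • s ∈ T.coverCells n := by
  obtain ⟨h1, σ, hσ, h2⟩ := hs
  exact ⟨by rw [Finset.card_smul_finset, h1], g • σ, T.smul_mem g σ hσ,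
    Finset.smul_finset_subset_smul_finset h2⟩

theorem cell_mem_cells {n : ℕ} {s : Finset W} : cell Γ s ∈ T.cells n ↔ s ∈ T.coverCells n := by
  constructor
  · rintro ⟨t, ht, h⟩
    obtain ⟨g, hg⟩ := cell_eq_iff.1 h.symm
    rw [← hg]
    exact T.smul_mem_coverCells ht g
  · exact fun h => ⟨s, h, rfl⟩

theorem out_mem_coverCells {n : ℕ} {q : Cell Γ W} (hq : q ∈ T.cells n) : q.out ∈ T.coverCells n := by
  rwa [← T.cell_mem_cells, cell_out]

theorem coverCells_five : T.coverCells 5 = T.simplices := by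
  ext σ
  constructor
  · rintro ⟨h1, τ, hτ, h2⟩
    rwa [Finset.eq_of_subset_of_card_le h2 (by rw [h1, T.card_eq τ hτ])]
  · exact fun h => ⟨T.card_eq σ h, σ, h, subset_rfl⟩

theorem out_mem_simplices {q : Cell Γ W} (hq : q ∈ T.cells 5) : q.out ∈ T.simplices := by
  rw [← coverCells_five]
  exact T.out_mem_coverCells hq

theorem affineIndependent_of_mem {n : ℕ} {s : Finset W} (hs : s ∈ T.coverCells n) :
    AffineIndependent ℝ fun p : s => X.pos p := by
  obtain ⟨-, σ, hσ, h⟩ := hs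
  exact affineIndependent_subset (T.nondegenerate σ hσ) h

/-- The sum over the star of the face `t` in the covering complex, as a sum over the 4-simplices of
the quotient. -/
theorem finsum_star {F : Finset W → Finset W → ℝ}
    (hF : ∀ (g : Γ), ∀ σ ∈ T.simplices, ∀ t, F (g • σ) (g • t) = F σ t) {t : Finset W}
    (ht : t.card = 3) :
    ∑ᶠ σ ∈ {σ ∈ T.simplices | t ⊆ σ}, F σ t = ∑ q : T.cells 5, orbitSum F q.1.out (cell Γ t) := by
  classical
  have htn : t.Nonempty := Finset.card_pos.1 (by omega)
  have hex : ∀ σ : Finset W, ∃ g : Γ, g • (cell Γ σ).out = σ := fun σ =>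
    cell_eq_iff.1 (cell_out (cell Γ σ)).symm
  choose γ hγ using hex
  let S : Finset (Σ _ : T.cells 5, Finset W) := Finset.univ.sigma fun q =>
    (q.1.out.powersetCard 3).filter fun t' => cell Γ t' = cell Γ t
  have hS : ∑ q : T.cells 5, orbitSum F q.1.out (cell Γ t) = ∑ z ∈ S, F z.1.1.out z.2 := by
    rw [Finset.sum_sigma]
    rfl
  rw [hS, ← finsum_mem_coe_finset]
  symm
  -- the simplex of the star of `t` which is the translate of `q.out` that maps `t'` to `t`
  have hex' : ∀ z ∈ S, ∃ g : Γ, g • z.2 = t := by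
    intro z hz
    have := (Finset.mem_filter.1 (Finset.mem_sigma.1 hz).2).2
    exact cell_eq_iff.1 this.symm
  choose! δ hδ using hex'
  have hmem : ∀ z ∈ S, z.2 ⊆ z.1.1.out ∧ z.2.Nonempty := by
    intro z hz
    have h1 := Finset.mem_powersetCard.1 (Finset.mem_filter.1 (Finset.mem_sigma.1 hz).2).1
    exact ⟨h1.1, Finset.card_pos.1 (by omega)⟩
  refine finsum_mem_eq_of_bijOn (fun z => δ z • z.1.1.out) ⟨?_, ?_, ?_⟩ ?_
  · intro z hz
    refine ⟨T.smul_mem _ _ (T.out_mem_simplices z.1.2), ?_⟩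
    conv_lhs => rw [← hδ z hz]
    exact Finset.smul_finset_subset_smul_finset (hmem z hz).1
  · rintro ⟨⟨q, hq⟩, t₁⟩ hz ⟨⟨q', hq'⟩, t₂⟩ hz' h
    have e1 := hδ _ hz
    have e2 := hδ _ hz'
    have m1 := hmem _ hz
    simp only at e1 e2 h m1
    generalize δ ⟨⟨q, hq⟩, t₁⟩ = g at *
    generalize δ ⟨⟨q', hq'⟩, t₂⟩ = g' at *
    have hqq : q = q' := by
      rw [← cell_out q, ← cell_out q', ← cell_smul g, h, cell_smul]
    subst hqq
    have hg : g'⁻¹ * g = 1 := by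
      refine T.free _ q.out (T.out_mem_simplices hq) q.out subset_rfl ?_ ?_
      · exact m1.2.mono m1.1
      · rw [mul_smul, h, inv_smul_smul]
    have hgg : g = g' := by rwa [inv_mul_eq_one, eq_comm] at hg
    subst hgg
    have : t₁ = t₂ := smul_left_cancel g (e1.trans e2.symm)
    subst this
    rfl
  · rintro σ ⟨hσ, htσ⟩
    have hq : cell Γ σ ∈ T.cells 5 := T.cell_mem_cells.2 (by rw [T.coverCells_five]; exact hσ)
    have hz : (⟨⟨cell Γ σ, hq⟩, (γ σ)⁻¹ • t⟩ : Σ _ : T.cells 5, Finset W) ∈ (S : Set _) := by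
      refine Finset.mem_sigma.2 ⟨Finset.mem_univ _, Finset.mem_filter.2
        ⟨Finset.mem_powersetCard.2 ⟨?_, by rw [Finset.card_smul_finset, ht]⟩, cell_smul _ _⟩⟩
      have h1 : (γ σ)⁻¹ • σ = (cell Γ σ).out := inv_smul_eq_iff.2 (hγ σ).symm
      have := Finset.smul_finset_subset_smul_finset (a := (γ σ)⁻¹) htσ
      rwa [h1] at this
    refine ⟨_, hz, ?_⟩
    have e1 := hδ _ hz
    simp only at e1
    have hg : δ ⟨⟨cell Γ σ, hq⟩, (γ σ)⁻¹ • t⟩ * (γ σ)⁻¹ = 1 :=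
      T.free _ σ hσ t htσ htn (by rw [mul_smul]; exact e1)
    simp only
    rw [mul_eq_one_iff_eq_inv, inv_inv] at hg
    rw [hg, hγ]
  · intro z hz
    conv_rhs => rw [← hδ z hz]
    rw [hF _ _ (T.out_mem_simplices z.1.2)]

/-- The derivative of the deficit angle at the orbit `i` with respect to the squared length of `a`. -/
def curvature (i a : Cell Γ W) : ℝ :=
  -∑ q : T.cells 5, orbitSum (fun σ t => ((T.sign σ : ℤ) : ℝ) * angleDeriv X a σ t) q.1.out i

open Classical in
theorem curvatureMatrix_apply (i : T.Face) (a : T.Edge) :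
    T.curvatureMatrix i a = T.curvature i.1 a.1 := by
  have hcard : i.1.out.card = 3 := (T.out_mem_coverCells i.2).1
  have hdef : ∀ L : Cell Γ W → ℝ, T.deficit L i.1.out = -∑ q : T.cells 5,
      orbitSum (fun σ t => ((T.sign σ : ℤ) : ℝ) * faceAng (pullLength L) σ t) q.1.out i.1 := by
    intro L
    rw [deficit]
    have := T.finsum_star (F := fun σ t => ((T.sign σ : ℤ) : ℝ) * faceAng (pullLength L) σ t)
      (fun g σ hσ t => by rw [T.sign_smul g σ hσ, faceAng_smul]) hcard
    rw [cell_out] at this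
    rw [← this]
    rfl
  rw [curvatureMatrix, Matrix.of_apply]
  simp only [hdef]
  refine HasDerivAt.deriv ?_
  refine HasDerivAt.fun_neg (HasDerivAt.fun_sum fun q _ => HasDerivAt.fun_sum fun t ht => ?_)
  rw [Finset.mem_filter, Finset.mem_powersetCard] at ht
  have hσ := T.out_mem_simplices q.2
  refine HasDerivAt.const_mul _ ?_
  exact (differentiableAt_faceAng X a.1 (T.card_eq _ hσ) (T.nondegenerate _ hσ) ht.1.2
    ht.1.1).hasDerivAt

open Classical in
theorem curvature_eq_zero_left {i : Cell Γ W} (hi : i ∉ T.cells 3) (a : Cell Γ W) :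
    T.curvature i a = 0 := by
  rw [curvature, neg_eq_zero]
  refine Finset.sum_eq_zero fun q _ => ?_
  rw [orbitSum]
  refine Finset.sum_eq_zero fun t ht => ?_
  rw [Finset.mem_filter, Finset.mem_powersetCard] at ht
  refine absurd ?_ hi
  rw [← ht.2]
  exact T.cell_mem_cells.2 ⟨ht.1.2, _, T.out_mem_simplices q.2, ht.1.1⟩

open Classical in
theorem curvature_eq_zero_right (i : Cell Γ W) {a : Cell Γ W} (ha : a ∉ T.cells 2) :
    T.curvature i a = 0 := by
  rw [curvature, neg_eq_zero]
  refine Finset.sum_eq_zero fun q _ => ?_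
  rw [orbitSum]
  refine Finset.sum_eq_zero fun t ht => ?_
  have hconst : ∀ s, faceAng (pullLength (Function.update (flatLength X) a s)) q.1.out t =
      faceAng (pullLength (flatLength X)) q.1.out t := by
    intro s
    have : ∀ k l : q.1.out, pullLength (Function.update (flatLength X) a s) k.1 l.1 =
        pullLength (flatLength X) k.1 l.1 := by
      intro k l
      rw [pullLength, pullLength]
      split_ifs with h
      · rfl
      · rw [Function.update_of_ne]
        rintro rfl
        refine ha (T.cell_mem_cells.2 ⟨Finset.card_pair h, _, T.out_mem_simplices q.2, ?_⟩)
        exact Finset.insert_subset k.2 (Finset.singleton_subset_iff.2 l.2)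
    simp only [faceAng, this]
  simp only [angleDeriv, hconst, deriv_const, mul_zero]

end Triangulation

end Orbits

/-! ### Combinatorics of the move `2 → 4` -/

namespace IsMove24

variable {Γ W : Type*} [Group Γ] [MulAction Γ W] [DecidableEq W] {X : Development Γ W}
  {T T' : Triangulation X} {A B : W} {κ : Finset W} (hm : IsMove24 T T' A B κ)

include hm

theorem notMem_insert : A ∉ insert B κ := by
  simp [hm.ne, hm.notMem_left]

theorem card_six : (insert A (insert B κ)).card = 6 := by
  rw [Finset.card_insert_of_notMem hm.notMem_insert, Finset.card_insert_of_notMem hm.notMem_right,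
    hm.card_eq]

theorem erase_left : (insert A (insert B κ)).erase A = insert B κ :=
  Finset.erase_insert hm.notMem_insert

theorem erase_right : (insert A (insert B κ)).erase B = insert A κ := by
  rw [Finset.insert_comm, Finset.erase_insert]
  simp [hm.ne.symm, hm.notMem_right]

theorem erase_mem {c : W} (hc : c ∈ κ) :
    (insert A (insert B κ)).erase c = insert A (insert B (κ.erase c)) := by
  rw [Finset.erase_insert_of_ne, Finset.erase_insert_of_ne]
  · rintro rfl; exact hm.notMem_right hc
  · rintro rfl; exact hm.notMem_left hc

theorem nonempty : κ.Nonempty := Finset.card_pos.1 (by rw [hm.card_eq]; omega)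

theorem ne_left {c : W} (hc : c ∈ κ) : c ≠ A := by
  rintro rfl; exact hm.notMem_left hc

theorem ne_right {c : W} (hc : c ∈ κ) : c ≠ B := by
  rintro rfl; exact hm.notMem_right hc

theorem new_mem {c : W} (hc : c ∈ κ) : (insert A (insert B κ)).erase c ∈ T'.simplices := by
  rw [hm.simplices_eq]
  exact Or.inr ⟨c, hc, by rw [hm.erase_mem hc]⟩

theorem pair_subset_erase {c : W} (hc : c ∈ κ) : {A, B} ⊆ (insert A (insert B κ)).erase c := by
  rw [hm.erase_mem hc]
  intro p hp
  simp only [Finset.mem_insert, Finset.mem_singleton] at hp ⊢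
  tauto

theorem old_of_not_subset {s : Finset W} (hs : s ⊆ insert A (insert B κ))
    (h : ¬({A, B} : Finset W) ⊆ s) : ∃ σ ∈ T.simplices, s ⊆ σ := by
  have h' : A ∉ s ∨ B ∉ s := by
    by_contra! h'
    exact h (Finset.insert_subset h'.1 (Finset.singleton_subset_iff.2 h'.2))
  rcases h' with h' | h'
  · refine ⟨_, hm.mem_right, ?_⟩
    rw [← hm.erase_left]
    exact Finset.subset_erase.2 ⟨hs, h'⟩
  · refine ⟨_, hm.mem_left, ?_⟩
    rw [← hm.erase_right]
    exact Finset.subset_erase.2 ⟨hs, h'⟩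

theorem not_pair_subset_old {s : Finset W} (hs : {A, B} ⊆ s) : s ∉ T.simplices :=
  fun h => hm.edge_new ⟨Finset.card_pair hm.ne, s, h, hs⟩

theorem eq_pair_of_cell_eq {s : Finset W} (hs : s ⊆ insert A (insert B κ))
    (hc : cell Γ s = cell Γ {A, B}) : s = {A, B} := by
  obtain ⟨g, hg⟩ := cell_eq_iff.1 hc
  have h2 : s.card = 2 := by rw [← hg, Finset.card_smul_finset, Finset.card_pair hm.ne]
  by_contra h
  have h1 : ¬({A, B} : Finset W) ⊆ s := fun h1 =>
    h (Finset.eq_of_subset_of_card_le h1 (by rw [h2, Finset.card_pair hm.ne])).symm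
  obtain ⟨σ, hσ, hsσ⟩ := hm.old_of_not_subset hs h1
  refine hm.edge_new ?_
  rw [← T.cell_mem_cells, ← hc, T.cell_mem_cells]
  exact ⟨h2, σ, hσ, hsσ⟩

/-- The new edge lies in no other copy of the cluster, since the action is free; this makes the
cells of the cluster that contain it pairwise inequivalent. -/
theorem smul_eq_one {g : Γ} (h : g • ({A, B} : Finset W) ⊆ insert A (insert B κ)) : g = 1 := by
  obtain ⟨c, hc⟩ := hm.nonempty
  exact T'.free g _ (hm.new_mem hc) {A, B} (hm.pair_subset_erase hc) (Finset.insert_nonempty _ _)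
    (hm.eq_pair_of_cell_eq h (cell_smul _ _))

theorem eq_of_cell_eq {s t : Finset W} (hs : s ⊆ insert A (insert B κ))
    (hAB : {A, B} ⊆ t) (hst : cell Γ s = cell Γ t) : s = t := by
  obtain ⟨g, hg⟩ := cell_eq_iff.1 hst
  have : g = 1 := hm.smul_eq_one
    (((Finset.smul_finset_subset_smul_finset hAB).trans hg.subset).trans hs)
  rw [← hg, this, one_smul]

theorem not_cell_old {n : ℕ} {s : Finset W} (hs : {A, B} ⊆ s) : cell Γ s ∉ T.cells n := by
  rw [T.cell_mem_cells]
  rintro ⟨-, σ, hσ, h⟩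
  exact hm.not_pair_subset_old (hs.trans h) hσ

theorem coverCells_of_new {n : ℕ} {s : Finset W} (hs : s ∈ T'.coverCells n) :
    s ∈ T.coverCells n ∨ ∃ g : Γ, {A, B} ⊆ g • s ∧ g • s ⊆ insert A (insert B κ) := by
  obtain ⟨h1, σ, hσ, h2⟩ := hs
  rw [hm.simplices_eq] at hσ
  rcases hσ with hσ | ⟨c, hc, hσ⟩
  · exact Or.inl ⟨h1, σ, hσ.1, h2⟩
  · obtain ⟨g, hg⟩ := cell_eq_iff.1 hσ.symm
    have h3 : g • s ⊆ insert A (insert B κ) := by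
      refine (Finset.smul_finset_subset_smul_finset h2).trans ?_
      rw [hg, ← hm.erase_mem hc]
      exact Finset.erase_subset _ _
    by_cases h4 : ({A, B} : Finset W) ⊆ g • s
    · exact Or.inr ⟨g, h4, h3⟩
    · obtain ⟨τ, hτ, h5⟩ := hm.old_of_not_subset h3 h4
      refine Or.inl ?_
      rw [← T.cell_mem_cells, ← cell_smul g, T.cell_mem_cells]
      exact ⟨by rw [Finset.card_smul_finset, h1], τ, hτ, h5⟩

theorem new_of_subset {s : Finset W} (hs : s.card ≤ 3) (h : s ⊆ insert A (insert B κ)) :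
    s ∈ T'.coverCells s.card := by
  obtain ⟨c, hc, hcs⟩ : ∃ c ∈ κ, c ∉ s := by
    by_contra! h'
    have := Finset.card_le_card h'
    rw [hm.card_eq] at this
    omega
  exact ⟨rfl, _, hm.new_mem hc, Finset.subset_erase.2 ⟨h, hcs⟩⟩

theorem coverCells_subset {n : ℕ} (hn : n ≤ 3) : T.coverCells n ⊆ T'.coverCells n := by
  rintro s ⟨h1, σ, hσ, h2⟩
  by_cases h : cell Γ σ = cell Γ (insert A κ) ∨ cell Γ σ = cell Γ (insert B κ)
  · have h3 : ∃ g : Γ, g • σ ⊆ insert A (insert B κ) := by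
      rcases h with h | h
      · obtain ⟨g, hg⟩ := cell_eq_iff.1 h.symm
        exact ⟨g, by rw [hg, ← hm.erase_right]; exact Finset.erase_subset _ _⟩
      · obtain ⟨g, hg⟩ := cell_eq_iff.1 h.symm
        exact ⟨g, by rw [hg]; exact Finset.subset_insert _ _⟩
    obtain ⟨g, hg⟩ := h3
    rw [← T'.cell_mem_cells, ← cell_smul g, T'.cell_mem_cells]
    have := hm.new_of_subset (s := g • s) (by rw [Finset.card_smul_finset]; omega)
      ((Finset.smul_finset_subset_smul_finset h2).trans hg)
    rwa [Finset.card_smul_finset, h1] at this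
  · exact ⟨h1, σ, by rw [hm.simplices_eq]; exact Or.inl ⟨hσ, h⟩, h2⟩

theorem cells_subset {n : ℕ} (hn : n ≤ 3) : T.cells n ⊆ T'.cells n :=
  Set.image_mono (hm.coverCells_subset hn)

theorem cell_pair_mem : cell Γ {A, B} ∈ T'.cells 2 := by
  have := hm.new_of_subset (s := {A, B}) (by rw [Finset.card_pair hm.ne]; omega)
    (by intro p hp; simp only [Finset.mem_insert, Finset.mem_singleton] at hp ⊢; tauto)
  rw [Finset.card_pair hm.ne] at this
  exact T'.cell_mem_cells.2 this

theorem card_triple {c : W} (hc : c ∈ κ) : (insert c {A, B} : Finset W).card = 3 := by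
  rw [Finset.card_insert_of_notMem, Finset.card_pair hm.ne]
  simp [hm.ne_left hc, hm.ne_right hc]

theorem triple_subset {c : W} (hc : c ∈ κ) :
    (insert c {A, B} : Finset W) ⊆ insert A (insert B κ) := by
  intro p hp
  simp only [Finset.mem_insert, Finset.mem_singleton] at hp ⊢
  rcases hp with rfl | h | h <;> tauto

theorem cell_triple_mem {c : W} (hc : c ∈ κ) : cell Γ (insert c {A, B}) ∈ T'.cells 3 := by
  have := hm.new_of_subset (by rw [hm.card_triple hc]) (hm.triple_subset hc)
  rw [hm.card_triple hc] at this
  exact T'.cell_mem_cells.2 this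

/-- The edges after the move: the old ones, and the edge `AB`. -/
def edgeEquiv : T.Edge ⊕ Unit ≃ T'.Edge :=
  Equiv.ofBijective (Sum.elim (fun a => ⟨a.1, hm.cells_subset (by norm_num) a.2⟩)
    fun _ => ⟨cell Γ {A, B}, hm.cell_pair_mem⟩) (by
    constructor
    · rintro (a | a) (a' | a') h
      · simp only [Sum.elim_inl, Subtype.mk.injEq] at h
        rw [Subtype.ext h]
      · simp only [Sum.elim_inl, Sum.elim_inr, Subtype.mk.injEq] at h
        exact absurd (h ▸ a.2) (hm.not_cell_old subset_rfl)
      · simp only [Sum.elim_inl, Sum.elim_inr, Subtype.mk.injEq] at h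
        exact absurd (h ▸ a'.2) (hm.not_cell_old subset_rfl)
      · rfl
    · rintro ⟨_, s, hs, rfl⟩
      rcases hm.coverCells_of_new hs with h | ⟨g, h1, h2⟩
      · exact ⟨Sum.inl ⟨cell Γ s, T.cell_mem_cells.2 h⟩, rfl⟩
      · refine ⟨Sum.inr (), Subtype.ext ?_⟩
        have h3 : g • s = {A, B} := (Finset.eq_of_subset_of_card_le h1
          (by rw [Finset.card_smul_finset, hs.1, Finset.card_pair hm.ne])).symm
        simp only [Sum.elim_inr]
        rw [← h3, cell_smul])

/-- The two-dimensional faces after the move: the old ones, and the four triangles `ABc`. -/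
def faceEquiv : T.Face ⊕ κ ≃ T'.Face :=
  Equiv.ofBijective (Sum.elim (fun a => ⟨a.1, hm.cells_subset le_rfl a.2⟩)
    fun c => ⟨cell Γ (insert c.1 {A, B}), hm.cell_triple_mem c.2⟩) (by
    have hsub : ∀ c : W, ({A, B} : Finset W) ⊆ insert c {A, B} := fun c =>
      Finset.subset_insert _ _
    constructor
    · rintro (a | c) (a' | c') h
      · simp only [Sum.elim_inl, Subtype.mk.injEq] at h
        rw [Subtype.ext h]
      · simp only [Sum.elim_inl, Sum.elim_inr, Subtype.mk.injEq] at h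
        exact absurd (h ▸ a.2) (hm.not_cell_old (hsub _))
      · simp only [Sum.elim_inl, Sum.elim_inr, Subtype.mk.injEq] at h
        exact absurd (h ▸ a'.2) (hm.not_cell_old (hsub _))
      · simp only [Sum.elim_inr, Subtype.mk.injEq] at h
        have h1 := hm.eq_of_cell_eq (hm.triple_subset c.2) (hsub _) h
        have h2 : c.1 ∈ (insert c'.1 {A, B} : Finset W) := h1 ▸ Finset.mem_insert_self _ _
        simp only [Finset.mem_insert, Finset.mem_singleton, hm.ne_left c.2, hm.ne_right c.2,
          or_false] at h2
        rw [Subtype.ext h2]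
    · rintro ⟨_, s, hs, rfl⟩
      rcases hm.coverCells_of_new hs with h | ⟨g, h1, h2⟩
      · exact ⟨Sum.inl ⟨cell Γ s, T.cell_mem_cells.2 h⟩, rfl⟩
      · have h3 : (g • s).card = 3 := by rw [Finset.card_smul_finset, hs.1]
        have h4 : ((g • s) \ {A, B}).card = 1 := by
          rw [Finset.card_sdiff_of_subset h1, h3, Finset.card_pair hm.ne]
        obtain ⟨c, hc⟩ := Finset.card_eq_one.1 h4
        have hc' : c ∈ (g • s) \ {A, B} := by rw [hc]; exact Finset.mem_singleton_self c
        have hcκ : c ∈ κ := by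
          have h5 := h2 (Finset.mem_sdiff.1 hc').1
          have h6 := (Finset.mem_sdiff.1 hc').2
          simp only [Finset.mem_insert, Finset.mem_singleton] at h5 h6
          tauto
        refine ⟨Sum.inr ⟨c, hcκ⟩, Subtype.ext ?_⟩
        have h7 : g • s = insert c {A, B} := by
          rw [← Finset.sdiff_union_of_subset h1, hc]; rfl
        simp only [Sum.elim_inr]
        rw [← h7, cell_smul])

@[simp] theorem edgeEquiv_inl (a : T.Edge) : (hm.edgeEquiv (Sum.inl a)).1 = a.1 := rfl
@[simp] theorem edgeEquiv_inr (u : Unit) : (hm.edgeEquiv (Sum.inr u)).1 = cell Γ {A, B} := rfl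
@[simp] theorem faceEquiv_inl (a : T.Face) : (hm.faceEquiv (Sum.inl a)).1 = a.1 := rfl
@[simp] theorem faceEquiv_inr (c : κ) :
    (hm.faceEquiv (Sum.inr c)).1 = cell Γ (insert c.1 {A, B}) := rfl

theorem cell_new_injOn : Set.InjOn (fun c => cell Γ ((insert A (insert B κ)).erase c)) κ := by
  intro c hc c' hc' h
  have h1 := hm.eq_of_cell_eq (Finset.erase_subset _ _)
    (hm.pair_subset_erase hc') h
  by_contra hne
  have h2 : c ∈ (insert A (insert B κ)).erase c' :=
    Finset.mem_erase.2 ⟨hne, by simp [Finset.mem_coe.1 hc]⟩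
  rw [← h1] at h2
  exact Finset.notMem_erase _ _ h2

/-- Two orbits of 4-simplices are replaced with four; the products are multiplied out to avoid division. -/
theorem prod_cells_five {M : Type*} [CommMonoid M] (f : Cell Γ W → M) :
    (∏ q : T'.cells 5, f q.1) * (f (cell Γ (insert A κ)) * f (cell Γ (insert B κ))) =
      (∏ q : T.cells 5, f q.1) * ∏ c ∈ κ, f (cell Γ ((insert A (insert B κ)).erase c)) := by
  classical
  have hA : cell Γ (insert A κ) ∈ T.cells 5 :=
    T.cell_mem_cells.2 (by rw [T.coverCells_five]; exact hm.mem_left)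
  have hB : cell Γ (insert B κ) ∈ T.cells 5 :=
    T.cell_mem_cells.2 (by rw [T.coverCells_five]; exact hm.mem_right)
  have h1 : (T.cells 5).toFinset = ((T.cells 5).toFinset \
      {cell Γ (insert A κ), cell Γ (insert B κ)}) ∪
      {cell Γ (insert A κ), cell Γ (insert B κ)} := by
    refine (Finset.sdiff_union_of_subset ?_).symm
    intro q hq
    simp only [Finset.mem_insert, Finset.mem_singleton] at hq
    rw [Set.mem_toFinset]
    rcases hq with rfl | rfl <;> assumption
  have h2 : (T'.cells 5).toFinset = ((T.cells 5).toFinset \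
      {cell Γ (insert A κ), cell Γ (insert B κ)}) ∪
      κ.image fun c => cell Γ ((insert A (insert B κ)).erase c) := by
    ext q
    obtain ⟨s, rfl⟩ : ∃ s, q = cell Γ s := ⟨q.out, (cell_out q).symm⟩
    simp only [Set.mem_toFinset, Finset.mem_union, Finset.mem_sdiff, Finset.mem_insert,
      Finset.mem_singleton, Finset.mem_image, T.cell_mem_cells, T'.cell_mem_cells,
      T.coverCells_five, T'.coverCells_five, hm.simplices_eq, Set.mem_union, Set.mem_sdiff,
      Set.mem_ofPred_eq]
    refine or_congr Iff.rfl ⟨?_, ?_⟩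
    · rintro ⟨c, hc, h⟩
      exact ⟨c, hc, by rw [h, hm.erase_mem hc]⟩
    · rintro ⟨c, hc, h⟩
      exact ⟨c, hc, by rw [← h, hm.erase_mem hc]⟩
  rw [Finset.prod_set_coe, Finset.prod_set_coe, h1, h2, Finset.prod_union, Finset.prod_union,
    Finset.prod_image hm.cell_new_injOn, Finset.prod_pair hm.cell_ne]
  · exact mul_right_comm _ _ _
  · exact Finset.sdiff_disjoint
  · rw [Finset.disjoint_left]
    rintro q hq hq'
    obtain ⟨c, hc, rfl⟩ := Finset.mem_image.1 hq'
    exact hm.not_cell_old (hm.pair_subset_erase hc) (Set.mem_toFinset.1 (Finset.mem_sdiff.1 hq).1)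

theorem sum_cells_five (f : Cell Γ W → ℝ) :
    (∑ q : T'.cells 5, f q.1) + (f (cell Γ (insert A κ)) + f (cell Γ (insert B κ))) =
      (∑ q : T.cells 5, f q.1) + ∑ c ∈ κ, f (cell Γ ((insert A (insert B κ)).erase c)) :=
  hm.prod_cells_five (M := Multiplicative ℝ) fun q => Multiplicative.ofAdd (f q)

end IsMove24

/-! ### The deficit angles under the move -/

/-- A sum over sets of `n + 1` elements with a marked one is a sum over sets of `n` elements with a
marked element outside. -/
theorem sum_powersetCard_succ {W M : Type*} [DecidableEq W] [AddCommMonoid M] (K : Finset W) (n : ℕ)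
    (f : W → Finset W → M) :
    ∑ t ∈ K.powersetCard (n + 1), ∑ g ∈ t, f g (t.erase g) =
      ∑ e ∈ K.powersetCard n, ∑ g ∈ K \ e, f g e := by
  rw [Finset.sum_sigma', Finset.sum_sigma']
  refine Finset.sum_bij' (fun z _ => ⟨z.1.erase z.2, z.2⟩) (fun z _ => ⟨insert z.2 z.1, z.2⟩)
    ?_ ?_ ?_ ?_ ?_
  · rintro ⟨t, g⟩ h
    simp only [Finset.mem_sigma, Finset.mem_powersetCard, Finset.mem_sdiff] at h ⊢
    exact ⟨⟨(Finset.erase_subset _ _).trans h.1.1,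
      by rw [Finset.card_erase_of_mem h.2, h.1.2]; rfl⟩, h.1.1 h.2, Finset.notMem_erase _ _⟩
  · rintro ⟨e, g⟩ h
    simp only [Finset.mem_sigma, Finset.mem_powersetCard, Finset.mem_sdiff] at h ⊢
    exact ⟨⟨Finset.insert_subset h.2.1 h.1.1,
      by rw [Finset.card_insert_of_notMem h.2.2, h.1.2]⟩, Finset.mem_insert_self _ _⟩
  · rintro ⟨t, g⟩ h
    simp only [Finset.mem_sigma] at h
    simp only [Finset.insert_erase h.2]
  · rintro ⟨e, g⟩ h
    simp only [Finset.mem_sigma, Finset.mem_sdiff] at h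
    simp only [Finset.erase_insert h.2.2]
  · rintro ⟨t, g⟩ _
    rfl

theorem units_mul_sign {u u' : ℤˣ} {a b : ℝ} (ha : a ≠ 0) (hb : b ≠ 0)
    (h : u = u' ↔ a * b < 0) : ((u : ℤ) : ℝ) * (a / |a|) = -(((u' : ℤ) : ℝ) * (b / |b|)) := by
  rcases lt_or_gt_of_ne ha with ha' | ha' <;> rcases lt_or_gt_of_ne hb with hb' | hb' <;>
  rcases Int.units_eq_one_or u with rfl | rfl <;> rcases Int.units_eq_one_or u' with rfl | rfl <;>
  simp [abs_of_neg, abs_of_pos, ha', hb', ha, hb] at h ⊢ <;> nlinarith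

section Orbits

variable {Γ W : Type*} [Group Γ] [MulAction Γ W] [DecidableEq W]

/-- The coefficients with which the orbits of faces of a six-vertex cluster with affine dependency
`w` enter the change of the deficit angles under a move. -/
def faceWeight (X : Development Γ W) (K : Finset W) (w : W → ℝ) : Cell Γ W → ℝ :=
  orbitSum (fun K t => X.volume t / (24 * ∏ p ∈ K \ t, w p)) K

/-- The coefficients with which the orbits of edges of a six-vertex cluster with affine dependency
`w` enter the change of the deficit angles under a move. -/
def edgeWeight (K : Finset W) (w : W → ℝ) (a : Cell Γ W) : ℝ := quadForm K (edgeVelocity a) w w / 2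

open Classical in
theorem sum_angleDeriv {X : Development Γ W} {K : Finset W} {w : W → ℝ} (hw : IsWeight X.pos K w)
    (a : Cell Γ W) {t : Finset W} (htK : t ⊆ K) (ht : t.card = 3) :
    ∑ p ∈ K \ t, w p / |w p| * angleDeriv X a (K.erase p) t =
      X.volume t / (24 * ∏ p ∈ K \ t, w p) * edgeWeight K w a :=
  hw.sum_angles htK ht (edgeVelocity_comm a) (fun p _ q _ => hasDerivAt_pullLength X a p q _)
    (fun p _ q _ => by rw [Function.update_eq_self, pullLength_flatLength])

/-- The signed variation of all the angles of the boundary of the 5-simplex `K` at the faces of one orbit, when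
the length of one orbit of edges varies. -/
theorem sum_orbitSum_erase {X : Development Γ W} {K : Finset W} {w : W → ℝ}
    (hw : IsWeight X.pos K w) (a i : Cell Γ W) :
    ∑ p ∈ K, w p / |w p| * orbitSum (angleDeriv X a) (K.erase p) i =
      faceWeight X K w i * edgeWeight K w a := by
  classical
  have h1 : ∀ p ∈ K, w p / |w p| * orbitSum (angleDeriv X a) (K.erase p) i =
      ∑ t ∈ K.powersetCard 3, if cell Γ t = i ∧ p ∉ t then
        w p / |w p| * angleDeriv X a (K.erase p) t else 0 := by
    intro p _
    rw [orbitSum, Finset.mul_sum, ← Finset.sum_filter]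
    refine Finset.sum_congr ?_ fun _ _ => rfl
    ext t
    simp only [Finset.mem_filter, Finset.mem_powersetCard, Finset.subset_erase]
    tauto
  rw [Finset.sum_congr rfl h1, Finset.sum_comm, faceWeight, orbitSum, Finset.sum_mul,
    Finset.sum_filter]
  refine Finset.sum_congr rfl fun t ht => ?_
  rw [Finset.mem_powersetCard] at ht
  split_ifs with h
  · rw [← sum_angleDeriv hw a ht.1 ht.2, ← Finset.sum_filter, Finset.sdiff_eq_filter]
    refine Finset.sum_congr ?_ fun _ _ => rfl
    ext p
    simp [h]
  · refine Finset.sum_eq_zero fun p _ => if_neg fun h' => h h'.1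

namespace Triangulation

variable {X : Development Γ W} (T : Triangulation X)

theorem orbitSum_sign_out {σ : Finset W} (hσ : σ ∈ T.simplices) (a i : Cell Γ W) :
    orbitSum (fun σ t => ((T.sign σ : ℤ) : ℝ) * angleDeriv X a σ t) (cell Γ σ).out i =
      ((T.sign σ : ℤ) : ℝ) * orbitSum (angleDeriv X a) σ i := by
  obtain ⟨g, hg⟩ := cell_eq_iff.1 (cell_out (cell Γ σ))
  rw [← hg, orbitSum_smul g fun t => by rw [T.sign_smul g σ hσ, angleDeriv_smul], orbitSum,
    orbitSum, Finset.mul_sum]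

end Triangulation

namespace IsMove24

variable {X : Development Γ W}
  {T T' : Triangulation X} {A B : W} {κ : Finset W} (hm : IsMove24 T T' A B κ)

include hm

theorem exists_weight : ∃ w, IsWeight X.pos (insert A (insert B κ)) w := by
  refine exists_isWeight (by simp) hm.card_six fun p hp => ?_
  rw [Finset.mem_insert, Finset.mem_insert] at hp
  rcases hp with rfl | rfl | hp
  · rw [hm.erase_left]; exact T.nondegenerate _ hm.mem_right
  · rw [hm.erase_right]; exact T.nondegenerate _ hm.mem_left
  · exact T'.nondegenerate _ (hm.new_mem hp)

variable {w : W → ℝ} (hw : IsWeight X.pos (insert A (insert B κ)) w)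

include hw

theorem weight_left : w A ≠ 0 := hw.ne_zero A (by simp)

theorem weight_right : w B ≠ 0 := hw.ne_zero B (by simp)

theorem weight_mem {c : W} (hc : c ∈ κ) : w c ≠ 0 := hw.ne_zero c (by simp [hc])

/-- The signs of the six 4-simplices of the boundary of a 5-simplex, those before the move being
taken with the opposite sign, are proportional to the signs of the affine dependency. -/
theorem exists_sign : ∃ s : ℝ, s ^ 2 = 1 ∧
    (∀ c ∈ κ, ((T'.sign ((insert A (insert B κ)).erase c) : ℤ) : ℝ) = s * (w c / |w c|)) ∧
    ((T.sign (insert A κ) : ℤ) : ℝ) = -(s * (w B / |w B|)) ∧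
    ((T.sign (insert B κ) : ℤ) : ℝ) = -(s * (w A / |w A|)) := by
  have hsq : ∀ a : ℝ, a ≠ 0 → (a / |a|) ^ 2 = 1 := fun a ha => by
    rw [div_pow, sq_abs, div_self (pow_ne_zero 2 ha)]
  have hu : ∀ u : ℤˣ, (((u : ℤ) : ℝ)) ^ 2 = 1 := fun u => by
    rcases Int.units_eq_one_or u with rfl | rfl <;> simp
  have hA := hm.weight_left hw
  have hB := hm.weight_right hw
  have key : ∀ c ∈ κ, ((T'.sign ((insert A (insert B κ)).erase c) : ℤ) : ℝ) * (w c / |w c|) =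
      -(((T.sign (insert A κ) : ℤ) : ℝ) * (w B / |w B|)) := by
    intro c hc
    refine units_mul_sign (hm.weight_mem hw hc) hB ?_
    rw [hm.erase_mem hc, hm.sign_left c hc, mul_comm]
    refine hw.sSameSide_iff ?_ ?_ (hm.ne_right hc).symm ?_
    · simp [hm.ne.symm, hm.notMem_right]
    · simp [hm.ne_left hc]
    · rw [Finset.insert_comm c, Finset.insert_erase hc, Finset.insert_comm]
  have key' : ∀ c ∈ κ, ((T'.sign ((insert A (insert B κ)).erase c) : ℤ) : ℝ) * (w c / |w c|) =
      -(((T.sign (insert B κ) : ℤ) : ℝ) * (w A / |w A|)) := by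
    intro c hc
    refine units_mul_sign (hm.weight_mem hw hc) hA ?_
    rw [hm.erase_mem hc, hm.sign_right c hc, mul_comm]
    refine hw.sSameSide_iff ?_ ?_ (hm.ne_left hc).symm ?_
    · simp [hm.ne, hm.notMem_left]
    · simp [hm.ne_right hc]
    · rw [Finset.insert_comm c, Finset.insert_erase hc]
  obtain ⟨c₀, hc₀⟩ := hm.nonempty
  refine ⟨-(((T.sign (insert A κ) : ℤ) : ℝ) * (w B / |w B|)), ?_, ?_, ?_, ?_⟩
  · rw [neg_sq, mul_pow, hu, hsq _ hB, one_mul]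
  · intro c hc
    rw [← key c hc]
    linear_combination (-((T'.sign ((insert A (insert B κ)).erase c) : ℤ) : ℝ)) *
      hsq _ (hm.weight_mem hw hc)
  · linear_combination (-((T.sign (insert A κ) : ℤ) : ℝ)) * hsq _ hB
  · rw [← key c₀ hc₀, key' c₀ hc₀]
    linear_combination (-((T.sign (insert B κ) : ℤ) : ℝ)) * hsq _ hA

/-- The move changes the matrix of derivatives of the deficit angles by a matrix of rank one. -/
theorem exists_curvature_eq : ∃ s : ℝ, s ^ 2 = 1 ∧ ∀ i a, T'.curvature i a =
    T.curvature i a - s * faceWeight X (insert A (insert B κ)) w i *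
      edgeWeight (insert A (insert B κ)) w a := by
  classical
  obtain ⟨s, hs, h1, h2, h3⟩ := hm.exists_sign hw
  refine ⟨s, hs, fun i a => ?_⟩
  have key := hm.sum_cells_five fun q => if q ∈ T.cells 5 then
    orbitSum (fun σ t => ((T.sign σ : ℤ) : ℝ) * angleDeriv X a σ t) q.out i else
    orbitSum (fun σ t => ((T'.sign σ : ℤ) : ℝ) * angleDeriv X a σ t) q.out i
  have e1 : (∑ q : T'.cells 5, if q.1 ∈ T.cells 5 then
      orbitSum (fun σ t => ((T.sign σ : ℤ) : ℝ) * angleDeriv X a σ t) q.1.out i else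
      orbitSum (fun σ t => ((T'.sign σ : ℤ) : ℝ) * angleDeriv X a σ t) q.1.out i) =
      -T'.curvature i a := by
    rw [Triangulation.curvature, neg_neg]
    refine Finset.sum_congr rfl fun q _ => ?_
    split_ifs with h
    · refine orbitSum_congr (fun t => ?_) i
      rw [hm.sign_old _ (T.out_mem_simplices h) (T'.out_mem_simplices q.2)]
    · rfl
  have e2 : (∑ q : T.cells 5, if q.1 ∈ T.cells 5 then
      orbitSum (fun σ t => ((T.sign σ : ℤ) : ℝ) * angleDeriv X a σ t) q.1.out i else
      orbitSum (fun σ t => ((T'.sign σ : ℤ) : ℝ) * angleDeriv X a σ t) q.1.out i) =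
      -T.curvature i a := by
    rw [Triangulation.curvature, neg_neg]
    exact Finset.sum_congr rfl fun q _ => if_pos q.2
  have mA : cell Γ (insert A κ) ∈ T.cells 5 :=
    T.cell_mem_cells.2 (by rw [T.coverCells_five]; exact hm.mem_left)
  have mB : cell Γ (insert B κ) ∈ T.cells 5 :=
    T.cell_mem_cells.2 (by rw [T.coverCells_five]; exact hm.mem_right)
  have e3 : ∀ c ∈ κ, (if cell Γ ((insert A (insert B κ)).erase c) ∈ T.cells 5 then
      orbitSum (fun σ t => ((T.sign σ : ℤ) : ℝ) * angleDeriv X a σ t)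
        (cell Γ ((insert A (insert B κ)).erase c)).out i else
      orbitSum (fun σ t => ((T'.sign σ : ℤ) : ℝ) * angleDeriv X a σ t)
        (cell Γ ((insert A (insert B κ)).erase c)).out i) =
      s * (w c / |w c| * orbitSum (angleDeriv X a) ((insert A (insert B κ)).erase c) i) := by
    intro c hc
    rw [if_neg (hm.not_cell_old (hm.pair_subset_erase hc)),
      T'.orbitSum_sign_out (hm.new_mem hc), h1 c hc, mul_assoc]
  rw [e1, e2, if_pos mA, if_pos mB, T.orbitSum_sign_out hm.mem_left,
    T.orbitSum_sign_out hm.mem_right, h2, h3, Finset.sum_congr rfl e3, ← Finset.mul_sum] at key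
  have e4 := sum_orbitSum_erase hw a i
  rw [Finset.sum_insert hm.notMem_insert, Finset.sum_insert hm.notMem_right, hm.erase_left,
    hm.erase_right] at e4
  linear_combination -key - s * e4

omit hw in
theorem edgeVelocity_pair {p q : W} (hp : p ∈ insert A (insert B κ))
    (hq : q ∈ insert A (insert B κ)) : edgeVelocity (cell Γ {A, B}) p q =
      (if p = A then if q = B then 1 else 0 else 0) +
        if p = B then if q = A then 1 else 0 else 0 := by
  have h : (p ≠ q ∧ cell Γ {p, q} = cell Γ {A, B}) ↔ (p = A ∧ q = B) ∨ (p = B ∧ q = A) := by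
    constructor
    · rintro ⟨hpq, h⟩
      have h1 := hm.eq_pair_of_cell_eq
        (Finset.insert_subset hp (Finset.singleton_subset_iff.2 hq)) h
      have h2 : p ∈ ({A, B} : Finset W) := h1 ▸ Finset.mem_insert_self _ _
      have h3 : q ∈ ({A, B} : Finset W) := h1 ▸ Finset.mem_insert_of_mem (Finset.mem_singleton_self _)
      simp only [Finset.mem_insert, Finset.mem_singleton] at h2 h3
      rcases h2 with rfl | rfl <;> rcases h3 with rfl | rfl <;> simp at hpq ⊢
    · rintro (⟨rfl, rfl⟩ | ⟨rfl, rfl⟩)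
      · exact ⟨hm.ne, rfl⟩
      · exact ⟨hm.ne.symm, by rw [Finset.pair_comm]⟩
  rw [edgeVelocity]
  have := hm.ne
  by_cases h1 : p = A
  · subst h1
    by_cases h2 : q = B
    · subst h2
      rw [if_pos (h.2 (Or.inl ⟨rfl, rfl⟩))]; simp [this]
    · rw [if_neg (fun h' => by rcases h.1 h' with h' | h' <;> tauto)]; simp [h2, this]
  · by_cases h2 : p = B ∧ q = A
    · rw [if_pos (h.2 (Or.inr h2))]; simp [h2, this.symm]
    · rw [if_neg (fun h' => by rcases h.1 h' with h' | h' <;> tauto)]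
      simp only [h1, if_false, zero_add]
      split_ifs <;> tauto

theorem edgeWeight_pair :
    edgeWeight (insert A (insert B κ)) w (cell Γ {A, B}) = w A * w B := by
  have hA : A ∈ insert A (insert B κ) := by simp
  have hB : B ∈ insert A (insert B κ) := by simp
  have h : quadForm (insert A (insert B κ)) (edgeVelocity (cell Γ {A, B})) w w =
      ∑ p ∈ insert A (insert B κ), ∑ q ∈ insert A (insert B κ),
        ((if p = A then if q = B then w p * w q else 0 else 0) +
          if p = B then if q = A then w p * w q else 0 else 0) := by
    refine Finset.sum_congr rfl fun p hp => Finset.sum_congr rfl fun q hq => ?_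
    rw [hm.edgeVelocity_pair hp hq]
    split_ifs <;> ring
  rw [edgeWeight, h]
  simp only [Finset.sum_add_distrib]
  have h1 : ∀ a b : W, a ∈ insert A (insert B κ) → b ∈ insert A (insert B κ) →
      ∑ p ∈ insert A (insert B κ), ∑ q ∈ insert A (insert B κ),
        (if p = a then if q = b then w p * w q else 0 else 0) = w a * w b := by
    intro a b ha hb
    rw [Finset.sum_eq_single_of_mem a ha, Finset.sum_eq_single_of_mem b hb]
    · simp
    · intro q _ hq; simp [hq]
    · intro p _ hp; simp [hp]
  rw [h1 A B hA hB, h1 B A hB hA]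
  ring

omit hw in
theorem faceWeight_triple {c : W} (hc : c ∈ κ) :
    faceWeight X (insert A (insert B κ)) w (cell Γ (insert c {A, B})) =
      X.volume (insert c {A, B}) / (24 * ∏ p ∈ κ.erase c, w p) := by
  classical
  have h1 : ((insert A (insert B κ)).powersetCard 3).filter
      (fun t => cell Γ t = cell Γ (insert c {A, B})) = {insert c {A, B}} := by
    ext t
    rw [Finset.mem_filter, Finset.mem_powersetCard, Finset.mem_singleton]
    constructor
    · rintro ⟨h, h'⟩
      exact hm.eq_of_cell_eq h.1 (Finset.subset_insert _ _) h'
    · rintro rfl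
      exact ⟨⟨hm.triple_subset hc, hm.card_triple hc⟩, rfl⟩
  have h2 : insert A (insert B κ) \ insert c {A, B} = κ.erase c := by
    ext p
    simp only [Finset.mem_sdiff, Finset.mem_insert, Finset.mem_singleton, Finset.mem_erase]
    constructor
    · tauto
    · rintro ⟨h, h'⟩
      have := hm.ne_left h'
      have := hm.ne_right h'
      tauto
  rw [faceWeight, orbitSum]
  trans ∑ t ∈ ((insert A (insert B κ)).powersetCard 3).filter
      (fun t => cell Γ t = cell Γ (insert c {A, B})),
      X.volume t / (24 * ∏ p ∈ insert A (insert B κ) \ t, w p)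
  · congr
  · rw [h1, Finset.sum_singleton, h2]

end IsMove24

/-! ### Edge deviations and areas -/

namespace Triangulation

variable {X : Development Γ W} (T : Triangulation X)

theorem volume_pos_three {t : Finset W} (ht : t ∈ T.coverCells 3) : 0 < X.volume t :=
  vol_triangle_pos ht.1 (T.affineIndependent_of_mem ht)

theorem volume_pos_five {σ : Finset W} (hσ : σ ∈ T.simplices) : 0 < X.volume σ :=
  vol_four_simplex_pos (T.card_eq σ hσ) (T.nondegenerate σ hσ)

theorem erase_mem_coverCells {t : Finset W} (ht : t ∈ T.coverCells 3) {g : W} (hg : g ∈ t) :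
    t.erase g ∈ T.coverCells 2 := by
  obtain ⟨h, σ, hσ, hσ'⟩ := ht
  exact ⟨by rw [Finset.card_erase_of_mem hg, h], σ, hσ, (Finset.erase_subset _ _).trans hσ'⟩

theorem volume_mul_areaDiff {t : Finset W} (ht : t ∈ T.coverCells 3) {v : EdgeField W}
    (hv : v ∈ T.deviations) : X.volume t * X.areaDiff t v =
      -(∑ g ∈ t, X.sqLength (t.erase g) *
        inner ℝ (X.pos g - X.midpoint (t.erase g)) (v (t.erase g))) / 2 :=
  Pachner.volume_mul_areaDiff X ht.1 (T.affineIndependent_of_mem ht) v fun _ hg _ hp _ hq =>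
    hv.2.1 _ (T.erase_mem_coverCells ht hg) _ hp _ hq

theorem areaDiff_smul {t : Finset W} (ht : t ∈ T.coverCells 3) {v : EdgeField W}
    (hv : v ∈ T.deviations) (g : Γ) : X.areaDiff (g • t) v = X.areaDiff t v := by
  have h1 := T.volume_mul_areaDiff ht hv
  have h2 := T.volume_mul_areaDiff (T.smul_mem_coverCells ht g) hv
  have h3 : ∀ f : W → ℝ, ∑ p ∈ g • t, f p = ∑ p ∈ t, f (g • p) := fun f =>
    Finset.sum_image fun p _ q _ hpq => MulAction.injective g hpq
  have h4 : ∀ p, (g • t).erase (g • p) = g • t.erase p := fun p => by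
    rw [Finset.smul_finset_def, Finset.smul_finset_def,
      Finset.image_erase (MulAction.injective g)]
  rw [h3, X.volume_smul] at h2
  have h5 : ∀ p ∈ t, X.sqLength ((g • t).erase (g • p)) *
      inner ℝ (X.pos (g • p) - X.midpoint ((g • t).erase (g • p))) (v ((g • t).erase (g • p))) =
      X.sqLength (t.erase p) * inner ℝ (X.pos p - X.midpoint (t.erase p)) (v (t.erase p)) := by
    intro p hp
    have he := T.erase_mem_coverCells ht hp
    rw [h4, X.sqLength_smul, X.pos_sub_midpoint_smul g he.1, hv.2.2 g _ he,
      LinearIsometryEquiv.inner_map_map]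
  rw [Finset.sum_congr rfl h5, ← h1] at h2
  exact mul_left_cancel₀ (T.volume_pos_three ht).ne' h2

theorem areaDiff_out {t : Finset W} (ht : t ∈ T.coverCells 3) {v : EdgeField W}
    (hv : v ∈ T.deviations) : X.areaDiff (cell Γ t).out v = X.areaDiff t v := by
  obtain ⟨g, hg⟩ := cell_eq_iff.1 (cell_out (cell Γ t))
  rw [← hg, T.areaDiff_smul ht hv]

end Triangulation

/-- The linear relation between the variations of areas of the faces of a 5-simplex under edge deviations.
Collecting the terms with `v e`, one gets `∑ w_g (x_g - m_e)`, paired with `v e`, over the vertices `g ∉ e`,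
where `m_e` is the midpoint; the vertices `g ∈ e` may be added since `v e` is orthogonal to `e`,
and then the sum vanishes as `w` is an affine dependency. -/
theorem sum_areaDiff_eq_zero {X : Development Γ W} {K : Finset W} {w : W → ℝ}
    (hw : IsWeight X.pos K w) {v : EdgeField W}
    (hv : ∀ e ∈ K.powersetCard 2, ∀ p ∈ e, ∀ q ∈ e, inner ℝ (v e) (X.pos p - X.pos q) = 0) :
    ∑ t ∈ K.powersetCard 3, X.volume t / (24 * ∏ p ∈ K \ t, w p) * X.areaDiff t v = 0 := by
  have hW : ∏ p ∈ K, w p ≠ 0 := Finset.prod_ne_zero_iff.2 hw.ne_zero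
  have h1 : ∀ t ∈ K.powersetCard 3, X.volume t / (24 * ∏ p ∈ K \ t, w p) * X.areaDiff t v =
      -1 / (48 * ∏ p ∈ K, w p) * ∑ g ∈ t, w g * ((∏ p ∈ t.erase g, w p) * (X.sqLength (t.erase g) *
        inner ℝ (X.pos g - X.midpoint (t.erase g)) (v (t.erase g)))) := by
    intro t ht
    rw [Finset.mem_powersetCard] at ht
    have hind : AffineIndependent ℝ fun p : t => X.pos p := by
      obtain ⟨p, hp⟩ : (K \ t).Nonempty := Finset.card_pos.1 (by
        rw [Finset.card_sdiff_of_subset ht.1, hw.card_eq, ht.2]; norm_num)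
      rw [Finset.mem_sdiff] at hp
      exact affineIndependent_subset (hw.indep p hp.1) (Finset.subset_erase.2 ⟨ht.1, hp.2⟩)
    have h2 := volume_mul_areaDiff X ht.2 hind v fun g hg => hv _ (by
      rw [Finset.mem_powersetCard, Finset.card_erase_of_mem hg, ht.2]
      exact ⟨(Finset.erase_subset _ _).trans ht.1, rfl⟩)
    have h3 : (∏ p ∈ K \ t, w p) * ∏ p ∈ t, w p = ∏ p ∈ K, w p := Finset.prod_sdiff ht.1
    have h4 : ∀ g ∈ t, w g * ((∏ p ∈ t.erase g, w p) * (X.sqLength (t.erase g) *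
        inner ℝ (X.pos g - X.midpoint (t.erase g)) (v (t.erase g)))) =
        (∏ p ∈ t, w p) * (X.sqLength (t.erase g) *
        inner ℝ (X.pos g - X.midpoint (t.erase g)) (v (t.erase g))) := by
      intro g hg
      rw [← mul_assoc, Finset.mul_prod_erase t w hg]
    rw [Finset.sum_congr rfl h4, ← Finset.mul_sum, div_mul_eq_mul_div, h2, ← h3]
    rw [← h3] at hW
    have ha := left_ne_zero_of_mul hW
    have hb := right_ne_zero_of_mul hW
    field_simp
    ring
  rw [Finset.sum_congr rfl h1, ← Finset.mul_sum,
    sum_powersetCard_succ K 2 fun g e => w g * ((∏ p ∈ e, w p) * (X.sqLength e *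
        inner ℝ (X.pos g - X.midpoint e) (v e)))]
  refine mul_eq_zero_of_right _ (Finset.sum_eq_zero fun e he => ?_)
  have he' := Finset.mem_powersetCard.1 he
  have h2 : ∀ g ∈ e, inner ℝ (X.pos g - X.midpoint e) (v e) = 0 := by
    obtain ⟨p, q, hpq, rfl⟩ := Finset.card_eq_two.1 he'.2
    have h3 := hv _ he p (by simp) q (by simp)
    rw [X.midpoint_pair hpq]
    intro g hg
    rw [Finset.mem_insert, Finset.mem_singleton] at hg
    rcases hg with rfl | rfl
    · rw [show X.pos g - (2 : ℝ)⁻¹ • (X.pos g + X.pos q) =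
        (2 : ℝ)⁻¹ • (X.pos g - X.pos q) by module, real_inner_smul_left, real_inner_comm, h3,
        mul_zero]
    · rw [show X.pos g - (2 : ℝ)⁻¹ • (X.pos p + X.pos g) =
        (-(2 : ℝ)⁻¹) • (X.pos p - X.pos g) by module, real_inner_smul_left, real_inner_comm, h3,
        mul_zero]
  have h5 : ∑ g ∈ K, w g * inner ℝ (X.pos g - X.midpoint e) (v e) = 0 := by
    simp only [← real_inner_smul_left, ← sum_inner, smul_sub, Finset.sum_sub_distrib, hw.smul_eq,
      ← Finset.sum_smul, hw.sum_eq, zero_smul, sub_zero, inner_zero_left]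
  have h6 : ∑ g ∈ K \ e, w g * inner ℝ (X.pos g - X.midpoint e) (v e) = 0 := by
    rw [← h5, ← Finset.sum_sdiff he'.1, left_eq_add]
    exact Finset.sum_eq_zero fun g hg => by rw [h2 g hg, mul_zero]
  calc _ = ∑ g ∈ K \ e, (∏ p ∈ e, w p) * X.sqLength e *
        (w g * inner ℝ (X.pos g - X.midpoint e) (v e)) :=
        Finset.sum_congr rfl fun g _ => by ring
    _ = 0 := by rw [← Finset.mul_sum, h6, mul_zero]

end Orbits

/-! ### Deviations of the new edge -/

/-- Three orthonormal vectors orthogonal to a nonzero vector `u` of `ℝ⁴` form an orthonormal basis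
of its orthogonal complement. -/
theorem inner_eq_sum_of_orthogonal {b : Fin 3 → E4} (hb : Orthonormal ℝ b) {u : E4} (hu : u ≠ 0)
    (hbu : ∀ k, inner ℝ (b k) u = 0) (x : E4) {y : E4} (hy : inner ℝ y u = 0) :
    inner ℝ x y = ∑ k, inner ℝ x (b k) * inner ℝ (b k) y := by
  have hn : ‖u‖ ≠ 0 := norm_ne_zero_iff.2 hu
  let c : Fin 4 → E4 := Fin.cons (‖u‖⁻¹ • u) b
  have hc : Orthonormal ℝ c := by
    rw [orthonormal_iff_ite] at hb ⊢
    intro i j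
    refine Fin.cases ?_ (fun i => ?_) i <;> refine Fin.cases ?_ (fun j => ?_) j
    · simp only [c, Fin.cons_zero, if_true]
      rw [real_inner_smul_left, real_inner_smul_right, real_inner_self_eq_norm_sq]
      field_simp
    · simp only [c, Fin.cons_zero, Fin.cons_succ, (Fin.succ_ne_zero j).symm, if_false]
      rw [real_inner_comm, real_inner_smul_right, hbu, mul_zero]
    · simp only [c, Fin.cons_zero, Fin.cons_succ, real_inner_smul_right, hbu,
        mul_zero, Fin.succ_ne_zero i, if_false]
    · simp only [c, Fin.cons_succ, hb, Fin.succ_inj]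
  let B := (basisOfOrthonormalOfCardEqFinrank hc (by simp)).toOrthonormalBasis
    (by rw [coe_basisOfOrthonormalOfCardEqFinrank]; exact hc)
  have hB : ∀ i, B i = c i := fun i => by
    simp [B]
  rw [← B.sum_inner_mul_inner x y, Fin.sum_univ_succ]
  simp only [hB, c, Fin.cons_zero, Fin.cons_succ]
  rw [real_inner_smul_left u y, real_inner_comm y u, hy, mul_zero, mul_zero, zero_add]

/-- The volume of a 4-simplex in terms of an edge `AB` and of the projections of the other three
vertices to the orthogonal complement of the edge. -/
theorem abs_det_inner_mul_norm {W : Type*} [DecidableEq W] {x : W → E4} {A B : W} (hAB : x B ≠ x A)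
    {P : Finset W} (hA : A ∉ P) (hB : B ∉ P) (c : Fin 3 ≃ P) {b : Fin 3 → E4}
    (hb : Orthonormal ℝ b) (hbAB : ∀ k, inner ℝ (b k) (x B - x A) = 0) :
    |(Matrix.of fun k l => inner ℝ (x (c k) - (2 : ℝ)⁻¹ • (x A + x B)) (b l)).det| *
      ‖x A - x B‖ = 24 * vol x ({A, B} ∪ P) := by
  have hne : A ≠ B := by rintro rfl; exact hAB rfl
  have hPc : P.card = 3 := by rw [← Fintype.card_coe, ← Fintype.card_congr c, Fintype.card_fin]
  have hdisj : Disjoint {A, B} P := by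
    rw [Finset.disjoint_left]
    intro p hp
    rw [Finset.mem_insert, Finset.mem_singleton] at hp
    rcases hp with rfl | rfl <;> assumption
  have hcard : ({A, B} ∪ P : Finset W).card = 5 := by
    rw [Finset.card_union_of_disjoint hdisj, Finset.card_pair hne, hPc]
  have hex : ∀ q ∈ P, ∃ th : (W → ℝ) × E4, IsHeight x {A, B} q th.1 th.2 := fun q hq => by
    obtain ⟨t, h, H⟩ := exists_isHeight x (F := {A, B}) (by simp)
      (fun h => Finset.disjoint_left.1 hdisj h hq)
    exact ⟨(t, h), H⟩
  choose! th H using hex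
  let N : Matrix (Fin 3) (Fin 3) ℝ :=
    Matrix.of fun k l => inner ℝ (x (c k) - (2 : ℝ)⁻¹ • (x A + x B)) (b l)
  have hN : ∀ k l, N k l = inner ℝ (th (c k)).2 (b l) := by
    intro k l
    have hq : (c k : W) ∉ ({A, B} : Finset W) := fun h =>
      Finset.disjoint_left.1 hdisj h (c k).2
    have h1 : inner ℝ (x B - x A) (b l) = 0 := by rw [real_inner_comm]; exact hbAB l
    rw [(H _ (c k).2).inner_eq hq (f := A) (by simp)]
    · rw [show x (c k) - x A = (x (c k) - (2 : ℝ)⁻¹ • (x A + x B)) + (2 : ℝ)⁻¹ • (x B - x A) by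
        module, inner_add_left, real_inner_smul_left, h1, mul_zero, add_zero]
      rfl
    · intro p hp q hq
      simp only [Finset.mem_insert, Finset.mem_singleton] at hp hq
      have h2 : inner ℝ (x A - x B) (b l) = 0 := by rw [← neg_sub, inner_neg_left, h1, neg_zero]
      rcases hp with rfl | rfl <;> rcases hq with rfl | rfl <;> simp [h1, h2]
  have hG : (Matrix.of fun k k' : P => -2 * inner ℝ (th k).2 (th k').2).det =
      -8 * N.det ^ 2 := by
    rw [← Matrix.det_submatrix_equiv_self c]
    have : (Matrix.of fun k k' : P => -2 * inner ℝ (th k).2 (th k').2).submatrix c c =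
        (-2 : ℝ) • (N * N.transpose) := by
      ext k l
      rw [Matrix.submatrix_apply, Matrix.of_apply, Matrix.smul_apply, Matrix.mul_apply,
        inner_eq_sum_of_orthogonal hb (sub_ne_zero.2 hAB) hbAB]
      · simp only [Matrix.transpose_apply, hN, real_inner_comm, smul_eq_mul]
      · rw [real_inner_comm]
        exact (H _ (c l).2).orth _ (by simp) _ (by simp)
    rw [this, Matrix.det_smul, Matrix.det_mul, Matrix.det_transpose, Fintype.card_fin]
    ring
  rw [vol_eq hcard, cmDet_union x (by simp) hdisj H, hG, cmDet_pair x hne]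
  have : (-1 : ℝ) ^ 5 * (2 * ‖x A - x B‖ ^ 2 * (-8 * N.det ^ 2)) / 2 ^ (5 - 1) =
      (|N.det| * ‖x A - x B‖) ^ 2 := by
    rw [mul_pow, sq_abs]; norm_num; ring
  rw [this, Real.sqrt_sq (by positivity)]
  norm_num [Nat.factorial, N]
  ring

section Orbits

variable {Γ W : Type*} [Group Γ] [MulAction Γ W] [DecidableEq W]

namespace IsMove24

variable {X : Development Γ W}
  {T T' : Triangulation X} {A B : W} {κ : Finset W} (hm : IsMove24 T T' A B κ)

include hm

theorem pair_mem_coverCells : {A, B} ∈ T'.coverCells 2 := T'.cell_mem_cells.1 hm.cell_pair_mem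

theorem triple_mem_coverCells {c : W} (hc : c ∈ κ) : insert c {A, B} ∈ T'.coverCells 3 :=
  T'.cell_mem_cells.1 (hm.cell_triple_mem hc)

theorem pos_ne : X.pos B ≠ X.pos A := fun h => by
  have h1 := (T'.affineIndependent_of_mem hm.pair_mem_coverCells).injective
    (a₁ := ⟨B, by simp⟩) (a₂ := ⟨A, by simp⟩) h
  exact hm.ne (congrArg Subtype.val h1).symm

theorem deviations_le : T.deviations ≤ T'.deviations := by
  rintro v ⟨h1, h2, h3⟩
  refine ⟨fun e he => h1 e fun he' => he (hm.coverCells_subset (by norm_num) he'),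
    fun e _ p hp q hq => ?_, fun g e _ => ?_⟩
  · by_cases he : e ∈ T.coverCells 2
    · exact h2 e he p hp q hq
    · rw [h1 e he, inner_zero_left]
  · by_cases he : e ∈ T.coverCells 2
    · exact h3 g e he
    · rw [h1 e he, map_zero, h1]
      rwa [← T.cell_mem_cells, cell_smul, T.cell_mem_cells]

theorem deviation_old_pair {v : EdgeField W} (hv : v ∈ T.deviations) : v {A, B} = 0 :=
  hv.1 _ hm.edge_new

theorem deviationsAt_old {n : EdgeField W} (hn : n ∈ T'.deviationsAt {A, B}) {e : Finset W}
    (he : e ∈ T.coverCells 2) : n e = 0 :=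
  hn.2 e fun h => hm.edge_new (by rwa [← T.cell_mem_cells, ← h, T.cell_mem_cells])

theorem dS_deviationsAt {n : EdgeField W} (hn : n ∈ T'.deviationsAt {A, B}) : T.dS n = 0 := by
  funext i
  have hi := T.out_mem_coverCells i.2
  have h1 := T'.volume_mul_areaDiff (hm.coverCells_subset le_rfl hi) hn.1
  rw [Finset.sum_eq_zero, neg_zero, zero_div] at h1
  · exact (mul_eq_zero.1 h1).resolve_left (T.volume_pos_three hi).ne'
  · intro g hg
    rw [hm.deviationsAt_old hn (T.erase_mem_coverCells hi hg), inner_zero_right, mul_zero]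

theorem dS_inl (v : EdgeField W) (i : T.Face) : T'.dS v (hm.faceEquiv (Sum.inl i)) = T.dS v i := rfl

/-- The area of a new triangle `ABc` depends on the deviation of `AB` through its component towards
the vertex `c`. -/
theorem dS_inr {n : EdgeField W} (hn : n ∈ T'.deviationsAt {A, B}) (c : κ) :
    T'.dS n (hm.faceEquiv (Sum.inr c)) = -(X.sqLength {A, B} / (2 * X.volume (insert c.1 {A, B}))) *
      inner ℝ (X.pos c.1 - (2 : ℝ)⁻¹ • (X.pos A + X.pos B)) (n {A, B}) := by
  have ht := hm.triple_mem_coverCells c.2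
  have h1 := T'.volume_mul_areaDiff ht hn.1
  have h2 : (insert c.1 {A, B} : Finset W).erase c.1 = {A, B} :=
    Finset.erase_insert (by simp [hm.ne_left c.2, hm.ne_right c.2])
  rw [Finset.sum_eq_single_of_mem c.1 (Finset.mem_insert_self _ _), h2,
    X.midpoint_pair hm.ne] at h1
  · have h3 : T'.dS n (hm.faceEquiv (Sum.inr c)) = X.areaDiff (insert c.1 {A, B}) n :=
      T'.areaDiff_out ht hn.1
    have h4 := (T'.volume_pos_three ht).ne'
    rw [h3]
    generalize inner ℝ (X.pos c.1 - (2 : ℝ)⁻¹ • (X.pos A + X.pos B)) (n {A, B}) = z at *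
    field_simp
    linear_combination 2 * h1
  · intro g hg hgc
    rw [hm.deviationsAt_old hn, inner_zero_right, mul_zero]
    refine ⟨(T'.erase_mem_coverCells ht hg).1, hm.old_of_not_subset
      ((Finset.erase_subset _ _).trans (hm.triple_subset c.2)) fun h => ?_⟩
    rw [Finset.mem_insert, Finset.mem_insert, Finset.mem_singleton] at hg
    refine Finset.notMem_erase g _ (h ?_)
    rw [Finset.mem_insert, Finset.mem_singleton]
    tauto

theorem sum_faceWeight_dS {w : W → ℝ} (hw : IsWeight X.pos (insert A (insert B κ)) w)
    {v : EdgeField W} (hv : v ∈ T'.deviations) :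
    ∑ i : T'.Face, faceWeight X (insert A (insert B κ)) w i.1 * T'.dS v i = 0 := by
  classical
  have hmem : ∀ t ∈ (insert A (insert B κ)).powersetCard 3, t ∈ T'.coverCells 3 := by
    intro t ht
    rw [Finset.mem_powersetCard] at ht
    have := hm.new_of_subset ht.2.le ht.1
    rwa [ht.2] at this
  have h0 : ∑ i : T'.Face, faceWeight X (insert A (insert B κ)) w i.1 * T'.dS v i =
      ∑ i ∈ (T'.cells 3).toFinset,
        faceWeight X (insert A (insert B κ)) w i * X.areaDiff i.out v :=
    Finset.sum_set_coe (T'.cells 3) (f := fun i =>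
      faceWeight X (insert A (insert B κ)) w i * X.areaDiff i.out v)
  rw [h0, ← sum_areaDiff_eq_zero hw (v := v)]
  · rw [← Finset.sum_fiberwise_of_maps_to (g := cell Γ) (t := (T'.cells 3).toFinset)]
    · refine Finset.sum_congr rfl fun i _ => ?_
      rw [faceWeight, orbitSum, Finset.sum_mul]
      refine Finset.sum_congr (by congr) fun t ht => ?_
      rw [Finset.mem_filter] at ht
      rw [← ht.2, T'.areaDiff_out (hmem t ht.1) hv]
    · intro t ht
      rw [Set.mem_toFinset]
      exact T'.cell_mem_cells.2 (hmem t ht)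
  · intro e he p hp q hq
    rw [Finset.mem_powersetCard] at he
    have := hm.new_of_subset (s := e) (by omega) he.1
    rw [he.2] at this
    exact hv.2.1 e this p hp q hq

theorem deviationsAt_inner {n : EdgeField W} (hn : n ∈ T'.deviationsAt {A, B}) :
    inner ℝ (n {A, B}) (X.pos B - X.pos A) = 0 :=
  hn.1.2.1 _ hm.pair_mem_coverCells _ (by simp) _ (by simp)

theorem deviationsAt_eq_zero {n : EdgeField W} (hn : n ∈ T'.deviationsAt {A, B})
    (h : n {A, B} = 0) : n = 0 := by
  funext e
  by_cases he : cell Γ e = cell Γ {A, B}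
  · obtain ⟨g, rfl⟩ := cell_eq_iff.1 he
    rw [hn.1.2.2 g _ hm.pair_mem_coverCells, h, map_zero]
    rfl
  · exact hn.2 e he

/-- Every vector orthogonal to `AB` extends to an equivariant deviation of the orbit of `AB`, since no
nontrivial element of the group preserves this edge. -/
theorem exists_deviationsAt {z : E4} (hz : inner ℝ z (X.pos B - X.pos A) = 0) :
    ∃ n ∈ T'.deviationsAt {A, B}, n {A, B} = z := by
  classical
  have hfree : ∀ g : Γ, g • ({A, B} : Finset W) = {A, B} → g = 1 := fun g hg =>
    hm.smul_eq_one (by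
      rw [hg]; intro p hp; simp only [Finset.mem_insert, Finset.mem_singleton] at hp ⊢; tauto)
  have huniq : ∀ g g' : Γ, g • ({A, B} : Finset W) = g' • ({A, B} : Finset W) → g = g' := by
    intro g g' h
    have : g'⁻¹ * g = 1 := hfree _ (by rw [mul_smul, h, inv_smul_smul])
    rwa [inv_mul_eq_one, eq_comm] at this
  let n : EdgeField W := fun e =>
    if h : ∃ g : Γ, g • ({A, B} : Finset W) = e then (X.hol h.choose).linearIsometryEquiv z else 0
  have hn : ∀ g : Γ, n (g • {A, B}) = (X.hol g).linearIsometryEquiv z := by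
    intro g
    have h : ∃ g' : Γ, g' • ({A, B} : Finset W) = g • {A, B} := ⟨g, rfl⟩
    simp only [n, dif_pos h]
    rw [huniq _ _ h.choose_spec]
  have hn0 : ∀ e, cell Γ e ≠ cell Γ {A, B} → n e = 0 := fun e he =>
    dif_neg fun h => he (cell_eq_iff.2 h)
  have hlin : ∀ (g g' : Γ) (y : E4), (X.hol (g * g')).linearIsometryEquiv y =
      (X.hol g).linearIsometryEquiv ((X.hol g').linearIsometryEquiv y) := by
    intro g g' y
    rw [map_mul]
    rfl
  refine ⟨n, ⟨⟨?_, ?_, ?_⟩, hn0⟩, ?_⟩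
  · intro e he
    refine hn0 e fun h => he ?_
    rw [← T'.cell_mem_cells, h]
    exact hm.cell_pair_mem
  · intro e _ p hp q hq
    by_cases he : cell Γ e = cell Γ {A, B}
    · obtain ⟨g, rfl⟩ := cell_eq_iff.1 he
      obtain ⟨p, hp', rfl⟩ := Finset.mem_smul_finset.1 hp
      obtain ⟨q, hq', rfl⟩ := Finset.mem_smul_finset.1 hq
      rw [hn, X.pos_smul_sub, LinearIsometryEquiv.inner_map_map]
      rw [Finset.mem_insert, Finset.mem_singleton] at hp' hq'
      have hz' : inner ℝ z (X.pos A - X.pos B) = 0 := by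
        rw [← neg_sub, inner_neg_right, hz, neg_zero]
      rcases hp' with rfl | rfl <;> rcases hq' with rfl | rfl <;> simp [hz, hz']
    · rw [hn0 e he, inner_zero_left]
  · intro g e _
    by_cases he : cell Γ e = cell Γ {A, B}
    · obtain ⟨g', rfl⟩ := cell_eq_iff.1 he
      rw [← mul_smul, hn, hn, hlin]
    · rw [hn0 e he, map_zero, hn0]
      rwa [cell_smul]
  · have := hn 1
    rw [one_smul] at this
    rw [this, map_one]
    rfl

end IsMove24

end Orbits

/-! ### Kernels and minors under the move -/

/-- A minor of a rank-one perturbation of a matrix with a zero row and a zero column. -/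
theorem det_submatrix_sub_rank_one {F E R : Type*} [Fintype R] [DecidableEq R]
    {Q Q' : Matrix F E ℝ} {y : F → ℝ} {ψ : E → ℝ} (hQ : ∀ i a, Q' i a = Q i a - y i * ψ a)
    (f : R ⊕ Fin 1 → F) (e : R ⊕ Fin 1 → E) (hy : y (f (Sum.inr 0)) ≠ 0)
    (hrow : ∀ a, Q (f (Sum.inr 0)) a = 0) (hcol : ∀ i, Q i (e (Sum.inr 0)) = 0) :
    (Q'.submatrix f e).det = (Q.submatrix (f ∘ Sum.inl) (e ∘ Sum.inl)).det *
      -(y (f (Sum.inr 0)) * ψ (e (Sum.inr 0))) := by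
  have h : Q'.submatrix f e =
      Matrix.fromBlocks 1 (Matrix.of fun i _ => y (f (Sum.inl i)) / y (f (Sum.inr 0))) 0 1 *
      Matrix.fromBlocks (Q.submatrix (f ∘ Sum.inl) (e ∘ Sum.inl)) 0
        (Matrix.of fun _ j => -(y (f (Sum.inr 0)) * ψ (e (Sum.inl j))))
        (Matrix.of fun _ _ => -(y (f (Sum.inr 0)) * ψ (e (Sum.inr 0)))) := by
    rw [Matrix.fromBlocks_multiply]
    ext i j
    rcases i with i | i <;> rcases j with j | j
    · simp only [Matrix.submatrix_apply, hQ, Matrix.fromBlocks_apply₁₁, Matrix.add_apply,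
        Matrix.one_mul, Matrix.mul_apply, Fin.sum_univ_one, Matrix.of_apply, Function.comp_apply]
      field_simp
      ring
    · obtain rfl := Subsingleton.elim j 0
      simp only [Matrix.submatrix_apply, hQ, Matrix.fromBlocks_apply₁₂, Matrix.add_apply,
        Matrix.mul_zero, Matrix.mul_apply, Fin.sum_univ_one, Matrix.of_apply, hcol,
        Matrix.zero_apply]
      field_simp
      ring
    · obtain rfl := Subsingleton.elim i 0
      simp only [Matrix.submatrix_apply, hQ, Matrix.fromBlocks_apply₂₁, Matrix.add_apply,
        Matrix.zero_mul, Matrix.one_mul, Matrix.of_apply, hrow, Matrix.zero_apply]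
      ring
    · obtain rfl := Subsingleton.elim i 0
      obtain rfl := Subsingleton.elim j 0
      simp only [Matrix.submatrix_apply, hQ, Matrix.fromBlocks_apply₂₂, Matrix.add_apply,
        Matrix.zero_mul, Matrix.one_mul, Matrix.of_apply, hrow, Matrix.zero_apply]
      ring
  rw [h, Matrix.det_mul, Matrix.det_fromBlocks_zero₂₁, Matrix.det_fromBlocks_zero₁₂,
    Matrix.det_one, Matrix.det_one, one_mul, one_mul, Matrix.det_fin_one]
  rfl

section Orbits

variable {Γ W : Type*} [Group Γ] [MulAction Γ W] [DecidableEq W]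

namespace Triangulation

variable {X : Development Γ W} (T : Triangulation X)

theorem mem_ker_dω {h : T.Edge → ℝ} :
    h ∈ LinearMap.ker T.dω ↔ ∀ i : T.Face, ∑ a : T.Edge, T.curvature i.1 a.1 * h a = 0 := by
  rw [LinearMap.mem_ker, funext_iff]
  refine forall_congr' fun i => ?_
  simp only [← curvatureMatrix_apply]
  rfl

theorem mem_ker_dΩ {x : T.Face → ℝ} :
    x ∈ LinearMap.ker T.dΩ ↔ ∀ a : T.Edge, ∑ i : T.Face, T.curvature i.1 a.1 * x i = 0 := by
  rw [LinearMap.mem_ker, funext_iff]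
  refine forall_congr' fun i => ?_
  simp only [← curvatureMatrix_apply]
  rfl

end Triangulation

namespace IsMove24

variable {X : Development Γ W}
  {T T' : Triangulation X} {A B : W} {κ : Finset W} (hm : IsMove24 T T' A B κ)

include hm

theorem sum_edge (f : T'.Edge → ℝ) : ∑ a, f a =
    ∑ a : T.Edge, f (hm.edgeEquiv (Sum.inl a)) + f (hm.edgeEquiv (Sum.inr ())) := by
  rw [← hm.edgeEquiv.sum_comp, Fintype.sum_sum_type]
  simp

theorem sum_face (f : T'.Face → ℝ) : ∑ i, f i =
    ∑ i : T.Face, f (hm.faceEquiv (Sum.inl i)) + ∑ c, f (hm.faceEquiv (Sum.inr c)) := by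
  rw [← hm.faceEquiv.sum_comp, Fintype.sum_sum_type]

theorem curvature_new_face (c : κ) (a : Cell Γ W) :
    T.curvature (hm.faceEquiv (Sum.inr c)).1 a = 0 :=
  T.curvature_eq_zero_left (hm.not_cell_old (Finset.subset_insert _ _)) a

theorem curvature_new_edge (i : Cell Γ W) (u : Unit) :
    T.curvature i (hm.edgeEquiv (Sum.inr u)).1 = 0 :=
  T.curvature_eq_zero_right i (hm.not_cell_old subset_rfl)

variable {w : W → ℝ} (hw : IsWeight X.pos (insert A (insert B κ)) w)

include hw

theorem faceWeight_ne_zero (c : κ) :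
    faceWeight X (insert A (insert B κ)) w (hm.faceEquiv (Sum.inr c)).1 ≠ 0 := by
  rw [hm.faceEquiv_inr, hm.faceWeight_triple c.2]
  refine div_ne_zero (T'.volume_pos_three (hm.triple_mem_coverCells c.2)).ne'
    (mul_ne_zero (by norm_num) (Finset.prod_ne_zero_iff.2 fun p hp => ?_))
  exact hm.weight_mem hw (Finset.mem_of_mem_erase hp)

theorem edgeWeight_ne_zero (u : Unit) :
    edgeWeight (insert A (insert B κ)) w (hm.edgeEquiv (Sum.inr u)).1 ≠ 0 := by
  rw [hm.edgeEquiv_inr, hm.edgeWeight_pair hw]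
  exact mul_ne_zero (hm.weight_left hw) (hm.weight_right hw)

/-- The row of the new face `ABc` in the new matrix is a nonzero multiple of `ψ`, so the elements of the new
kernel are orthogonal to `ψ`. -/
theorem ker_dω_old {h : Cell Γ W → ℝ} (hh : T'.onEdges h ∈ LinearMap.ker T'.dω) :
    T.onEdges h ∈ LinearMap.ker T.dω := by
  obtain ⟨s, hs, hcurv⟩ := hm.exists_curvature_eq hw
  have hs0 : s ≠ 0 := by rintro rfl; norm_num at hs
  rw [T'.mem_ker_dω] at hh
  have h1 : ∀ i : T'.Face, ∑ a : T.Edge, T.curvature i.1 a.1 * h a.1 -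
      s * faceWeight X (insert A (insert B κ)) w i.1 *
        ∑ a : T'.Edge, edgeWeight (insert A (insert B κ)) w a.1 * h a.1 = 0 := by
    intro i
    rw [← hh i]
    simp only [hcurv, sub_mul, Finset.sum_sub_distrib, mul_assoc, ← Finset.mul_sum]
    congr 1
    rw [hm.sum_edge, hm.curvature_new_edge, zero_mul, add_zero]
    rfl
  obtain ⟨c, hc⟩ := hm.nonempty
  have h2 := h1 (hm.faceEquiv (Sum.inr ⟨c, hc⟩))
  simp only [hm.curvature_new_face, zero_mul, Finset.sum_const_zero, zero_sub, neg_eq_zero] at h2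
  have h3 := (mul_eq_zero.1 h2).resolve_left (mul_ne_zero hs0 (hm.faceWeight_ne_zero hw _))
  rw [T.mem_ker_dω]
  intro i
  have h4 := h1 (hm.faceEquiv (Sum.inl i))
  rwa [h3, mul_zero, sub_zero] at h4

/-- The column of the new edge in the new matrix is a nonzero multiple of `y`, which gives the
linear relation; modulo it, the other columns are those before the move. -/
theorem mem_ker_dΩ_iff {x : T'.Face → ℝ} : x ∈ LinearMap.ker T'.dΩ ↔
    (fun i => x (hm.faceEquiv (Sum.inl i))) ∈ LinearMap.ker T.dΩ ∧
      ∑ i : T'.Face, faceWeight X (insert A (insert B κ)) w i.1 * x i = 0 := by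
  obtain ⟨s, hs, hcurv⟩ := hm.exists_curvature_eq hw
  have hs0 : s ≠ 0 := by rintro rfl; norm_num at hs
  have h1 : ∀ a : T'.Edge, ∑ i : T'.Face, T'.curvature i.1 a.1 * x i =
      ∑ i : T.Face, T.curvature i.1 a.1 * x (hm.faceEquiv (Sum.inl i)) -
      s * edgeWeight (insert A (insert B κ)) w a.1 *
        ∑ i : T'.Face, faceWeight X (insert A (insert B κ)) w i.1 * x i := by
    intro a
    simp only [hcurv, sub_mul, Finset.sum_sub_distrib, Finset.mul_sum]
    congr 1
    · rw [hm.sum_face]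
      simp [curvature_new_face hm, hm.faceEquiv_inl, -faceEquiv_inr]
    · exact Finset.sum_congr rfl fun i _ => by ring
  rw [T'.mem_ker_dΩ, T.mem_ker_dΩ]
  constructor
  · intro h
    have h2 := h (hm.edgeEquiv (Sum.inr ()))
    rw [h1] at h2
    simp only [hm.curvature_new_edge, zero_mul, Finset.sum_const_zero, zero_sub, neg_eq_zero] at h2
    have h3 := (mul_eq_zero.1 h2).resolve_left (mul_ne_zero hs0 (hm.edgeWeight_ne_zero hw _))
    refine ⟨fun a => ?_, h3⟩
    have h4 := h (hm.edgeEquiv (Sum.inl a))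
    rwa [h1, h3, mul_zero, sub_zero] at h4
  · rintro ⟨h2, h3⟩ a
    rw [h1, h3, mul_zero, sub_zero]
    obtain ⟨a | u, rfl⟩ := hm.edgeEquiv.surjective a
    · exact h2 a
    · simp only [hm.curvature_new_edge, zero_mul, Finset.sum_const_zero]

/-- The derivative of the area of `ABc` with respect to the component of the deviation of `AB`
in the direction `b l`. -/
def areaJacobian (_ : IsMove24 T T' A B κ) (b : Fin 3 → E4) (c : W) (l : Fin 3) : ℝ :=
  -(X.sqLength {A, B} / (2 * X.volume (insert c {A, B}))) *
    inner ℝ (X.pos c - (2 : ℝ)⁻¹ • (X.pos A + X.pos B)) (b l)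

variable {b : Fin 3 → E4} (hb : Orthonormal ℝ b)
  (hbAB : ∀ k, inner ℝ (b k) (X.pos B - X.pos A) = 0)

include hb hbAB

omit hw in
theorem dS_inr_eq_sum {n : EdgeField W} (hn : n ∈ T'.deviationsAt {A, B}) (c : κ) :
    T'.dS n (hm.faceEquiv (Sum.inr c)) =
      ∑ l, hm.areaJacobian b c.1 l * inner ℝ (b l) (n {A, B}) := by
  rw [hm.dS_inr hn, inner_eq_sum_of_orthogonal hb (sub_ne_zero.2 hm.pos_ne) hbAB _
    (hm.deviationsAt_inner hn), Finset.mul_sum]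
  exact Finset.sum_congr rfl fun l _ => by rw [areaJacobian]; ring

omit hw in
theorem eq_zero_of_inner_eq_zero {n : EdgeField W} (hn : n ∈ T'.deviationsAt {A, B})
    (h : ∀ l, inner ℝ (b l) (n {A, B}) = 0) : n = 0 := by
  refine hm.deviationsAt_eq_zero hn (inner_self_eq_zero (𝕜 := ℝ).1 ?_)
  rw [inner_eq_sum_of_orthogonal hb (sub_ne_zero.2 hm.pos_ne) hbAB _ (hm.deviationsAt_inner hn)]
  simp [h]

theorem abs_det_areaJacobian {c₁ : W} (hc₁ : c₁ ∈ κ) (c : Fin 3 ≃ (κ.erase c₁ : Finset W)) :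
    |(Matrix.of fun k l => hm.areaJacobian b (c k).1 l).det| *
      ∏ p ∈ κ.erase c₁, X.volume (insert p {A, B}) =
      3 * X.sqLength {A, B} ^ (5 / 2 : ℝ) * |w c₁| := by
  have h1 := abs_det_inner_mul_norm (x := X.pos) hm.pos_ne (P := κ.erase c₁)
    (fun h => hm.notMem_left (Finset.mem_of_mem_erase h))
    (fun h => hm.notMem_right (Finset.mem_of_mem_erase h)) c hb hbAB
  have h2 : ({A, B} : Finset W) ∪ κ.erase c₁ = (insert A (insert B κ)).erase c₁ := by
    rw [hm.erase_mem hc₁, Finset.insert_union, Finset.singleton_union]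
  rw [h2, ← hw.abs_eq c₁ (by simp [hc₁])] at h1
  have h3 : (Matrix.of fun k l => hm.areaJacobian b (c k).1 l) = Matrix.of fun k l =>
      -(X.sqLength {A, B} / (2 * X.volume (insert (c k).1 {A, B}))) *
      (Matrix.of fun k l => inner ℝ (X.pos (c k) - (2 : ℝ)⁻¹ • (X.pos A + X.pos B)) (b l)) k l :=
    rfl
  have h4 : ∏ p ∈ κ.erase c₁, X.volume (insert p {A, B}) =
      ∏ k : Fin 3, X.volume (insert (c k).1 {A, B}) := by
    rw [← Finset.prod_coe_sort, ← c.prod_comp]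
  have hV : ∀ k, X.volume (insert (c k).1 {A, B}) ≠ 0 := fun k =>
    (T'.volume_pos_three (hm.triple_mem_coverCells (Finset.mem_of_mem_erase (c k).2))).ne'
  have hV0 : ∀ k, 0 < X.volume (insert (c k).1 {A, B}) := fun k =>
    T'.volume_pos_three (hm.triple_mem_coverCells (Finset.mem_of_mem_erase (c k).2))
  have hL : X.sqLength {A, B} = ‖X.pos A - X.pos B‖ ^ 2 := X.sqLength_pair hm.ne
  have hn : 0 < ‖X.pos A - X.pos B‖ := norm_pos_iff.2 (sub_ne_zero.2 hm.pos_ne.symm)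
  have hL5 : X.sqLength {A, B} ^ (5 / 2 : ℝ) = ‖X.pos A - X.pos B‖ ^ 5 := by
    rw [hL, ← Real.rpow_natCast, ← Real.rpow_natCast, ← Real.rpow_mul hn.le]
    norm_num
  rw [h3, Matrix.det_mul_column, h4, hL5, abs_mul, hL]
  generalize (Matrix.of fun k l =>
    inner ℝ (X.pos (c k) - (2 : ℝ)⁻¹ • (X.pos A + X.pos B)) (b l)).det = D at *
  simp only [Fin.prod_univ_three, abs_mul, abs_neg, abs_div, abs_two, abs_pow, abs_norm,
    abs_of_pos (hV0 _)]
  have v0 := hV 0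
  have v1 := hV 1
  have v2 := hV 2
  field_simp
  linear_combination h1

theorem det_areaJacobian_ne_zero {c₁ : W} (hc₁ : c₁ ∈ κ) (c : Fin 3 ≃ (κ.erase c₁ : Finset W)) :
    (Matrix.of fun k l => hm.areaJacobian b (c k).1 l).det ≠ 0 := by
  intro h
  have h1 := hm.abs_det_areaJacobian hw hb hbAB hc₁ c
  rw [h, abs_zero, zero_mul] at h1
  have hn : 0 < ‖X.pos A - X.pos B‖ := norm_pos_iff.2 (sub_ne_zero.2 hm.pos_ne.symm)
  have h2 : 0 < X.sqLength {A, B} ^ (5 / 2 : ℝ) := by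
    rw [X.sqLength_pair hm.ne]; positivity
  have h3 : 0 < |w c₁| := abs_pos.2 (hm.weight_mem hw hc₁)
  have : 0 < 3 * X.sqLength {A, B} ^ (5 / 2 : ℝ) * |w c₁| := by positivity
  exact this.ne h1

omit hw hb hbAB in
theorem exists_enumeration : ∃ c₁ ∈ κ, Nonempty (Fin 3 ≃ (κ.erase c₁ : Finset W)) := by
  obtain ⟨c₁, hc₁⟩ := hm.nonempty
  refine ⟨c₁, hc₁, ⟨Fintype.equivOfCardEq ?_⟩⟩
  rw [Fintype.card_fin, Fintype.card_coe, Finset.card_erase_of_mem hc₁, hm.card_eq]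

omit hw in
theorem deviationsAt_eq_zero_of_dS (hw : IsWeight X.pos (insert A (insert B κ)) w)
    {n : EdgeField W} (hn : n ∈ T'.deviationsAt {A, B})
    (h : T'.dS n = 0) : n = 0 := by
  obtain ⟨c₁, hc₁, ⟨c⟩⟩ := hm.exists_enumeration
  refine hm.eq_zero_of_inner_eq_zero hb hbAB hn fun l => ?_
  refine congrFun (Matrix.eq_zero_of_mulVec_eq_zero
    (hm.det_areaJacobian_ne_zero hw hb hbAB hc₁ c)
    (v := fun l => inner ℝ (b l) (n {A, B})) ?_) l
  funext k
  have := hm.dS_inr_eq_sum hb hbAB hn ⟨(c k).1, Finset.mem_of_mem_erase (c k).2⟩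
  rw [h] at this
  exact this.symm

/-- A cycle `x` after the move is represented by edge deviations as soon as its restriction to
the old faces is: the four areas of the new faces are adjusted, up to one linear relation
satisfied by `x`, by the deviation of `AB`. -/
theorem exists_dS_add_eq {x : T'.Face → ℝ} (hx : x ∈ LinearMap.ker T'.dΩ) {u : EdgeField W}
    (hu : u ∈ T.deviations) (hux : T.dS u = fun i => x (hm.faceEquiv (Sum.inl i))) :
    ∃ n ∈ T'.deviationsAt {A, B}, T'.dS (u + n) = x := by
  obtain ⟨c₁, hc₁, ⟨c⟩⟩ := hm.exists_enumeration
  let M : Matrix (Fin 3) (Fin 3) ℝ := Matrix.of fun k l => hm.areaJacobian b (c k).1 l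
  have hM : M.det ≠ 0 := hm.det_areaJacobian_ne_zero hw hb hbAB hc₁ c
  let g : Fin 3 → κ := fun k => ⟨(c k).1, Finset.mem_of_mem_erase (c k).2⟩
  let τ : Fin 3 → ℝ := M⁻¹.mulVec fun k =>
    x (hm.faceEquiv (Sum.inr (g k))) - T'.dS u (hm.faceEquiv (Sum.inr (g k)))
  have hτ : M.mulVec τ = fun k =>
      x (hm.faceEquiv (Sum.inr (g k))) - T'.dS u (hm.faceEquiv (Sum.inr (g k))) := by
    rw [Matrix.mulVec_mulVec, Matrix.mul_nonsing_inv _ (isUnit_iff_ne_zero.2 hM), Matrix.one_mulVec]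
  obtain ⟨n, hn, hnz⟩ := hm.exists_deviationsAt (z := ∑ l, τ l • b l) (by
    simp [sum_inner, real_inner_smul_left, hbAB])
  refine ⟨n, hn, ?_⟩
  have h1 : ∀ k, T'.dS n (hm.faceEquiv (Sum.inr (g k))) =
      x (hm.faceEquiv (Sum.inr (g k))) - T'.dS u (hm.faceEquiv (Sum.inr (g k))) := by
    intro k
    rw [hm.dS_inr_eq_sum hb hbAB hn, hnz]
    simp only [hb.inner_right_fintype]
    exact congrFun hτ k
  have h2 : ∀ i, i ≠ hm.faceEquiv (Sum.inr ⟨c₁, hc₁⟩) → T'.dS (u + n) i = x i := by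
    intro i hi
    obtain ⟨i | p, rfl⟩ := hm.faceEquiv.surjective i
    · rw [map_add, Pi.add_apply, hm.dS_inl, hm.dS_inl, hm.dS_deviationsAt hn, hux]
      simp
    · have hp : p.1 ≠ c₁ := fun h => hi (by rw [← Subtype.coe_eta p p.2]; simp only [h])
      obtain ⟨k, hk⟩ := c.surjective ⟨p.1, Finset.mem_erase.2 ⟨hp, p.2⟩⟩
      have hgk : g k = p := by simp [g, hk]
      have := h1 k
      rw [hgk] at this
      rw [map_add, Pi.add_apply, this]
      ring
  have h3 := hm.sum_faceWeight_dS hw (add_mem (hm.deviations_le hu) hn.1)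
  have h4 := ((hm.mem_ker_dΩ_iff hw).1 hx).2
  have h5 : ∑ i : T'.Face, faceWeight X (insert A (insert B κ)) w i.1 *
      (T'.dS (u + n) i - x i) = 0 := by
    simp only [mul_sub, Finset.sum_sub_distrib, h3, h4, sub_zero]
  rw [Finset.sum_eq_single_of_mem (hm.faceEquiv (Sum.inr ⟨c₁, hc₁⟩)) (Finset.mem_univ _)
    fun i _ hi => by rw [h2 i hi, sub_self, mul_zero]] at h5
  have h6 := (mul_eq_zero.1 h5).resolve_left (hm.faceWeight_ne_zero hw _)
  funext i
  by_cases hi : i = hm.faceEquiv (Sum.inr ⟨c₁, hc₁⟩)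
  · rw [hi]; exact sub_eq_zero.1 h6
  · exact h2 i hi

theorem kerSubsetIm (hincl : T.KerSubsetIm) : T'.KerSubsetIm := by
  intro x hx
  obtain ⟨u, hu, hux⟩ := hincl ((hm.mem_ker_dΩ_iff hw).1 hx).1
  obtain ⟨n, hn, h⟩ := hm.exists_dS_add_eq hw hb hbAB hx hu hux
  exact ⟨u + n, add_mem (hm.deviations_le hu) hn.1, h⟩

variable {U : Submodule ℝ (EdgeField W)} (hU : U ≤ T.deviations)

include hU

omit hb hbAB in
theorem dS_mem_ker (hUΩ : U.map T.dS = LinearMap.ker T.dΩ) {v : EdgeField W}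
    (hv : v ∈ U ⊔ T'.deviationsAt {A, B}) : T'.dS v ∈ LinearMap.ker T'.dΩ := by
  obtain ⟨u, hu, n, hn, rfl⟩ := Submodule.mem_sup.1 hv
  rw [hm.mem_ker_dΩ_iff hw]
  refine ⟨?_, hm.sum_faceWeight_dS hw (add_mem (hm.deviations_le (hU hu)) hn.1)⟩
  have : (fun i => T'.dS (u + n) (hm.faceEquiv (Sum.inl i))) = T.dS u := by
    funext i
    rw [hm.dS_inl, map_add, hm.dS_deviationsAt hn, add_zero]
  rw [this, ← hUΩ]
  exact Submodule.mem_map_of_mem hu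

theorem map_dS_eq_ker (hUΩ : U.map T.dS = LinearMap.ker T.dΩ) :
    (U ⊔ T'.deviationsAt {A, B}).map T'.dS = LinearMap.ker T'.dΩ := by
  apply le_antisymm
  · rintro _ ⟨v, hv, rfl⟩
    exact hm.dS_mem_ker hw hU hUΩ hv
  · intro x hx
    have h1 := ((hm.mem_ker_dΩ_iff hw).1 hx).1
    rw [← hUΩ] at h1
    obtain ⟨u, hu, hux⟩ := h1
    obtain ⟨n, hn, h⟩ := hm.exists_dS_add_eq hw hb hbAB hx (hU hu) hux
    exact ⟨u + n, Submodule.add_mem_sup hu hn, h⟩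

theorem disjoint_ker_dS (hUD : Disjoint U (LinearMap.ker T.dS)) :
    Disjoint (U ⊔ T'.deviationsAt {A, B}) (LinearMap.ker T'.dS) := by
  rw [Submodule.disjoint_def] at hUD ⊢
  intro v hv hv0
  obtain ⟨u, hu, n, hn, rfl⟩ := Submodule.mem_sup.1 hv
  rw [LinearMap.mem_ker] at hv0
  have h1 : u = 0 := hUD u hu (by
    rw [LinearMap.mem_ker]
    funext i
    have h2 := congrFun hv0 (hm.faceEquiv (Sum.inl i))
    rwa [hm.dS_inl, map_add, hm.dS_deviationsAt hn, add_zero] at h2)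
  subst h1
  rw [zero_add] at hv0 ⊢
  exact hm.deviationsAt_eq_zero_of_dS hb hbAB hw hn hv0

end IsMove24

end Orbits

/-! ### The invariant under the move -/

section Orbits

variable {Γ W : Type*} [Group Γ] [MulAction Γ W] [DecidableEq W]

namespace Triangulation

variable {X : Development Γ W} (T : Triangulation X)

theorem invariantDev_apply {r m d : ℕ} (φ : T.MinorChoice r m d) (h : Fin m → T.Edge → ℝ) :
    T.invariantDev φ h = ((∏ i : T.Face, X.volume i.1.out) / (∏ σ : T.cells 5, X.volume σ.1.out) *
      (T.curvatureMatrix.submatrix (φ.faces ∘ Sum.inl) (φ.edges ∘ Sum.inl)).det⁻¹ *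
      (Matrix.of fun i j => h i (φ.edges (Sum.inr j))).det) •
      wedgeForms fun j => LinearMap.proj (φ.faces (Sum.inr j)) ∘ₗ T.dS := by
  ext v
  simp only [invariantDev, invariant, AlternatingMap.smul_apply, smul_smul,
    AlternatingMap.compLinearMap_apply, LinearMap.compAlternatingMap_apply,
    LinearMap.toSpanSingleton_apply, smul_eq_mul]
  rfl

end Triangulation

namespace IsMove24

variable {X : Development Γ W}
  {T T' : Triangulation X} {A B : W} {κ : Finset W} (hm : IsMove24 T T' A B κ)

include hm

/-- The splitting of the edges into `𝒞` and its complement, extended by adding the edge `AB`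
to `𝒞`. -/
def extendEdges {r m : ℕ} (e : Fin r ⊕ Fin m ≃ T.Edge) : (Fin r ⊕ Fin 1) ⊕ Fin m ≃ T'.Edge :=
  (Equiv.sumAssoc _ _ _).trans <| ((Equiv.refl _).sumCongr (Equiv.sumComm _ _)).trans <|
    (Equiv.sumAssoc _ _ _).symm.trans <| (e.sumCongr (Equiv.ofUnique (Fin 1) Unit)).trans
      hm.edgeEquiv

/-- The splitting of the faces into `𝒟` and its complement, extended by adding one of the four new
faces to `𝒟`. -/
def extendFaces {r d : ℕ} (f : Fin r ⊕ Fin d ≃ T.Face) (k : Fin 1 ⊕ Fin 3 ≃ κ) :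
    (Fin r ⊕ Fin 1) ⊕ (Fin d ⊕ Fin 3) ≃ T'.Face :=
  (Equiv.sumSumSumComm _ _ _ _).trans <| (f.sumCongr k).trans hm.faceEquiv

variable {r m d : ℕ} (e : Fin r ⊕ Fin m ≃ T.Edge) (f : Fin r ⊕ Fin d ≃ T.Face)
  (k : Fin 1 ⊕ Fin 3 ≃ κ)

/-- Subtracting multiples of the new row reduces the extended minor to the old one. -/
theorem det_extend {y : T'.Face → ℝ} {ψ : T'.Edge → ℝ}
    (hQ : ∀ i a, T'.curvature i.1 a.1 = T.curvature i.1 a.1 - y i * ψ a)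
    (hy : y (hm.faceEquiv (Sum.inr (k (Sum.inl 0)))) ≠ 0) :
    (T'.curvatureMatrix.submatrix (hm.extendFaces f k ∘ Sum.inl)
      (hm.extendEdges e ∘ Sum.inl)).det =
      (T.curvatureMatrix.submatrix (f ∘ Sum.inl) (e ∘ Sum.inl)).det *
        -(y (hm.faceEquiv (Sum.inr (k (Sum.inl 0)))) * ψ (hm.edgeEquiv (Sum.inr ()))) := by
  have h := det_submatrix_sub_rank_one
    (Q := Matrix.of fun (i : T'.Face) (a : T'.Edge) => T.curvature i.1 a.1)
    (Q' := T'.curvatureMatrix) (y := y) (ψ := ψ)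
    (fun i a => by rw [T'.curvatureMatrix_apply, hQ, Matrix.of_apply])
    (hm.extendFaces f k ∘ Sum.inl) (hm.extendEdges e ∘ Sum.inl) hy
    (fun a => hm.curvature_new_face _ _) (fun i => hm.curvature_new_edge _ ())
  rw [h]
  congr 2
  ext i j
  exact (T.curvatureMatrix_apply _ _).symm

theorem rank_eq {y : T'.Face → ℝ} {ψ : T'.Edge → ℝ}
    (hQ : ∀ i a, T'.curvature i.1 a.1 = T.curvature i.1 a.1 - y i * ψ a)
    (hy : y (hm.faceEquiv (Sum.inr (k (Sum.inl 0)))) ≠ 0)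
    (hψ : ψ (hm.edgeEquiv (Sum.inr ())) ≠ 0) (hr : T.curvatureMatrix.rank = r)
    (hdet : (T.curvatureMatrix.submatrix (f ∘ Sum.inl) (e ∘ Sum.inl)).det ≠ 0) :
    T'.curvatureMatrix.rank = r + 1 := by
  classical
  apply le_antisymm
  · obtain ⟨P, G, hPG⟩ := exists_rank_factorization (R := Fin r) T.curvatureMatrix (by simp [hr])
    have h1 : T'.curvatureMatrix =
        (Matrix.of fun (i : T'.Face) (j : Fin r ⊕ Fin 1) => Sum.elim
          (fun j => Sum.elim (fun i' => P i' j) (fun _ => 0) (hm.faceEquiv.symm i))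
          (fun _ => -y i) j) *
        (Matrix.of fun (j : Fin r ⊕ Fin 1) (a : T'.Edge) => Sum.elim
          (fun j => Sum.elim (fun a' => G j a') (fun _ => 0) (hm.edgeEquiv.symm a))
          (fun _ => ψ a) j) := by
      ext i a
      rw [T'.curvatureMatrix_apply, hQ, Matrix.mul_apply, Fintype.sum_sum_type, Fin.sum_univ_one]
      obtain ⟨i | c, rfl⟩ := hm.faceEquiv.surjective i
      · obtain ⟨a | u, rfl⟩ := hm.edgeEquiv.surjective a
        · have h2 := T.curvatureMatrix_apply i a
          rw [hPG, Matrix.mul_apply] at h2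
          simp [← h2, sub_eq_add_neg]
        · rw [hm.curvature_new_edge]
          simp
      · rw [hm.curvature_new_face]
        simp
    rw [h1]
    refine (Matrix.rank_mul_le_left _ _).trans ((Matrix.rank_le_card_width _).trans ?_)
    simp
  · have h1 := hm.det_extend e f k hQ hy
    have h2 : (T'.curvatureMatrix.submatrix (hm.extendFaces f k ∘ Sum.inl)
        (hm.extendEdges e ∘ Sum.inl)).det ≠ 0 := by
      rw [h1]
      exact mul_ne_zero hdet (neg_ne_zero.2 (mul_ne_zero hy hψ))
    have h3 := Matrix.rank_of_isUnit _ ((Matrix.isUnit_iff_isUnit_det _).2 (isUnit_iff_ne_zero.2 h2))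
    have h4 := Matrix.rank_submatrix_le T'.curvatureMatrix (hm.extendFaces f k ∘ Sum.inl)
      (hm.extendEdges e ∘ Sum.inl)
    rw [h3] at h4
    simpa using h4

variable {w : W → ℝ} (hw : IsWeight X.pos (insert A (insert B κ)) w)

include hw

/-- The factors of the invariant which come from areas and volumes, from the new row and column of
the minor and from the Jacobian of the new areas combine to `72 L_{AB}^{5/2}`. -/
theorem exists_factor {s : ℝ} (hs : s ^ 2 = 1) {b : Fin 3 → E4} (hb : Orthonormal ℝ b)
    (hbAB : ∀ k, inner ℝ (b k) (X.pos B - X.pos A) = 0) {c₁ : W} (hc₁ : c₁ ∈ κ)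
    (c : Fin 3 ≃ (κ.erase c₁ : Finset W)) :
    ∃ ε : ℝ, (ε = 1 ∨ ε = -1) ∧
      (∏ i : T'.Face, X.volume i.1.out) / (∏ σ : T'.cells 5, X.volume σ.1.out) *
      (-(s * faceWeight X (insert A (insert B κ)) w (hm.faceEquiv (Sum.inr ⟨c₁, hc₁⟩)).1 *
        edgeWeight (insert A (insert B κ)) w (hm.edgeEquiv (Sum.inr ())).1))⁻¹ *
      (Matrix.of fun k l => hm.areaJacobian b (c k).1 l).det =
      ε * (72 * X.sqLength {A, B} ^ (5 / 2 : ℝ)) *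
        ((∏ i : T.Face, X.volume i.1.out) / (∏ σ : T.cells 5, X.volume σ.1.out)) := by
  have hJ := hm.abs_det_areaJacobian hw hb hbAB hc₁ c
  have hS : ∏ i : T'.Face, X.volume i.1.out = (∏ i : T.Face, X.volume i.1.out) *
      (X.volume (insert c₁ {A, B}) * ∏ p ∈ κ.erase c₁, X.volume (insert p {A, B})) := by
    rw [← hm.faceEquiv.prod_comp, Fintype.prod_sum_type, Finset.mul_prod_erase κ
      (fun p => X.volume (insert p {A, B})) hc₁, ← Finset.prod_coe_sort κ]
    simp only [hm.faceEquiv_inl, hm.faceEquiv_inr, X.volume_out_cell]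
  have hV := hm.prod_cells_five fun q => X.volume q.out
  have vol_w : ∀ p ∈ insert A (insert B κ), X.volume ((insert A (insert B κ)).erase p) = |w p| :=
    fun p hp => (hw.abs_eq p hp).symm
  have hVc : ∏ p ∈ κ, X.volume ((insert A (insert B κ)).erase p) =
      |w c₁| * ∏ p ∈ κ.erase c₁, |w p| := by
    rw [Finset.mul_prod_erase κ (fun p => |w p|) hc₁]
    exact Finset.prod_congr rfl fun p hp => vol_w p (by simp [hp])
  have hVA := vol_w A (by simp)
  have hVB := vol_w B (by simp)
  rw [hm.erase_left] at hVA
  rw [hm.erase_right] at hVB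
  simp only [X.volume_out_cell, hVc, hVA, hVB] at hV
  rw [hm.faceEquiv_inr, hm.edgeEquiv_inr, hm.faceWeight_triple hc₁, hm.edgeWeight_pair hw, hS]
  have hS1 : 0 < X.volume (insert c₁ {A, B}) :=
    T'.volume_pos_three (hm.triple_mem_coverCells hc₁)
  have hS2 : 0 < ∏ p ∈ κ.erase c₁, X.volume (insert p {A, B}) := Finset.prod_pos fun p hp =>
    T'.volume_pos_three (hm.triple_mem_coverCells (Finset.mem_of_mem_erase hp))
  have hS0 : 0 < ∏ i : T.Face, X.volume i.1.out := Finset.prod_pos fun i _ =>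
    T.volume_pos_three (T.out_mem_coverCells i.2)
  have hV0 : 0 < ∏ σ : T.cells 5, X.volume σ.1.out := Finset.prod_pos fun i _ =>
    T.volume_pos_five (T.out_mem_simplices i.2)
  have hV1 : 0 < ∏ σ : T'.cells 5, X.volume σ.1.out := Finset.prod_pos fun i _ =>
    T'.volume_pos_five (T'.out_mem_simplices i.2)
  have hA := abs_pos.2 (hm.weight_left hw)
  have hB := abs_pos.2 (hm.weight_right hw)
  have hc := abs_pos.2 (hm.weight_mem hw hc₁)
  have hP : 0 < ∏ p ∈ κ.erase c₁, |w p| := Finset.prod_pos fun p hp =>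
    abs_pos.2 (hm.weight_mem hw (Finset.mem_of_mem_erase hp))
  have hL : 0 ≤ X.sqLength {A, B} ^ (5 / 2 : ℝ) := by
    rw [X.sqLength_pair hm.ne]; positivity
  have hsabs : |s| = 1 := by
    rw [← Real.sqrt_sq_eq_abs, hs, Real.sqrt_one]
  generalize (Matrix.of fun k l => hm.areaJacobian b (c k).1 l).det = J at *
  generalize X.sqLength {A, B} ^ (5 / 2 : ℝ) = L at *
  generalize X.volume (insert c₁ {A, B}) = S₁ at *
  generalize ∏ p ∈ κ.erase c₁, X.volume (insert p {A, B}) = S₂ at *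
  generalize ∏ i : T.Face, X.volume i.1.out = S₀ at *
  generalize ∏ σ : T.cells 5, X.volume σ.1.out = V₀ at *
  generalize ∏ σ : T'.cells 5, X.volume σ.1.out = V₁ at *
  have habs : |S₀ * (S₁ * S₂) / V₁ *
      (-(s * (S₁ / (24 * ∏ p ∈ κ.erase c₁, w p)) * (w A * w B)))⁻¹ * J| =
      72 * L * (S₀ / V₀) := by
    simp only [abs_mul, abs_div, abs_inv, abs_neg, Finset.abs_prod, hsabs, abs_of_pos hS0,
      abs_of_pos hS1, abs_of_pos hS2, abs_of_pos hV1, Nat.abs_ofNat]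
    generalize ∏ p ∈ κ.erase c₁, |w p| = P at *
    have hV1' : V₁ = V₀ * (|w c₁| * P) / (|w B| * |w A|) := by
      rw [eq_div_iff (by positivity), hV]
    rw [hV1']
    have hS2' := hS2.ne'
    field_simp
    linear_combination 24 * hJ
  have hnn : 0 ≤ 72 * L * (S₀ / V₀) := by positivity
  rcases (abs_eq hnn).1 habs with h | h
  · exact ⟨1, Or.inl rfl, by rw [h]; ring⟩
  · exact ⟨-1, Or.inr rfl, by rw [h]; ring⟩

variable {U : Submodule ℝ (EdgeField W)} (hU : U ≤ T.deviations)
  (hUD : Disjoint U (LinearMap.ker T.dS)) (hUΩ : U.map T.dS = LinearMap.ker T.dΩ)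

include hU hUD hUΩ

omit hm hw hU in
/-- On `U`, every linear function is a combination of the differentials of the areas of the faces
outside `𝒟`. -/
theorem exists_coeff (hdet : (T.curvatureMatrix.submatrix (f ∘ Sum.inl) (e ∘ Sum.inl)).det ≠ 0)
    (F : EdgeField W →ₗ[ℝ] ℝ) : ∃ g : Fin d → ℝ, ∀ u ∈ U,
      F u = ∑ l, T.dS u (f (Sum.inr l)) * g l := by
  let ι : U →ₗ[ℝ] (Fin d → ℝ) :=
    (LinearMap.pi fun l => LinearMap.proj (f (Sum.inr l)) ∘ₗ T.dS) ∘ₗ U.subtype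
  have hι : LinearMap.ker ι = ⊥ := by
    rw [LinearMap.ker_eq_bot']
    rintro ⟨u, hu⟩ h
    have h1 : ∀ l, T.dS u (f (Sum.inr l)) = 0 := fun l => congrFun h l
    have h2 : T.dS u ∈ LinearMap.ker T.dΩ := hUΩ ▸ Submodule.mem_map_of_mem hu
    rw [T.mem_ker_dΩ] at h2
    have h3 : (fun i => T.dS u (f (Sum.inl i))) = 0 := by
      refine Matrix.eq_zero_of_vecMul_eq_zero hdet ?_
      funext j
      have h4 := h2 (e (Sum.inl j))
      rw [← f.sum_comp, Fintype.sum_sum_type] at h4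
      simp only [h1, mul_zero, Finset.sum_const_zero, add_zero] at h4
      rw [Pi.zero_apply, ← h4, Matrix.vecMul, dotProduct]
      refine Finset.sum_congr rfl fun i _ => ?_
      rw [Matrix.submatrix_apply, T.curvatureMatrix_apply, mul_comm]
      rfl
    refine Subtype.ext (Submodule.disjoint_def.1 hUD u hu ?_)
    rw [LinearMap.mem_ker]
    funext i
    obtain ⟨i | i, rfl⟩ := f.surjective i
    · exact congrFun h3 i
    · exact h1 i
  obtain ⟨g, hg⟩ := ι.exists_leftInverse_of_injective hι
  refine ⟨fun l => F (g fun j => if l = j then 1 else 0).1, fun u hu => ?_⟩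
  have h1 : g (ι ⟨u, hu⟩) = ⟨u, hu⟩ := LinearMap.congr_fun hg _
  have h2 := LinearMap.pi_apply_eq_sum_univ (F ∘ₗ U.subtype ∘ₗ g) (ι ⟨u, hu⟩)
  simp only [LinearMap.comp_apply, h1] at h2
  rw [Submodule.subtype_apply] at h2
  rw [h2]
  rfl

omit hw in
/-- The form `⋀ dS` after the move, in the coordinates that extend those before the move. -/
theorem det_dS_extend (hdet : (T.curvatureMatrix.submatrix (f ∘ Sum.inl) (e ∘ Sum.inl)).det ≠ 0)
    {b : Fin 3 → E4} (hb : Orthonormal ℝ b)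
    (hbAB : ∀ k, inner ℝ (b k) (X.pos B - X.pos A) = 0) {v : Fin d ⊕ Fin 3 → EdgeField W}
    (hv : ∀ i, v i ∈ U ⊔ T'.deviationsAt {A, B}) :
    (Matrix.of fun i j => T'.dS (v i) (hm.extendFaces f k (Sum.inr j))).det =
      wedgeForms (Sum.elim (fun j => LinearMap.proj (f (Sum.inr j)) ∘ₗ T.dS)
        fun l => (innerₗ E4 (b l)) ∘ₗ LinearMap.proj {A, B}) v *
      (Matrix.of fun i l => hm.areaJacobian b (k (Sum.inr i)).1 l).det := by
  have hG := fun i : Fin 3 => exists_coeff e f hUD hUΩ hdet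
    (LinearMap.proj (hm.faceEquiv (Sum.inr (k (Sum.inr i)))) ∘ₗ T'.dS)
  choose G hG using hG
  have h1 : (Matrix.of fun i j => T'.dS (v i) (hm.extendFaces f k (Sum.inr j))) =
      (Matrix.of fun i j => (Sum.elim (fun j => LinearMap.proj (f (Sum.inr j)) ∘ₗ T.dS)
        (fun l => (innerₗ E4 (b l)) ∘ₗ LinearMap.proj {A, B}) :
          Fin d ⊕ Fin 3 → EdgeField W →ₗ[ℝ] ℝ) j (v i)) *
      Matrix.fromBlocks 1 (Matrix.of fun l i => G i l) 0
        (Matrix.of fun i l => hm.areaJacobian b (k (Sum.inr i)).1 l).transpose := by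
    ext i j
    obtain ⟨u, hu, n, hn, hun⟩ := Submodule.mem_sup.1 (hv i)
    have e1 : T.dS (v i) = T.dS u := by rw [← hun, map_add, hm.dS_deviationsAt hn, add_zero]
    have e2 : v i {A, B} = n {A, B} := by
      rw [← hun, Pi.add_apply, hm.deviation_old_pair (hU hu), zero_add]
    rw [Matrix.mul_apply, Fintype.sum_sum_type]
    rcases j with j | j
    · simp only [Matrix.of_apply, Sum.elim_inl, Sum.elim_inr, Matrix.fromBlocks_apply₁₁,
        Matrix.fromBlocks_apply₂₁, Matrix.zero_apply, mul_zero, Finset.sum_const_zero, add_zero,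
        Matrix.one_apply, mul_ite, mul_one, Finset.sum_ite_eq', Finset.mem_univ, if_true]
      rfl
    · simp only [Matrix.of_apply, Sum.elim_inl, Sum.elim_inr, Matrix.fromBlocks_apply₁₂,
        Matrix.fromBlocks_apply₂₂, Matrix.transpose_apply, LinearMap.comp_apply,
        LinearMap.proj_apply, e1, e2, innerₗ_apply_apply]
      have e3 : hm.extendFaces f k (Sum.inr (Sum.inr j)) =
        hm.faceEquiv (Sum.inr (k (Sum.inr j))) := rfl
      rw [e3, ← hun, map_add, Pi.add_apply, hm.dS_inr_eq_sum hb hbAB hn]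
      have e4 := hG j u hu
      simp only [LinearMap.comp_apply, LinearMap.proj_apply] at e4
      rw [e4]
      congr 1
      exact Finset.sum_congr rfl fun l _ => mul_comm _ _
  rw [h1, Matrix.det_mul, Matrix.det_fromBlocks_zero₂₁, Matrix.det_one, one_mul,
    Matrix.det_transpose]
  rfl

omit hw hU hUD hUΩ in
/-- Choices of maximal minors exist before and after the move. -/
theorem exists_minorChoice : ∃ r m d : ℕ, Nonempty (T.MinorChoice r m d) ∧
    Nonempty (T'.MinorChoice (r + 1) m (d + 3)) := by
  classical
  obtain ⟨w, hw⟩ := hm.exists_weight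
  obtain ⟨s, hs, hcurv⟩ := hm.exists_curvature_eq hw
  have hs0 : s ≠ 0 := by rintro rfl; norm_num at hs
  obtain ⟨r, m, d, e, f, hr, hdet⟩ := exists_maximal_minor T.curvatureMatrix
  have k : Fin 1 ⊕ Fin 3 ≃ κ := Fintype.equivOfCardEq (by simp [hm.card_eq])
  have hy := mul_ne_zero hs0 (hm.faceWeight_ne_zero hw (k (Sum.inl 0)))
  have hψ := hm.edgeWeight_ne_zero hw ()
  have hdet' := hm.det_extend e f k (fun i a => hcurv i.1 a.1) hy
  refine ⟨r, m, d, ⟨⟨e, f, hr, hdet⟩⟩, ⟨⟨(finSumFinEquiv.symm.sumCongr (Equiv.refl _)).trans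
    (hm.extendEdges e), (finSumFinEquiv.symm.sumCongr finSumFinEquiv.symm).trans
    (hm.extendFaces f k), hm.rank_eq e f k (fun i a => hcurv i.1 a.1) hy hψ hr hdet, ?_⟩⟩⟩
  rw [← Matrix.det_submatrix_equiv_self finSumFinEquiv, Matrix.submatrix_submatrix]
  convert hdet'.trans_ne (mul_ne_zero hdet (neg_ne_zero.2 (mul_ne_zero hy hψ))) using 3
  · ext i
    simp
  · ext i
    simp

end IsMove24

end Orbits

theorem wedge_smul_left {V ι κ : Type*} [AddCommGroup V] [Module ℝ V] [Fintype ι] [DecidableEq ι]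
    [Fintype κ] [DecidableEq κ] (c : ℝ) (α : V [⋀^ι]→ₗ[ℝ] ℝ) (β : V [⋀^κ]→ₗ[ℝ] ℝ) :
    wedge (c • α) β = c • wedge α β := by
  ext v
  rw [wedge, wedge, ← AlternatingMap.domCoprod'_apply, ← AlternatingMap.domCoprod'_apply,
    ← TensorProduct.smul_tmul', map_smul]
  simp

section Orbits

variable {Γ W : Type*} [Group Γ] [MulAction Γ W] [DecidableEq W]

namespace IsMove24

variable {X : Development Γ W}
  {T T' : Triangulation X} {A B : W} {κ : Finset W} (hm : IsMove24 T T' A B κ)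

include hm

/-- The invariant is multiplied under the move by `±72 L_{AB}^{5/2} dv_x ∧ dv_y ∧ dv_z`. -/
theorem exists_sign_invariantDev {b : Fin 3 → E4} (hb : Orthonormal ℝ b)
    (hbAB : ∀ k, inner ℝ (b k) (X.pos B - X.pos A) = 0) {r m d : ℕ} (φ : T.MinorChoice r m d)
    (φ' : T'.MinorChoice (r + 1) m (d + 3)) : ∃ ε : ℝ, (ε = 1 ∨ ε = -1) ∧
      ∀ U ≤ T.deviations, Disjoint U (LinearMap.ker T.dS) →
        U.map T.dS = LinearMap.ker T.dΩ → ∀ h : Fin m → Cell Γ W → ℝ,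
        (∀ j, T'.onEdges (h j) ∈ LinearMap.ker T'.dω) →
        ∀ v : Fin d ⊕ Fin 3 → EdgeField W, (∀ i, v i ∈ U ⊔ T'.deviationsAt {A, B}) →
        T'.invariantDev φ' (fun j => T'.onEdges (h j)) (v ∘ finSumFinEquiv.symm) =
          ε * (72 * X.sqLength {A, B} ^ (5 / 2 : ℝ)) *
            wedge (T.invariantDev φ fun j => T.onEdges (h j)) (deviationForm b {A, B}) v := by
  classical
  obtain ⟨w, hw⟩ := hm.exists_weight
  obtain ⟨s, hs, hcurv⟩ := hm.exists_curvature_eq hw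
  have hs0 : s ≠ 0 := by rintro rfl; norm_num at hs
  obtain ⟨c₁, hc₁, ⟨c⟩⟩ := hm.exists_enumeration
  have hk : Function.Bijective (Sum.elim (fun _ => ⟨c₁, hc₁⟩)
      (fun i => ⟨(c i).1, Finset.mem_of_mem_erase (c i).2⟩) : Fin 1 ⊕ Fin 3 → κ) := by
    rw [Fintype.bijective_iff_injective_and_card]
    refine ⟨?_, by simp [hm.card_eq]⟩
    rintro (i | i) (j | j) hij
    · rw [Subsingleton.elim i j]
    · exact absurd (congrArg Subtype.val hij).symm (Finset.ne_of_mem_erase (c j).2)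
    · exact absurd (congrArg Subtype.val hij) (Finset.ne_of_mem_erase (c i).2)
    · exact congrArg Sum.inr (c.injective (Subtype.ext (by simpa using hij)))
  let k : Fin 1 ⊕ Fin 3 ≃ κ := Equiv.ofBijective _ hk
  have hy := mul_ne_zero hs0 (hm.faceWeight_ne_zero hw ⟨c₁, hc₁⟩)
  have hψ := hm.edgeWeight_ne_zero hw ()
  have hQ : ∀ (i : T'.Face) (a : T'.Edge), T'.curvature i.1 a.1 = T.curvature i.1 a.1 -
      s * faceWeight X (insert A (insert B κ)) w i.1 *
        edgeWeight (insert A (insert B κ)) w a.1 := fun i a => hcurv i.1 a.1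
  have hdet0 := hm.det_extend φ.edges φ.faces k hQ hy
  have hrank : T'.curvatureMatrix.rank = Fintype.card (Fin r ⊕ Fin 1) := by
    simpa using hm.rank_eq φ.edges φ.faces k hQ hy hψ φ.rank_eq φ.det_ne_zero
  have hdet0' : (T'.curvatureMatrix.submatrix (hm.extendFaces φ.faces k ∘ Sum.inl)
      (hm.extendEdges φ.edges ∘ Sum.inl)).det ≠ 0 := by
    rw [hdet0]
    exact mul_ne_zero φ.det_ne_zero (neg_ne_zero.2 (mul_ne_zero hy hψ))
  -- the choice after the move, indexed like the extension of the choice before the move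
  let e' : (Fin r ⊕ Fin 1) ⊕ Fin m ≃ T'.Edge :=
    (finSumFinEquiv.sumCongr (Equiv.refl _)).trans φ'.edges
  let f' : (Fin r ⊕ Fin 1) ⊕ (Fin d ⊕ Fin 3) ≃ T'.Face :=
    (finSumFinEquiv.sumCongr finSumFinEquiv).trans φ'.faces
  have hdet1 : (T'.curvatureMatrix.submatrix (f' ∘ Sum.inl) (e' ∘ Sum.inl)).det =
      (T'.curvatureMatrix.submatrix (φ'.faces ∘ Sum.inl) (φ'.edges ∘ Sum.inl)).det := by
    rw [← Matrix.det_submatrix_equiv_self finSumFinEquiv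
      (T'.curvatureMatrix.submatrix (φ'.faces ∘ Sum.inl) (φ'.edges ∘ Sum.inl))]
    rfl
  obtain ⟨ε₁, hε₁, h1⟩ := invariant_choice_independent hrank (hm.extendEdges φ.edges) e'
    (hm.extendFaces φ.faces k) f' hdet0' (by rw [hdet1]; exact φ'.det_ne_zero)
  obtain ⟨ε₀, hε₀, h0⟩ := hm.exists_factor hw hs hb hbAB hc₁ c
  refine ⟨ε₁ * ε₀, ?_, ?_⟩
  · rcases hε₁ with rfl | rfl <;> rcases hε₀ with rfl | rfl <;> norm_num
  intro U hU hUD hUΩ h hh v hv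
  have h2 := h1 (Matrix.of fun j a => h j a.1) (Matrix.of fun i j => T'.dS (v i) j) ?_ ?_
  · rw [hdet1] at h2
    have e1 : T'.invariantDev φ' (fun j => T'.onEdges (h j)) (v ∘ finSumFinEquiv.symm) =
        (∏ i : T'.Face, X.volume i.1.out) / (∏ σ : T'.cells 5, X.volume σ.1.out) *
        ((T'.curvatureMatrix.submatrix (φ'.faces ∘ Sum.inl) (φ'.edges ∘ Sum.inl)).det⁻¹ *
        ((Matrix.of fun j (a : T'.Edge) => h j a.1).submatrix id (e' ∘ Sum.inr)).det *
        ((Matrix.of fun i j => T'.dS (v i) j).submatrix id (f' ∘ Sum.inr)).det) := by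
      rw [T'.invariantDev_apply, AlternatingMap.smul_apply, wedgeForms_apply,
        ← Matrix.det_submatrix_equiv_self finSumFinEquiv (Matrix.of fun i j =>
          (LinearMap.proj (φ'.faces (Sum.inr j)) ∘ₗ T'.dS) ((v ∘ finSumFinEquiv.symm) i)),
        smul_eq_mul, mul_assoc, mul_assoc, mul_assoc]
      congr 4
      ext i j
      simp [f']
    have e2 : wedge (T.invariantDev φ fun j => T.onEdges (h j)) (deviationForm b {A, B}) v =
        (∏ i : T.Face, X.volume i.1.out) / (∏ σ : T.cells 5, X.volume σ.1.out) *
        (T.curvatureMatrix.submatrix (φ.faces ∘ Sum.inl) (φ.edges ∘ Sum.inl)).det⁻¹ *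
        (Matrix.of fun i j => T.onEdges (h i) (φ.edges (Sum.inr j))).det *
        wedgeForms (Sum.elim (fun j => LinearMap.proj (φ.faces (Sum.inr j)) ∘ₗ T.dS)
          fun l => (innerₗ E4 (b l)) ∘ₗ LinearMap.proj {A, B}) v := by
      rw [T.invariantDev_apply, ← wedge_wedgeForms, wedge_smul_left]
      rfl
    have e3 := hm.det_dS_extend φ.edges φ.faces k hU hUD hUΩ φ.det_ne_zero hb hbAB hv
    have e4 : ((Matrix.of fun i j => T'.dS (v i) j).submatrix id
        (hm.extendFaces φ.faces k ∘ Sum.inr)).det =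
        (Matrix.of fun i j => T'.dS (v i) (hm.extendFaces φ.faces k (Sum.inr j))).det := rfl
    have e5 : ((Matrix.of fun j (a : T'.Edge) => h j a.1).submatrix id
        (hm.extendEdges φ.edges ∘ Sum.inr)).det =
        (Matrix.of fun i j => T.onEdges (h i) (φ.edges (Sum.inr j))).det := rfl
    have e6 : (Matrix.of fun i l => hm.areaJacobian b (k (Sum.inr i)).1 l).det =
        (Matrix.of fun i l => hm.areaJacobian b (c i).1 l).det := rfl
    have e7 : k (Sum.inl 0) = ⟨c₁, hc₁⟩ := rfl
    rw [e1, h2, e2, hdet0, e4, e3, e5, e6, e7, mul_inv]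
    linear_combination ε₁ *
      (T.curvatureMatrix.submatrix (φ.faces ∘ Sum.inl) (φ.edges ∘ Sum.inl)).det⁻¹ *
      (Matrix.of fun i j => T.onEdges (h i) (φ.edges (Sum.inr j))).det *
      (wedgeForms (Sum.elim (fun j => LinearMap.proj (φ.faces (Sum.inr j)) ∘ₗ T.dS)
          fun l => (innerₗ E4 (b l)) ∘ₗ LinearMap.proj {A, B}) v) * h0
  · ext i j
    have h3 := (T'.mem_ker_dω.1 (hh j)) i
    simp only [← Triangulation.curvatureMatrix_apply] at h3
    exact h3
  · ext i a
    have h3 := (T'.mem_ker_dΩ.1 (hm.dS_mem_ker hw hU hUΩ (hv i))) a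
    simp only [← Triangulation.curvatureMatrix_apply] at h3
    rw [Matrix.mul_apply, Matrix.zero_apply, ← h3]
    exact Finset.sum_congr rfl fun j _ => mul_comm _ _

end IsMove24

end Orbits

end Pachner

end

theorem theorem3 {Γ W : Type*} [Group Γ] [MulAction Γ W] [DecidableEq W]
    (X : Pachner.Development Γ W) (T T' : Pachner.Triangulation X)
    (A B : W) (κ : Finset W) (hmove : Pachner.IsMove24 T T' A B κ)
    (b : Fin 3 → Pachner.E4) (hb : Orthonormal ℝ b)
    (hbAB : ∀ k, inner ℝ (b k) (X.pos B - X.pos A) = 0)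
    (hincl : T.KerSubsetIm) :
    T'.KerSubsetIm ∧
    ∃ r m d : ℕ, Nonempty (T.MinorChoice r m d) ∧ Nonempty (T'.MinorChoice (r + 1) m (d + 3)) ∧
      ∀ (φ : T.MinorChoice r m d) (φ' : T'.MinorChoice (r + 1) m (d + 3)),
        ∃ ε : ℝ, (ε = 1 ∨ ε = -1) ∧
          ∀ U ≤ T.deviations, Disjoint U (LinearMap.ker T.dS) →
            U.map T.dS = LinearMap.ker T.dΩ →
            Disjoint (U ⊔ T'.deviationsAt {A, B}) (LinearMap.ker T'.dS) ∧
            (U ⊔ T'.deviationsAt {A, B}).map T'.dS = LinearMap.ker T'.dΩ ∧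
            ∀ h : Fin m → Pachner.Cell Γ W → ℝ,
              (∀ j, T'.onEdges (h j) ∈ LinearMap.ker T'.dω) →
              (∀ j, T.onEdges (h j) ∈ LinearMap.ker T.dω) ∧
              ∀ w : Fin d ⊕ Fin 3 → Pachner.EdgeField W,
                (∀ k, w k ∈ U ⊔ T'.deviationsAt {A, B}) →
                T'.invariantDev φ' (fun j => T'.onEdges (h j)) (w ∘ finSumFinEquiv.symm) =
                  ε * (72 * X.sqLength {A, B} ^ (5 / 2 : ℝ)) *
                    Pachner.wedge (T.invariantDev φ fun j => T.onEdges (h j))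
                      (Pachner.deviationForm b {A, B}) w := by
  obtain ⟨w, hw⟩ := hmove.exists_weight
  obtain ⟨r, m, d, hφ, hφ'⟩ := hmove.exists_minorChoice
  refine ⟨hmove.kerSubsetIm hw hb hbAB hincl, r, m, d, hφ, hφ', fun φ φ' => ?_⟩
  obtain ⟨ε, hε, h⟩ := hmove.exists_sign_invariantDev hb hbAB φ φ'
  exact ⟨ε, hε, fun U hU hUD hUΩ => ⟨hmove.disjoint_ker_dS hw hb hbAB hU hUD,
    hmove.map_dS_eq_ker hw hb hbAB hU hUΩ, fun η hη =>
      ⟨fun j => hmove.ker_dω_old hw (hη j), h U hU hUD hUΩ η hη⟩⟩⟩
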